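/- **Setting.** Consider smooth nondegenerate metrics (of arbitrary signature) with two commuting orthogonally transitive Killing vectors, written in adapted coordinates as $$\mathbf g=g_{ij}(t)\,dt^i dt^j+h_{kl}(t)\,du^k du^l,\qquad t=(t^1,t^2)\in D\subseteq\mathbb R^2\text{ open},\quad i,j,k,l\in\{1,2\},$$ which satisfy the vacuum Einstein equations $\mathbf{Ric}-\frac12\mathbf R\,\mathbf g+\Lambda\,\mathbf g=0$ with a fixed real $\Lambda$. Put $x=\det h$, $\rho=(dx/x)^2$, $\chi=\frac1x(dh_{11}dh_{22}-dh_{12}^2)$, $\gamma=\chi-\frac14\rho$, and $C_\alpha=g^{ij}\alpha_{ij}$, $Q_\alpha=\det\alpha/\det g$ for a quadratic form $\alpha$. Let $X^i=g^{ij}x_{,j}/x$, $Y=\frac{1}{x\sqrt{|\det g|}}(-x_{,2},\,x_{,1})$, and let $\varepsilon=\operatorname{sgn}\det g$ ($+1$ in the elliptic case, $-1$ in the hyperbolic case). Put $$I_1=-\tfrac14\chi(X,Y),\qquad I_2=-(Q_\gamma+Q_\chi)+\tfrac12C_\gamma(C_\gamma+\tfrac14C_\rho),$$ $$I_3=\tfrac12C_\gamma(Q_\gamma-Q_\chi)+\tfrac14C_\rho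 Q_\gamma,\qquad I_4=\tfrac14C_\gamma^2-Q_\gamma .$$ **(1)** At every point where $C_\rho\ne0$ one has $I_1^2=-\varepsilon\big[(Q_\gamma-Q_\chi)^2-\frac14C_\rho\big(C_\gamma Q_\chi-(C_\gamma+\frac14C_\rho)Q_\gamma\big)\big]$ and $$YC_\rho=-8I_1,\qquad XC_\rho=8(Q_\gamma-Q_\chi)+C_\rho(C_\gamma-\tfrac34C_\rho-4\Lambda),$$ $$\tfrac14C_\gamma I_1XC_\chi-\tfrac12I_1XQ_\gamma+\tfrac12I_2YQ_\gamma-\tfrac12I_3YC_\chi-I_4YQ_\chi=I_1\big[I_4(C_\gamma-\tfrac12C_\rho+4\Lambda)-\tfrac1{16}C_\gamma C_\rho(\tfrac34C_\rho+4\Lambda)\big],$$ $$\tfrac14\varepsilon C_\gamma I_1YC_\chi-\tfrac12\varepsilon I_1YQ_\gamma-\tfrac12I_2XQ_\gamma+\tfrac12I_3XC_\chi+I_4XQ_\chi=I_4\big[(\tfrac12C_\rho+4\Lambda)(Q_\gamma-Q_\chi)+2I_3\big]-\tfrac18I_3C_\rho(\tfrac34C_\rho+4\Lambda).$$ **(2)**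 Let $p=C_\rho$ and $q\in\{C_\chi,Q_\chi,Q_\gamma\}$. Call a metric generic at $t_0\in D$ if, at $t_0$: $C_\rho\ne0$; $C_\gamma^2\ne4Q_\gamma$ (that is, $I_4\neq 0$); the number $$\varepsilon I_1^2a^2+b^2,\quad a=\tfrac14C_\gamma\{C_\chi\}-\tfrac12\{Q_\gamma\},\quad b=\tfrac12I_2\{Q_\gamma\}-\tfrac12I_3\{C_\chi\}-I_4\{Q_\chi\},\quad \{f\}=\frac{\partial(C_\rho,f)}{\partial(t^1,t^2)},$$ is nonzero; and either $Q_\gamma(t_0)\ne0$ or $Q_\gamma$ vanishes identically near $t_0$. (When $p,q$ are local coordinates and the other two invariants are regarded as functions of them, this number is, up to the factor $(\partial(p,q)/\partial(t^1,t^2))^2$, the determinant of the last two relations as a linear system for $Xq,Yq$; thus the four relations fix $Xp,Yp,Xq,Yq$.) Let $\mathbf g=(g,h)$, $\mathbf g'=(g',h')$ be two such vacuum metrics with the same $\Lambda$, $t_0\in D$, $t_0'\in D'$, with $\det g(t_0)\det g'(t_0')>0$ and $\det h(t_0)\det h'(t_0')>0$. Suppose that $\mathbf g$ is generic at $t_0$;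 that $dp\wedge dq\neq0$ at $t_0$ and $dp'\wedge dq'\ne0$ at $t_0'$; that $p(t_0)=p'(t_0')$, $q(t_0)=q'(t_0')$; and that near $t_0$ and $t_0'$, respectively, the other two of the invariants $C_\chi,Q_\chi,Q_\gamma$ are given by the same functions of $(p,q)$ and of $(p',q')$. Then there are a local diffeomorphism $\phi$ with $\phi(t_0)=t_0'$ and a constant matrix $A\in GL_2(\mathbb R)$ such that $\Phi(t,u)=(\phi(t),Au)$ is a local isometry of $\mathbf g$ near $t_0$ either onto $g'_{ij}dt^idt^j+h'_{kl}du^kdu^l$ or onto $g'_{ij}dt^idt^j-h'_{kl}du^kdu^l$. If $h(t_0)$ and $h'(t_0')$ are both positive definite or both negative definite, the first alternative holds. In this sense the values of the other two invariants as functions of $p,q$ determine the metric. -/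

import Mathlib

open scoped ContDiff Matrix Topology

/-! ### Coordinate tensor calculus -/

section Calculus

/-- Partial derivative of `f` in the `i`-th coordinate direction. -/
noncomputable def pd {ι : Type*} [Fintype ι] [DecidableEq ι] (i : ι) (f : (ι → ℝ) → ℝ)
    (y : ι → ℝ) : ℝ :=
  fderiv ℝ f y (Pi.single i 1)

/-- Jacobian matrix `∂Φ^i/∂y^j`. -/
noncomputable def jacobian {ι : Type*} [Fintype ι] [DecidableEq ι]
    (Φ : (ι → ℝ) → (ι → ℝ)) (y : ι → ℝ) : Matrix ι ι ℝ :=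
  Matrix.of fun i j => pd j (fun z => Φ z i) y

/-- Christoffel symbols `Γ^k_{ij}` of the metric with coefficient matrix `G`. -/
noncomputable def christoffel {ι : Type*} [Fintype ι] [DecidableEq ι]
    (G : (ι → ℝ) → Matrix ι ι ℝ) (k i j : ι) (y : ι → ℝ) : ℝ :=
  (1 / 2) * ∑ l, (G y)⁻¹ k l *
    (pd i (fun z => G z l j) y + pd j (fun z => G z l i) y - pd l (fun z => G z i j) y)

/-- Ricci tensor
`R_{ij} = ∂_k Γ^k_{ij} - ∂_j Γ^k_{ik} + Γ^k_{kl} Γ^l_{ij} - Γ^k_{jl} Γ^l_{ik}`. -/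
noncomputable def ricci {ι : Type*} [Fintype ι] [DecidableEq ι]
    (G : (ι → ℝ) → Matrix ι ι ℝ) (y : ι → ℝ) : Matrix ι ι ℝ :=
  Matrix.of fun i j =>
    (∑ k, (pd k (christoffel G k i j) y - pd j (christoffel G k i k) y)) +
    ∑ k, ∑ l, (christoffel G k k l y * christoffel G l i j y
      - christoffel G k j l y * christoffel G l i k y)

/-- Scalar curvature `G^{ij} R_{ij}`. -/
noncomputable def scalarCurvature {ι : Type*} [Fintype ι] [DecidableEq ι]
    (G : (ι → ℝ) → Matrix ι ι ℝ) (y : ι → ℝ) : ℝ :=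
  ∑ i, ∑ j, (G y)⁻¹ i j * ricci G y i j

end Calculus

/-- A metric `𝐠 = g_ij dt^i dt^j + h_kl du^k du^l` with two commuting orthogonally transitive
Killing vectors `∂/∂u^1`, `∂/∂u^2`, written in adapted coordinates `(t^1,t^2,u^1,u^2)`; the
coefficients are smooth functions of `t = (t^1,t^2)` in an open set, and `𝐠` is nondegenerate of
arbitrary signature. -/
structure AdaptedMetric where
  dom : Set (Fin 2 → ℝ)
  g : (Fin 2 → ℝ) → Matrix (Fin 2) (Fin 2) ℝ
  h : (Fin 2 → ℝ) → Matrix (Fin 2) (Fin 2) ℝ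
  isOpen_dom : IsOpen dom
  smooth_g : ∀ i j, ContDiffOn ℝ ∞ (fun t => g t i j) dom
  smooth_h : ∀ i j, ContDiffOn ℝ ∞ (fun t => h t i j) dom
  symm_g : ∀ t ∈ dom, (g t).IsSymm
  symm_h : ∀ t ∈ dom, (h t).IsSymm
  det_g_ne : ∀ t ∈ dom, (g t).det ≠ 0
  det_h_ne : ∀ t ∈ dom, (h t).det ≠ 0

namespace AdaptedMetric

/-- The full four-dimensional metric; coordinates `inl i` are the `t^i`, `inr k` the `u^k`. -/
def full (M : AdaptedMetric) (y : Fin 2 ⊕ Fin 2 → ℝ) :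
    Matrix (Fin 2 ⊕ Fin 2) (Fin 2 ⊕ Fin 2) ℝ :=
  Matrix.fromBlocks (M.g (y ∘ Sum.inl)) 0 0 (M.h (y ∘ Sum.inl))

/-- Einstein's vacuum equations `𝐑𝐢𝐜 - ½ 𝐑 𝐠 + Λ 𝐠 = 0` for the four-dimensional metric. -/
def IsVacuum (M : AdaptedMetric) (Λ : ℝ) : Prop :=
  ∀ y : Fin 2 ⊕ Fin 2 → ℝ, y ∘ Sum.inl ∈ M.dom →
    ricci M.full y - ((1 / 2) * scalarCurvature M.full y) • M.full y + Λ • M.full y = 0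

/-- The metric `g_ij dt^i dt^j - h_kl du^k du^l`. -/
def negH (M : AdaptedMetric) : AdaptedMetric where
  dom := M.dom
  g := M.g
  h := fun t => -M.h t
  isOpen_dom := M.isOpen_dom
  smooth_g := M.smooth_g
  smooth_h := fun i j => (M.smooth_h i j).neg
  symm_g := M.symm_g
  symm_h := fun t ht => (M.symm_h t ht).neg
  det_g_ne := M.det_g_ne
  det_h_ne := fun t ht => by
    have := M.det_h_ne t ht
    simpa [Matrix.det_neg] using this

/-- The map `(t,u) ↦ (φ t, A u)`. -/
def adaptedMap (φ : (Fin 2 → ℝ) → (Fin 2 → ℝ)) (A : Matrix (Fin 2) (Fin 2) ℝ)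
    (y : Fin 2 ⊕ Fin 2 → ℝ) : Fin 2 ⊕ Fin 2 → ℝ :=
  Sum.elim (φ (y ∘ Sum.inl)) (A *ᵥ (y ∘ Sum.inr))

/-- Local equivalence of `M` near `t₀` with `M'` near `t₀'`: a local diffeomorphism `φ` with
`φ t₀ = t₀'` and a constant `A ∈ GL₂` such that `Φ(t,u) = (φ t, A u)` is an isometry,
`𝐠 = Φ^* 𝐠'`. -/
def LocallyEquivalent (M M' : AdaptedMetric) (t₀ t₀' : Fin 2 → ℝ) : Prop :=
  ∃ (φ : OpenPartialHomeomorph (Fin 2 → ℝ) (Fin 2 → ℝ)) (A : GL (Fin 2) ℝ),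
    t₀ ∈ φ.source ∧ φ t₀ = t₀' ∧ φ.source ⊆ M.dom ∧ φ.target ⊆ M'.dom ∧
    ContDiffOn ℝ ∞ φ φ.source ∧ ContDiffOn ℝ ∞ φ.symm φ.target ∧
    ∀ y : Fin 2 ⊕ Fin 2 → ℝ, y ∘ Sum.inl ∈ φ.source →
      M.full y = (jacobian (adaptedMap φ A.1) y)ᵀ * M'.full (adaptedMap φ A.1 y)
        * jacobian (adaptedMap φ A.1) y

/-! ### Invariant quadratic forms, first-order invariants and the invariant frame -/

/-- `x = det h`. -/
noncomputable def x (M : AdaptedMetric) (t : Fin 2 → ℝ) : ℝ := (M.h t).det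

/-- The covector `dx/x`. -/
noncomputable def dlnx (M : AdaptedMetric) (t : Fin 2 → ℝ) (i : Fin 2) : ℝ :=
  pd i M.x t / M.x t

/-- `ρ = (dx/x)²`. -/
noncomputable def rho (M : AdaptedMetric) (t : Fin 2 → ℝ) : Matrix (Fin 2) (Fin 2) ℝ :=
  Matrix.of fun i j => M.dlnx t i * M.dlnx t j

/-- `∂h_kl/∂t^i`. -/
noncomputable def dh (M : AdaptedMetric) (k l i : Fin 2) (t : Fin 2 → ℝ) : ℝ :=
  pd i (fun z => M.h z k l) t

/-- `χ = (dh_11 dh_22 - dh_12 dh_12)/x`. -/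
noncomputable def chi (M : AdaptedMetric) (t : Fin 2 → ℝ) : Matrix (Fin 2) (Fin 2) ℝ :=
  Matrix.of fun i j => 1 / (2 * M.x t) *
    ((M.dh 0 0 i t * M.dh 1 1 j t - M.dh 0 1 j t * M.dh 1 0 i t)
      + (M.dh 0 0 j t * M.dh 1 1 i t - M.dh 0 1 i t * M.dh 1 0 j t))

/-- The Cosgrove form `γ = χ - ¼ ρ`. -/
noncomputable def gamma (M : AdaptedMetric) (t : Fin 2 → ℝ) : Matrix (Fin 2) (Fin 2) ℝ :=
  M.chi t - (1 / 4 : ℝ) • M.rho t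

/-- `C_α = g^{ij} α_ij`. -/
noncomputable def trForm (M : AdaptedMetric)
    (α : (Fin 2 → ℝ) → Matrix (Fin 2) (Fin 2) ℝ) (t : Fin 2 → ℝ) : ℝ :=
  ∑ i, ∑ j, (M.g t)⁻¹ i j * α t i j

/-- `Q_α = det α / det g`. -/
noncomputable def detForm (M : AdaptedMetric)
    (α : (Fin 2 → ℝ) → Matrix (Fin 2) (Fin 2) ℝ) (t : Fin 2 → ℝ) : ℝ :=
  (α t).det / (M.g t).det

noncomputable def Crho (M : AdaptedMetric) : (Fin 2 → ℝ) → ℝ := M.trForm M.rho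
noncomputable def Cchi (M : AdaptedMetric) : (Fin 2 → ℝ) → ℝ := M.trForm M.chi
noncomputable def Cgamma (M : AdaptedMetric) : (Fin 2 → ℝ) → ℝ := M.trForm M.gamma
noncomputable def Qchi (M : AdaptedMetric) : (Fin 2 → ℝ) → ℝ := M.detForm M.chi
noncomputable def Qgamma (M : AdaptedMetric) : (Fin 2 → ℝ) → ℝ := M.detForm M.gamma

/-- The list `C_χ, Q_χ, Q_γ`. -/
noncomputable def inv (M : AdaptedMetric) (k : Fin 3) : (Fin 2 → ℝ) → ℝ :=
  ![M.Cchi, M.Qchi, M.Qgamma] k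

/-- The invariant vector field `X^i = g^{ij} x_{,j}/x`. -/
noncomputable def X (M : AdaptedMetric) (t : Fin 2 → ℝ) : Fin 2 → ℝ :=
  (M.g t)⁻¹ *ᵥ M.dlnx t

/-- The invariant vector field `Y^i = ε^{ij} x_{,j}/(x √|det g|)`, `ε^{12} = -ε^{21} = -1`. -/
noncomputable def Y (M : AdaptedMetric) (t : Fin 2 → ℝ) : Fin 2 → ℝ :=
  ![-(M.dlnx t 1 / √|(M.g t).det|), M.dlnx t 0 / √|(M.g t).det|]

/-- Derivatives `X f` and `Y f` of a function along the invariant frame. -/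
noncomputable def derivX (M : AdaptedMetric) (f : (Fin 2 → ℝ) → ℝ) (t : Fin 2 → ℝ) : ℝ :=
  fderiv ℝ f t (M.X t)
noncomputable def derivY (M : AdaptedMetric) (f : (Fin 2 → ℝ) → ℝ) (t : Fin 2 → ℝ) : ℝ :=
  fderiv ℝ f t (M.Y t)

/-! ### The quantities entering the four linear relations -/

/-- `ε = +1` if `g` is definite (elliptic case), `ε = -1` if `g` is indefinite (hyperbolic). -/
noncomputable def eps (M : AdaptedMetric) (t : Fin 2 → ℝ) : ℝ := Real.sign (M.g t).det

/-- `I₁ = -¼ χ(X,Y)`. -/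
noncomputable def I1 (M : AdaptedMetric) (t : Fin 2 → ℝ) : ℝ :=
  -(1 / 4) * (M.X t ⬝ᵥ (M.chi t *ᵥ M.Y t))

noncomputable def I2 (M : AdaptedMetric) (t : Fin 2 → ℝ) : ℝ :=
  -(M.Qgamma t + M.Qchi t) + (1 / 2) * M.Cgamma t * (M.Cgamma t + (1 / 4) * M.Crho t)

noncomputable def I3 (M : AdaptedMetric) (t : Fin 2 → ℝ) : ℝ :=
  (1 / 2) * M.Cgamma t * (M.Qgamma t - M.Qchi t) + (1 / 4) * M.Crho t * M.Qgamma t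

noncomputable def I4 (M : AdaptedMetric) (t : Fin 2 → ℝ) : ℝ :=
  (1 / 4) * M.Cgamma t ^ 2 - M.Qgamma t

/-- The four linear relations for the derivatives of the first-order invariants along `X`, `Y`,
together with the expression of `I₁²` through the first-order invariants. -/
def VacuumRelations (M : AdaptedMetric) (Λ : ℝ) (t : Fin 2 → ℝ) : Prop :=
  M.I1 t ^ 2 = -M.eps t * ((M.Qgamma t - M.Qchi t) ^ 2 - (1 / 4) * M.Crho t *
      (M.Cgamma t * M.Qchi t - (M.Cgamma t + (1 / 4) * M.Crho t) * M.Qgamma t)) ∧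
  M.derivY M.Crho t = -8 * M.I1 t ∧
  M.derivX M.Crho t = 8 * (M.Qgamma t - M.Qchi t)
      + M.Crho t * (M.Cgamma t - (3 / 4) * M.Crho t - 4 * Λ) ∧
  (1 / 4) * M.Cgamma t * M.I1 t * M.derivX M.Cchi t - (1 / 2) * M.I1 t * M.derivX M.Qgamma t
      + (1 / 2) * M.I2 t * M.derivY M.Qgamma t - (1 / 2) * M.I3 t * M.derivY M.Cchi t
      - M.I4 t * M.derivY M.Qchi t
    = M.I1 t * (M.I4 t * (M.Cgamma t - (1 / 2) * M.Crho t + 4 * Λ)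
      - (1 / 16) * M.Cgamma t * M.Crho t * ((3 / 4) * M.Crho t + 4 * Λ)) ∧
  (1 / 4) * M.eps t * M.Cgamma t * M.I1 t * M.derivY M.Cchi t
      - (1 / 2) * M.eps t * M.I1 t * M.derivY M.Qgamma t
      - (1 / 2) * M.I2 t * M.derivX M.Qgamma t + (1 / 2) * M.I3 t * M.derivX M.Cchi t
      + M.I4 t * M.derivX M.Qchi t
    = M.I4 t * (((1 / 2) * M.Crho t + 4 * Λ) * (M.Qgamma t - M.Qchi t) + 2 * M.I3 t)
      - (1 / 8) * M.I3 t * M.Crho t * ((3 / 4) * M.Crho t + 4 * Λ)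

/-! ### Genericity -/

/-- The Jacobian determinant `∂(a,b)/∂(t^1,t^2)`. -/
noncomputable def jac (a b : (Fin 2 → ℝ) → ℝ) (t : Fin 2 → ℝ) : ℝ :=
  pd 0 a t * pd 1 b t - pd 1 a t * pd 0 b t

/-- Determinant of the last two vacuum relations as a linear system for `(X q, Y q)`.
If `p = C_ρ` and `q` are local coordinates and `C_χ, Q_χ, Q_γ` are regarded as functions of
`(p,q)`, then `∂f/∂q = jac p f / jac p q`, and by the chain rule the coefficients of `X q, Y q` in
these relations form the matrix below divided by `jac p q`. The condition that the determinant be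
nonzero thus does not depend on `q`. -/
noncomputable def solvDet (M : AdaptedMetric) (t : Fin 2 → ℝ) : ℝ :=
  let a := (1 / 4) * M.Cgamma t * jac M.Crho M.Cchi t - (1 / 2) * jac M.Crho M.Qgamma t
  let b := (1 / 2) * M.I2 t * jac M.Crho M.Qgamma t - (1 / 2) * M.I3 t * jac M.Crho M.Cchi t
    - M.I4 t * jac M.Crho M.Qchi t
  (!![M.I1 t * a, b; -b, M.eps t * M.I1 t * a]).det

/-- Genericity of `M` at a point: `C_ρ ≠ 0`, `C_γ² ≠ 4 Q_γ`, the vacuum relations can be solved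
for the derivatives of the second coordinate, and `Q_γ` is either nonzero or
identically zero near the point. -/
def IsGenericAt (M : AdaptedMetric) (t : Fin 2 → ℝ) : Prop :=
  M.Crho t ≠ 0 ∧ M.Cgamma t ^ 2 ≠ 4 * M.Qgamma t ∧ M.solvDet t ≠ 0 ∧
    (M.Qgamma t ≠ 0 ∨ ∀ᶠ s in 𝓝 t, M.Qgamma s = 0)

end AdaptedMetric

/-! ### Partial derivatives -/

section PartialDerivatives

variable {ι κ : Type*} [Fintype ι] [DecidableEq ι] [Fintype κ] [DecidableEq κ]

/-! Part (1). For the block metric the Ricci tensor splits. The equations along the orbits are a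
wave equation for h (`box_h`). Those transversal to the orbits give the covariant Hessian of ln x up
to a multiple of g, because a two-dimensional Ricci tensor is a multiple of the metric; the trace of
the wave equation fixes that multiple (`hessLnx_vacuum`). Since xχ is the polarised determinant of
dh, the wave equation also yields a contracted Codazzi equation for χ (`codazzi`). Write p = C_ρ and
use the orthogonal frame X, Y with g(X,X) = p, g(Y,Y) = εp. The Hessian gives XC_ρ and YC_ρ. The
derivatives of C_χ, Q_χ, Q_γ along X and Y are affine in the six frame components of ∇χ, and the
last two relations are combinations into which ∇χ enters only through the two components of the
Codazzi equation (`relations_of_frame_components`).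

Part (2). Let φ identify the coordinates (p,q) with (p',q'); then all four invariants agree. I₁² is
a function of them and genericity forces I₁ ≠ 0, so I₁ agrees up to a locally constant sign. The
four relations are linear and uniquely solvable for the frame, and they are unchanged under (I₁,Y) ↦
(−I₁,−Y); hence φ carries X to X' and Y to ±Y' (`frame_matching`). The frame together with p gives
g; g and X give dx/x; the invariants together with I₁ give the frame components of χ. Thus g, dx/x
and χ are matched, and det h is matched up to a constant factor c.

It remains to recover h. Regard it as a surface in the three-dimensional space of symmetric matrices
with the quadratic form det. The inner products of h and its first derivatives are x, x(dx/x)/2 and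
xχ, so the two surfaces have proportional Gram data. If Q_γ ≠ 0, then h and its two derivatives form
a moving frame whose connection coefficients follow from the Gram data, and the surfaces differ by a
constant similarity (`exists_linear_of_nondegenerate`). If Q_γ vanishes identically, these vectors
are dependent; the wave equation puts the second derivatives into the same plane
(`triple_hvec_second`), and a normal to it completes the frame (`exists_linear_of_degenerate`).
Finally, a similarity of det with positive factor has the form h ↦ ±P h Pᵀ
(`exists_congruence_of_similarity`), which is the origin of the two alternatives. -/

theorem pd_congr {i : ι} {f f' : (ι → ℝ) → ℝ} {y : ι → ℝ} (h : f =ᶠ[𝓝 y] f') :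
    pd i f y = pd i f' y := by
  unfold pd; rw [h.fderiv_eq]

theorem pd_congr_of_isOpen {i : ι} {f f' : (ι → ℝ) → ℝ} {U : Set (ι → ℝ)} (hU : IsOpen U)
    (h : ∀ z ∈ U, f z = f' z) {y : ι → ℝ} (hy : y ∈ U) : pd i f y = pd i f' y :=
  pd_congr (Filter.eventuallyEq_of_mem (hU.mem_nhds hy) h)

@[simp] theorem pd_const (i : ι) (a : ℝ) (y : ι → ℝ) : pd i (fun _ => a) y = 0 := by
  simp [pd]

theorem pd_add {i : ι} {f f' : (ι → ℝ) → ℝ} {y : ι → ℝ} (hf : DifferentiableAt ℝ f y)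
    (hf' : DifferentiableAt ℝ f' y) :
    pd i (fun z => f z + f' z) y = pd i f y + pd i f' y := by
  simp [pd, fderiv_fun_add hf hf']

theorem pd_sub {i : ι} {f f' : (ι → ℝ) → ℝ} {y : ι → ℝ} (hf : DifferentiableAt ℝ f y)
    (hf' : DifferentiableAt ℝ f' y) :
    pd i (fun z => f z - f' z) y = pd i f y - pd i f' y := by
  simp [pd, fderiv_fun_sub hf hf']

theorem pd_neg {i : ι} {f : (ι → ℝ) → ℝ} {y : ι → ℝ} :
    pd i (fun z => - f z) y = - pd i f y := by
  simp [pd, fderiv_fun_neg]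

theorem pd_mul {i : ι} {f f' : (ι → ℝ) → ℝ} {y : ι → ℝ} (hf : DifferentiableAt ℝ f y)
    (hf' : DifferentiableAt ℝ f' y) :
    pd i (fun z => f z * f' z) y = pd i f y * f' y + f y * pd i f' y := by
  simp [pd, fderiv_fun_mul hf hf']; ring

theorem pd_const_mul {i : ι} {f : (ι → ℝ) → ℝ} {y : ι → ℝ} (a : ℝ)
    (hf : DifferentiableAt ℝ f y) : pd i (fun z => a * f z) y = a * pd i f y := by
  rw [pd_mul (by fun_prop) hf]; simp

theorem pd_inv {i : ι} {f : (ι → ℝ) → ℝ} {y : ι → ℝ} (hf : DifferentiableAt ℝ f y)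
    (h0 : f y ≠ 0) : pd i (fun z => (f z)⁻¹) y = - pd i f y * (f y)⁻¹ ^ 2 := by
  have := ((hasDerivAt_inv h0).comp_hasFDerivAt y hf.hasFDerivAt).fderiv
  simp only [pd]
  rw [show (fun z => (f z)⁻¹) = Inv.inv ∘ f from rfl, this]
  simp; ring

theorem pd_div {i : ι} {f f' : (ι → ℝ) → ℝ} {y : ι → ℝ} (hf : DifferentiableAt ℝ f y)
    (hf' : DifferentiableAt ℝ f' y) (h0 : f' y ≠ 0) :
    pd i (fun z => f z / f' z) y = (pd i f y - f y / f' y * pd i f' y) / f' y := by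
  simp only [div_eq_mul_inv]
  rw [pd_mul (f' := fun z => (f' z)⁻¹) hf (hf'.inv h0), pd_inv hf' h0]
  field_simp; ring

theorem pd_sum {i : ι} {α : Type*} (s : Finset α) {f : α → (ι → ℝ) → ℝ} {y : ι → ℝ}
    (hf : ∀ a ∈ s, DifferentiableAt ℝ (f a) y) :
    pd i (fun z => ∑ a ∈ s, f a z) y = ∑ a ∈ s, pd i (f a) y := by
  simp [pd, fderiv_fun_sum hf]

theorem ContDiffOn.pd {f : (ι → ℝ) → ℝ} {U : Set (ι → ℝ)} (hf : ContDiffOn ℝ ∞ f U)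
    (hU : IsOpen U) (i : ι) : ContDiffOn ℝ ∞ (pd i f) U := by
  have := hf.fderiv_of_isOpen hU (m := ∞) (by simp)
  exact this.clm_apply contDiffOn_const

omit [DecidableEq ι] in
theorem ContDiffOn.differentiableAt_of_isOpen {f : (ι → ℝ) → ℝ} {U : Set (ι → ℝ)}
    (hf : ContDiffOn ℝ ∞ f U) (hU : IsOpen U) {y : ι → ℝ} (hy : y ∈ U) :
    DifferentiableAt ℝ f y :=
  (hf.contDiffAt (hU.mem_nhds hy)).differentiableAt (by simp)

theorem pd_comm {f : (ι → ℝ) → ℝ} {U : Set (ι → ℝ)} (hf : ContDiffOn ℝ ∞ f U)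
    (hU : IsOpen U) {y : ι → ℝ} (hy : y ∈ U) (i j : ι) :
    pd i (pd j f) y = pd j (pd i f) y := by
  have hc := hf.contDiffAt (hU.mem_nhds hy)
  have hs : IsSymmSndFDerivAt ℝ f y := hc.isSymmSndFDerivAt (by simpa using WithTop.coe_le_coe.2 (le_top : (2 : ℕ∞) ≤ ⊤))
  have hd : DifferentiableAt ℝ (fderiv ℝ f) y :=
    ((hf.fderiv_of_isOpen hU (m := ∞) (by simp)).contDiffAt
      (hU.mem_nhds hy)).differentiableAt (by simp)
  have key : ∀ a b : ι, pd a (pd b f) y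
      = fderiv ℝ (fderiv ℝ f) y (Pi.single a 1) (Pi.single b 1) := by
    intro a b
    unfold _root_.pd
    rw [fderiv_clm_apply hd (by fun_prop)]
    simp
  rw [key, key, hs]

theorem fderiv_eq_sum_pd (f : (ι → ℝ) → ℝ) (y v : ι → ℝ) :
    fderiv ℝ f y v = ∑ i, v i * pd i f y := by
  conv_lhs => rw [← Finset.univ_sum_single v]
  rw [map_sum]
  refine Finset.sum_congr rfl fun i _ => ?_
  unfold pd
  rw [← smul_eq_mul, ← map_smul, ← Pi.single_smul]
  simp

/-- Restriction to the first block of variables. -/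
theorem pd_comp_inl_inl {f : (ι → ℝ) → ℝ} {y : ι ⊕ κ → ℝ}
    (hf : DifferentiableAt ℝ f (y ∘ Sum.inl)) (i : ι) :
    pd (Sum.inl i) (fun z : ι ⊕ κ → ℝ => f (z ∘ Sum.inl)) y = pd i f (y ∘ Sum.inl) := by
  let L : (ι ⊕ κ → ℝ) →L[ℝ] (ι → ℝ) :=
    ContinuousLinearMap.pi fun i => ContinuousLinearMap.proj (Sum.inl i)
  have : fderiv ℝ (fun z : ι ⊕ κ → ℝ => f (z ∘ Sum.inl)) y
      = (fderiv ℝ f (y ∘ Sum.inl)).comp L :=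
    (HasFDerivAt.comp (g := f) (f := L) y (hf.hasFDerivAt) L.hasFDerivAt).fderiv
  have h0 : L (Pi.single (Sum.inl i) 1) = Pi.single i 1 := by
    ext j
    simp [L, Pi.single_apply]
  simp [pd, this, h0]

theorem pd_comp_inl_inr {f : (ι → ℝ) → ℝ} {y : ι ⊕ κ → ℝ}
    (hf : DifferentiableAt ℝ f (y ∘ Sum.inl)) (k : κ) :
    pd (Sum.inr k) (fun z : ι ⊕ κ → ℝ => f (z ∘ Sum.inl)) y = 0 := by
  let L : (ι ⊕ κ → ℝ) →L[ℝ] (ι → ℝ) :=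
    ContinuousLinearMap.pi fun i => ContinuousLinearMap.proj (Sum.inl i)
  have : fderiv ℝ (fun z : ι ⊕ κ → ℝ => f (z ∘ Sum.inl)) y
      = (fderiv ℝ f (y ∘ Sum.inl)).comp L :=
    (HasFDerivAt.comp (g := f) (f := L) y (hf.hasFDerivAt) L.hasFDerivAt).fderiv
  unfold pd
  rw [this]
  have h0 : L (Pi.single (Sum.inr k) 1) = 0 := by
    ext j
    simp [L]
  simp [h0]

end PartialDerivatives

namespace AdaptedMetric

variable (M : AdaptedMetric)

/-! ### Smoothness of the data of an adapted metric -/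

theorem inv_g_apply {t : Fin 2 → ℝ} :
    (M.g t)⁻¹ = ((M.g t).det)⁻¹ • !![M.g t 1 1, -M.g t 0 1; -M.g t 1 0, M.g t 0 0] := by
  rw [Matrix.inv_def, Matrix.adjugate_fin_two, Ring.inverse_eq_inv']

theorem smooth_det_g : ContDiffOn ℝ ∞ (fun t => (M.g t).det) M.dom := by
  simp only [Matrix.det_fin_two]
  exact ((M.smooth_g 0 0).mul (M.smooth_g 1 1)).sub ((M.smooth_g 0 1).mul (M.smooth_g 1 0))

theorem smooth_x : ContDiffOn ℝ ∞ M.x M.dom := by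
  have : M.x = fun t => M.h t 0 0 * M.h t 1 1 - M.h t 0 1 * M.h t 1 0 := by
    funext t; simp [x, Matrix.det_fin_two]
  rw [this]
  exact ((M.smooth_h 0 0).mul (M.smooth_h 1 1)).sub ((M.smooth_h 0 1).mul (M.smooth_h 1 0))

theorem smooth_inv_g (i j : Fin 2) : ContDiffOn ℝ ∞ (fun t => (M.g t)⁻¹ i j) M.dom := by
  have h : ∀ (i j : Fin 2), ContDiffOn ℝ ∞ (fun t => ((M.g t).det)⁻¹ * M.g t i j) M.dom :=
    fun i j => (M.smooth_det_g.inv M.det_g_ne).mul (M.smooth_g i j)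
  simp only [inv_g_apply]
  fin_cases i <;> fin_cases j <;> simp
  · exact h 1 1
  · exact (h 0 1).neg
  · exact (h 1 0).neg
  · exact h 0 0

theorem smooth_inv_h (i j : Fin 2) : ContDiffOn ℝ ∞ (fun t => (M.h t)⁻¹ i j) M.dom := by
  have h : ∀ (i j : Fin 2), ContDiffOn ℝ ∞ (fun t => ((M.h t).det)⁻¹ * M.h t i j) M.dom :=
    fun i j => (M.smooth_x.inv M.det_h_ne).mul (M.smooth_h i j)
  simp only [Matrix.inv_def, Matrix.adjugate_fin_two, Ring.inverse_eq_inv']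
  fin_cases i <;> fin_cases j <;> simp
  · exact h 1 1
  · exact (h 0 1).neg
  · exact (h 1 0).neg
  · exact h 0 0

theorem smooth_dh (k l i : Fin 2) : ContDiffOn ℝ ∞ (M.dh k l i) M.dom :=
  (M.smooth_h k l).pd M.isOpen_dom i

theorem smooth_dlnx (i : Fin 2) : ContDiffOn ℝ ∞ (fun t => M.dlnx t i) M.dom :=
  (M.smooth_x.pd M.isOpen_dom i).div M.smooth_x M.det_h_ne

theorem smooth_christoffel_g (k i j : Fin 2) :
    ContDiffOn ℝ ∞ (christoffel M.g k i j) M.dom := by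
  unfold christoffel
  refine contDiffOn_const.mul (ContDiffOn.sum fun l _ => (M.smooth_inv_g k l).mul ?_)
  exact ((((M.smooth_g l j).pd M.isOpen_dom i).add
    ((M.smooth_g l i).pd M.isOpen_dom j)).sub ((M.smooth_g i j).pd M.isOpen_dom l))

theorem smooth_chi (i j : Fin 2) : ContDiffOn ℝ ∞ (fun t => M.chi t i j) M.dom := by
  simp only [chi, Matrix.of_apply]
  have s := M.smooth_dh
  refine (contDiffOn_const.div (contDiffOn_const.mul M.smooth_x) ?_).mul ?_
  · intro t ht; simpa using show M.x t ≠ 0 from M.det_h_ne t ht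
  · exact (((s _ _ _).mul (s _ _ _)).sub ((s _ _ _).mul (s _ _ _))).add
      (((s _ _ _).mul (s _ _ _)).sub ((s _ _ _).mul (s _ _ _)))

theorem smooth_rho (i j : Fin 2) : ContDiffOn ℝ ∞ (fun t => M.rho t i j) M.dom :=
  (M.smooth_dlnx i).mul (M.smooth_dlnx j)

theorem smooth_gamma (i j : Fin 2) : ContDiffOn ℝ ∞ (fun t => M.gamma t i j) M.dom :=
  (M.smooth_chi i j).sub (contDiffOn_const.mul (M.smooth_rho i j))

theorem smooth_trForm {α : (Fin 2 → ℝ) → Matrix (Fin 2) (Fin 2) ℝ}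
    (h : ∀ i j, ContDiffOn ℝ ∞ (fun t => α t i j) M.dom) :
    ContDiffOn ℝ ∞ (M.trForm α) M.dom :=
  ContDiffOn.sum fun i _ => ContDiffOn.sum fun j _ => (M.smooth_inv_g i j).mul (h i j)

theorem smooth_detForm {α : (Fin 2 → ℝ) → Matrix (Fin 2) (Fin 2) ℝ}
    (h : ∀ i j, ContDiffOn ℝ ∞ (fun t => α t i j) M.dom) :
    ContDiffOn ℝ ∞ (M.detForm α) M.dom := by
  refine ContDiffOn.div ?_ M.smooth_det_g M.det_g_ne
  simp only [Matrix.det_fin_two]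
  exact ((h 0 0).mul (h 1 1)).sub ((h 0 1).mul (h 1 0))

theorem smooth_Crho : ContDiffOn ℝ ∞ M.Crho M.dom := M.smooth_trForm M.smooth_rho
theorem smooth_Cchi : ContDiffOn ℝ ∞ M.Cchi M.dom := M.smooth_trForm M.smooth_chi
theorem smooth_Cgamma : ContDiffOn ℝ ∞ M.Cgamma M.dom := M.smooth_trForm M.smooth_gamma
theorem smooth_Qchi : ContDiffOn ℝ ∞ M.Qchi M.dom := M.smooth_detForm M.smooth_chi
theorem smooth_Qgamma : ContDiffOn ℝ ∞ M.Qgamma M.dom := M.smooth_detForm M.smooth_gamma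

theorem smooth_inv (k : Fin 3) : ContDiffOn ℝ ∞ (M.inv k) M.dom := by
  fin_cases k
  exacts [M.smooth_Cchi, M.smooth_Qchi, M.smooth_Qgamma]

variable {M}

theorem _root_.ContDiffOn.differentiableAt_dom {f : (Fin 2 → ℝ) → ℝ}
    (hf : ContDiffOn ℝ ∞ f M.dom) {t : Fin 2 → ℝ} (ht : t ∈ M.dom) : DifferentiableAt ℝ f t :=
  hf.differentiableAt_of_isOpen M.isOpen_dom ht

/-! ### Christoffel symbols of the full metric -/

theorem isOpen_dom_inl : IsOpen {y : Fin 2 ⊕ Fin 2 → ℝ | y ∘ Sum.inl ∈ M.dom} :=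
  M.isOpen_dom.preimage (by fun_prop)

theorem inv_full {y : Fin 2 ⊕ Fin 2 → ℝ} (hy : y ∘ Sum.inl ∈ M.dom) :
    (M.full y)⁻¹ = Matrix.fromBlocks (M.g (y ∘ Sum.inl))⁻¹ 0 0 (M.h (y ∘ Sum.inl))⁻¹ := by
  apply Matrix.inv_eq_right_inv
  rw [full, Matrix.fromBlocks_multiply]
  simp [Matrix.mul_nonsing_inv _ (isUnit_iff_ne_zero.mpr (M.det_g_ne _ hy)),
    Matrix.mul_nonsing_inv _ (isUnit_iff_ne_zero.mpr (M.det_h_ne _ hy))]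

theorem pd_full_inr {y : Fin 2 ⊕ Fin 2 → ℝ} (hy : y ∘ Sum.inl ∈ M.dom) (k : Fin 2)
    (a b : Fin 2 ⊕ Fin 2) : pd (Sum.inr k) (fun z => M.full z a b) y = 0 := by
  rcases a with a | a <;> rcases b with b | b
  · exact pd_comp_inl_inr ((M.smooth_g a b).differentiableAt_dom hy) k
  · exact pd_const _ _ _
  · exact pd_const _ _ _
  · exact pd_comp_inl_inr ((M.smooth_h a b).differentiableAt_dom hy) k

theorem pd_full_g {y : Fin 2 ⊕ Fin 2 → ℝ} (hy : y ∘ Sum.inl ∈ M.dom) (i a b : Fin 2) :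
    pd (Sum.inl i) (fun z => M.full z (Sum.inl a) (Sum.inl b)) y
      = pd i (fun t => M.g t a b) (y ∘ Sum.inl) :=
  pd_comp_inl_inl ((M.smooth_g a b).differentiableAt_dom hy) i

theorem pd_full_h {y : Fin 2 ⊕ Fin 2 → ℝ} (hy : y ∘ Sum.inl ∈ M.dom) (i a b : Fin 2) :
    pd (Sum.inl i) (fun z => M.full z (Sum.inr a) (Sum.inr b)) y
      = M.dh a b i (y ∘ Sum.inl) :=
  pd_comp_inl_inl ((M.smooth_h a b).differentiableAt_dom hy) i

theorem pd_full_inl_inr {y : Fin 2 ⊕ Fin 2 → ℝ} (i : Fin 2 ⊕ Fin 2) (a b : Fin 2) :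
    pd i (fun z => M.full z (Sum.inl a) (Sum.inr b)) y = 0 := pd_const _ _ _

theorem pd_full_inr_inl {y : Fin 2 ⊕ Fin 2 → ℝ} (i : Fin 2 ⊕ Fin 2) (a b : Fin 2) :
    pd i (fun z => M.full z (Sum.inr a) (Sum.inl b)) y = 0 := pd_const _ _ _

/-- The mixed block `½ h^{km} ∂_a h_{ml}` of the Christoffel symbols. -/
noncomputable def hConn (M : AdaptedMetric) (k a l : Fin 2) (t : Fin 2 → ℝ) : ℝ :=
  (1 / 2) * ∑ m, (M.h t)⁻¹ k m * M.dh m l a t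

/-- The vertical block `-½ g^{cd} ∂_d h_{kl}` of the Christoffel symbols. -/
noncomputable def gradH (M : AdaptedMetric) (c k l : Fin 2) (t : Fin 2 → ℝ) : ℝ :=
  -(1 / 2) * ∑ d, (M.g t)⁻¹ c d * M.dh k l d t

theorem smooth_hConn (k a l : Fin 2) : ContDiffOn ℝ ∞ (M.hConn k a l) M.dom :=
  contDiffOn_const.mul (ContDiffOn.sum fun m _ => (M.smooth_inv_h k m).mul (M.smooth_dh m l a))

theorem smooth_gradH (c k l : Fin 2) : ContDiffOn ℝ ∞ (M.gradH c k l) M.dom :=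
  contDiffOn_const.mul (ContDiffOn.sum fun m _ => (M.smooth_inv_g c m).mul (M.smooth_dh k l m))

section Christoffel

variable {y : Fin 2 ⊕ Fin 2 → ℝ} (hy : y ∘ Sum.inl ∈ M.dom) (a b c k l m : Fin 2)
include hy

theorem christoffel_full_ggg :
    christoffel M.full (Sum.inl c) (Sum.inl a) (Sum.inl b) y
      = christoffel M.g c a b (y ∘ Sum.inl) := by
  simp [christoffel, inv_full hy, pd_full_g hy]

theorem christoffel_full_ggh :
    christoffel M.full (Sum.inl c) (Sum.inl a) (Sum.inr k) y = 0 := by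
  simp [christoffel, inv_full hy, pd_full_inr hy, pd_full_inl_inr]

theorem christoffel_full_ghg :
    christoffel M.full (Sum.inl c) (Sum.inr k) (Sum.inl a) y = 0 := by
  simp [christoffel, inv_full hy, pd_full_inr hy, pd_full_inl_inr, pd_full_inr_inl]

theorem christoffel_full_ghh :
    christoffel M.full (Sum.inl c) (Sum.inr k) (Sum.inr l) y = M.gradH c k l (y ∘ Sum.inl) := by
  simp [christoffel, gradH, inv_full hy, pd_full_inr hy, pd_full_h hy]
  ring

theorem christoffel_full_hgg :
    christoffel M.full (Sum.inr k) (Sum.inl a) (Sum.inl b) y = 0 := by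
  simp [christoffel, inv_full hy, pd_full_inr hy, pd_full_inr_inl]

theorem christoffel_full_hgh :
    christoffel M.full (Sum.inr k) (Sum.inl a) (Sum.inr l) y = M.hConn k a l (y ∘ Sum.inl) := by
  simp [christoffel, hConn, inv_full hy, pd_full_inr hy, pd_full_h hy, pd_full_inl_inr]

theorem christoffel_full_hhg :
    christoffel M.full (Sum.inr k) (Sum.inr l) (Sum.inl a) y = M.hConn k a l (y ∘ Sum.inl) := by
  simp [christoffel, hConn, inv_full hy, pd_full_inr hy, pd_full_h hy, pd_full_inr_inl]

theorem christoffel_full_hhh :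
    christoffel M.full (Sum.inr k) (Sum.inr l) (Sum.inr m) y = 0 := by
  simp [christoffel, inv_full hy, pd_full_inr hy]

end Christoffel

/-! ### Ricci tensor of the block metric -/

section Ricci

variable {y : Fin 2 ⊕ Fin 2 → ℝ} (hy : y ∘ Sum.inl ∈ M.dom)
include hy

theorem pd_christoffel_full_inr (k : Fin 2) (a b c : Fin 2 ⊕ Fin 2) :
    pd (Sum.inr k) (christoffel M.full a b c) y = 0 := by
  rcases a with a | a <;> rcases b with b | b <;> rcases c with c | c
  · rw [pd_congr_of_isOpen isOpen_dom_inl (fun z hz => christoffel_full_ggg hz _ _ _) hy]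
    exact pd_comp_inl_inr ((M.smooth_christoffel_g _ _ _).differentiableAt_dom hy) _
  · rw [pd_congr_of_isOpen isOpen_dom_inl (fun z hz => christoffel_full_ggh hz _ _ _) hy]
    simp
  · rw [pd_congr_of_isOpen isOpen_dom_inl (fun z hz => christoffel_full_ghg hz _ _ _) hy]
    simp
  · rw [pd_congr_of_isOpen isOpen_dom_inl (fun z hz => christoffel_full_ghh hz _ _ _) hy]
    exact pd_comp_inl_inr ((smooth_gradH _ _ _).differentiableAt_dom hy) _
  · rw [pd_congr_of_isOpen isOpen_dom_inl (fun z hz => christoffel_full_hgg hz _ _ _) hy]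
    simp
  · rw [pd_congr_of_isOpen isOpen_dom_inl (fun z hz => christoffel_full_hgh hz _ _ _) hy]
    exact pd_comp_inl_inr ((smooth_hConn _ _ _).differentiableAt_dom hy) _
  · rw [pd_congr_of_isOpen isOpen_dom_inl (fun z hz => christoffel_full_hhg hz _ _ _) hy]
    exact pd_comp_inl_inr ((smooth_hConn _ _ _).differentiableAt_dom hy) _
  · rw [pd_congr_of_isOpen isOpen_dom_inl (fun z hz => christoffel_full_hhh hz _ _ _) hy]
    simp

theorem pd_christoffel_full_ggg (i a b c : Fin 2) :
    pd (Sum.inl i) (christoffel M.full (Sum.inl c) (Sum.inl a) (Sum.inl b)) y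
      = pd i (christoffel M.g c a b) (y ∘ Sum.inl) := by
  rw [pd_congr_of_isOpen isOpen_dom_inl (fun z hz => christoffel_full_ggg hz _ _ _) hy]
  exact pd_comp_inl_inl ((M.smooth_christoffel_g _ _ _).differentiableAt_dom hy) _

theorem pd_christoffel_full_ghh (i c k l : Fin 2) :
    pd (Sum.inl i) (christoffel M.full (Sum.inl c) (Sum.inr k) (Sum.inr l)) y
      = pd i (M.gradH c k l) (y ∘ Sum.inl) := by
  rw [pd_congr_of_isOpen isOpen_dom_inl (fun z hz => christoffel_full_ghh hz _ _ _) hy]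
  exact pd_comp_inl_inl ((smooth_gradH _ _ _).differentiableAt_dom hy) _

theorem pd_christoffel_full_hgh (i a k l : Fin 2) :
    pd (Sum.inl i) (christoffel M.full (Sum.inr k) (Sum.inl a) (Sum.inr l)) y
      = pd i (M.hConn k a l) (y ∘ Sum.inl) := by
  rw [pd_congr_of_isOpen isOpen_dom_inl (fun z hz => christoffel_full_hgh hz _ _ _) hy]
  exact pd_comp_inl_inl ((smooth_hConn _ _ _).differentiableAt_dom hy) _

theorem ricci_full_inl (i j : Fin 2) :
    ricci M.full y (Sum.inl i) (Sum.inl j) = ricci M.g (y ∘ Sum.inl) i j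
      - ∑ k, pd j (M.hConn k i k) (y ∘ Sum.inl)
      + ∑ k, ∑ l, M.hConn k l k (y ∘ Sum.inl) * christoffel M.g l i j (y ∘ Sum.inl)
      - ∑ k, ∑ l, M.hConn k j l (y ∘ Sum.inl) * M.hConn l i k (y ∘ Sum.inl) := by
  simp only [ricci, Matrix.of_apply, Fintype.sum_sum_type, pd_christoffel_full_ggg hy,
    pd_christoffel_full_hgh hy, pd_christoffel_full_inr hy, christoffel_full_ggg hy,
    christoffel_full_ggh hy, christoffel_full_hgg hy, christoffel_full_hgh hy, christoffel_full_hhg hy, christoffel_full_hhh hy]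
  simp only [Fin.sum_univ_two]
  ring

theorem ricci_full_inr (k l : Fin 2) :
    ricci M.full y (Sum.inr k) (Sum.inr l) = ∑ c, pd c (M.gradH c k l) (y ∘ Sum.inl)
      + ∑ c, (∑ d, christoffel M.g d d c (y ∘ Sum.inl) + ∑ m, M.hConn m c m (y ∘ Sum.inl))
          * M.gradH c k l (y ∘ Sum.inl)
      - ∑ c, ∑ m, (M.gradH c k m (y ∘ Sum.inl) * M.hConn m c l (y ∘ Sum.inl)
          + M.gradH c l m (y ∘ Sum.inl) * M.hConn m c k (y ∘ Sum.inl)) := by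
  simp only [ricci, Matrix.of_apply, Fintype.sum_sum_type, pd_christoffel_full_ghh hy,
    pd_christoffel_full_inr hy, christoffel_full_ggg hy, christoffel_full_ghh hy,
    christoffel_full_ggh hy, christoffel_full_ghg hy, christoffel_full_hhg hy, christoffel_full_hhh hy]
  simp only [Fin.sum_univ_two]
  ring

end Ricci

/-- In dimension four the trace of the field equations reads −R + 4Λ = 0, so ½R − Λ equals Λ. -/
theorem IsVacuum.ricci_eq {Λ : ℝ} (hM : M.IsVacuum Λ) {y : Fin 2 ⊕ Fin 2 → ℝ}
    (hy : y ∘ Sum.inl ∈ M.dom) (a b : Fin 2 ⊕ Fin 2) :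
    ricci M.full y a b = Λ * M.full y a b := by
  have h := hM y hy
  have hdet : IsUnit (M.full y).det := by
    rw [full, Matrix.det_fromBlocks_zero₂₁]
    exact isUnit_iff_ne_zero.mpr (mul_ne_zero (M.det_g_ne _ hy) (M.det_h_ne _ hy))
  have hsymm : (M.full y).IsSymm := by
    rw [full]
    exact Matrix.IsSymm.fromBlocks (M.symm_g _ hy) (by simp) (M.symm_h _ hy)
  have htr : ∑ i, ∑ j, (M.full y)⁻¹ i j * M.full y i j = 4 := by
    have h1 : ∑ i, ∑ j, (M.full y)⁻¹ i j * M.full y i j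
        = ((M.full y)⁻¹ * (M.full y)ᵀ).trace := by
      simp [Matrix.trace, Matrix.mul_apply]
    rw [h1, hsymm, Matrix.nonsing_inv_mul _ hdet]
    simp
  have hent : ∀ i j, ricci M.full y i j
      = (1 / 2 * scalarCurvature M.full y - Λ) * M.full y i j := by
    intro i j
    have := congrFun (congrFun h i) j
    simp at this
    linarith
  have hs : scalarCurvature M.full y = (1 / 2 * scalarCurvature M.full y - Λ) * 4 := by
    conv_lhs => rw [scalarCurvature]
    rw [← htr, Finset.mul_sum]
    refine Finset.sum_congr rfl fun i _ => ?_
    rw [Finset.mul_sum]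
    refine Finset.sum_congr rfl fun j _ => ?_
    rw [hent]; ring
  rw [hent]
  congr 1
  linarith

end AdaptedMetric

/-! ### Calculus of the two-dimensional metric g -/

namespace AdaptedMetric

variable {M : AdaptedMetric} {t : Fin 2 → ℝ} (ht : t ∈ M.dom)

theorem pd_pd_comm {f : (Fin 2 → ℝ) → ℝ} (hf : ContDiffOn ℝ ∞ f M.dom) (ht : t ∈ M.dom) :
    pd 1 (pd 0 f) t = pd 0 (pd 1 f) t := pd_comm hf M.isOpen_dom ht 1 0

include ht

theorem g_symm : M.g t 1 0 = M.g t 0 1 := (M.symm_g t ht).apply 0 1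

theorem h_symm : M.h t 1 0 = M.h t 0 1 := (M.symm_h t ht).apply 0 1

theorem pd_g_symm (i : Fin 2) : pd i (fun t => M.g t 1 0) t = pd i (fun t => M.g t 0 1) t :=
  pd_congr_of_isOpen M.isOpen_dom (fun _ hz => g_symm hz) ht

theorem dh_symm (i : Fin 2) : M.dh 1 0 i t = M.dh 0 1 i t :=
  pd_congr_of_isOpen M.isOpen_dom (fun _ hz => h_symm hz) ht

theorem inv_g_symm : (M.g t)⁻¹ 1 0 = (M.g t)⁻¹ 0 1 := by
  simp [inv_g_apply, g_symm ht]

theorem pd_inv_g_apply (k i j : Fin 2) :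
    pd k (fun t => (M.g t)⁻¹ i j) t
      = -∑ a, ∑ b, (M.g t)⁻¹ i a * pd k (fun t => M.g t a b) t * (M.g t)⁻¹ b j := by
  have hd := fun i j => (M.smooth_g i j).differentiableAt_dom ht
  have hD := M.smooth_det_g.differentiableAt_dom ht
  have h0 := M.det_g_ne t ht
  have hdi := hD.inv h0
  have hpD : pd k (fun t => (M.g t).det) t
      = pd k (fun t => M.g t 0 0) t * M.g t 1 1 + M.g t 0 0 * pd k (fun t => M.g t 1 1) t
        - (pd k (fun t => M.g t 0 1) t * M.g t 1 0 + M.g t 0 1 * pd k (fun t => M.g t 1 0) t) := by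
    simp only [Matrix.det_fin_two]
    rw [pd_sub ((hd _ _).fun_mul (hd _ _)) ((hd _ _).fun_mul (hd _ _)), pd_mul (hd _ _) (hd _ _),
      pd_mul (hd _ _) (hd _ _)]
  have hinv : pd k (fun t => ((M.g t).det)⁻¹) t
    = -pd k (fun t => (M.g t).det) t * ((M.g t).det)⁻¹ ^ 2 := pd_inv hD h0
  have hmul : ∀ a b, pd k (fun t => ((M.g t).det)⁻¹ * M.g t a b) t
      = pd k (fun t => ((M.g t).det)⁻¹) t * M.g t a b
        + ((M.g t).det)⁻¹ * pd k (fun t => M.g t a b) t := fun a b => pd_mul hdi (hd _ _)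
  have hdet : (M.g t).det = M.g t 0 0 * M.g t 1 1 - M.g t 0 1 * M.g t 1 0 := Matrix.det_fin_two _
  have h0' := h0
  rw [hdet] at h0'
  fin_cases i <;> fin_cases j <;>
  simp only [inv_g_apply, Matrix.smul_apply, Matrix.of_apply, Matrix.cons_val', Matrix.cons_val_zero,
    Matrix.cons_val_one, smul_eq_mul, Fin.sum_univ_two, mul_neg, pd_neg, hmul, hinv, hpD,
    Fin.zero_eta, Fin.mk_one, Fin.isValue, Matrix.cons_val_fin_one] <;>
  rw [hdet] <;> field_simp <;> ring

omit ht in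
theorem christoffel_g_apply (k i j : Fin 2) : christoffel M.g k i j t
    = 1 / 2 * ∑ l, (M.g t)⁻¹ k l * (pd i (fun z => M.g z l j) t + pd j (fun z => M.g z l i) t
        - pd l (fun z => M.g z i j) t) := rfl

theorem christoffel_g_symm (k : Fin 2) :
    christoffel M.g k 1 0 t = christoffel M.g k 0 1 t := by
  simp only [christoffel_g_apply, Fin.sum_univ_two, pd_g_symm ht]
  ring

theorem inv_g_mul_det : (M.g t)⁻¹ 0 0 * (M.g t)⁻¹ 1 1 - (M.g t)⁻¹ 0 1 * (M.g t)⁻¹ 0 1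
    = ((M.g t).det)⁻¹ := by
  have h0 := M.det_g_ne t ht
  have hdet : (M.g t).det = M.g t 0 0 * M.g t 1 1 - M.g t 0 1 * M.g t 1 0 := Matrix.det_fin_two _
  simp only [inv_g_apply, Matrix.smul_apply, Matrix.of_apply, Matrix.cons_val', Matrix.cons_val_zero,
    Matrix.cons_val_one, smul_eq_mul, Matrix.cons_val_fin_one]
  rw [g_symm ht] at hdet
  rw [hdet] at h0 ⊢
  field_simp

theorem inv_g_mul_g (i j : Fin 2) :
    (M.g t)⁻¹ i 0 * M.g t 0 j + (M.g t)⁻¹ i 1 * M.g t 1 j = if i = j then 1 else 0 := by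
  have := Matrix.nonsing_inv_mul _ (isUnit_iff_ne_zero.mpr (M.det_g_ne _ ht))
  have := congrFun (congrFun this i) j
  simpa [Matrix.mul_apply, Matrix.one_apply] using this

/-- The inverse metric is parallel. -/
theorem pd_inv_g (k i j : Fin 2) :
    pd k (fun t => (M.g t)⁻¹ i j) t
      = -∑ m, (christoffel M.g i k m t * (M.g t)⁻¹ m j + christoffel M.g j k m t * (M.g t)⁻¹ i m) := by
  rw [pd_inv_g_apply ht]
  fin_cases k <;> fin_cases i <;> fin_cases j <;>
  simp only [christoffel_g_apply, Fin.sum_univ_two, inv_g_symm ht, pd_g_symm ht,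
    Fin.zero_eta, Fin.mk_one, Fin.isValue] <;> ring

theorem pd_christoffel_g (m k i j : Fin 2) : pd m (christoffel M.g k i j) t
    = 1 / 2 * ∑ l, (pd m (fun t => (M.g t)⁻¹ k l) t * (pd i (fun z => M.g z l j) t
        + pd j (fun z => M.g z l i) t - pd l (fun z => M.g z i j) t)
      + (M.g t)⁻¹ k l * (pd m (pd i (fun z => M.g z l j)) t
        + pd m (pd j (fun z => M.g z l i)) t - pd m (pd l (fun z => M.g z i j)) t)) := by
  have hG := fun i j => (M.smooth_inv_g i j).differentiableAt_dom ht
  have hd := fun k i j => ((M.smooth_g i j).pd M.isOpen_dom k).differentiableAt_dom ht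
  unfold christoffel
  rw [pd_const_mul]
  · rw [pd_sum]
    · congr 1
      refine Finset.sum_congr rfl fun l _ => ?_
      rw [pd_mul (hG k l) (((hd _ _ _).fun_add (hd _ _ _)).fun_sub (hd _ _ _)),
        pd_sub ((hd _ _ _).fun_add (hd _ _ _)) (hd _ _ _), pd_add (hd _ _ _) (hd _ _ _)]
    · intro l _
      exact (hG k l).mul (((hd _ _ _).fun_add (hd _ _ _)).fun_sub (hd _ _ _))
  · exact DifferentiableAt.fun_sum fun l _ =>
      (hG k l).mul (((hd _ _ _).fun_add (hd _ _ _)).fun_sub (hd _ _ _))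

theorem pd_pd_g_symm (i j : Fin 2) :
    pd j (pd i (fun t => M.g t 1 0)) t = pd j (pd i (fun t => M.g t 0 1)) t :=
  pd_congr_of_isOpen M.isOpen_dom (fun _ hz => pd_g_symm hz i) ht

/-- In dimension two the Ricci tensor is proportional to the metric. -/
theorem exists_ricci_g_eq : ∃ K : ℝ, ∀ i j, ricci M.g t i j = K * M.g t i j := by
  have hc := fun a b => pd_pd_comm (M.smooth_g a b) ht
  -- The single independent curvature component R₀₁₀₁ = K det g. The Ricci components are R times
  -- the adjugate entries of g⁻¹, which are the entries of g divided by det g.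
  let R : ℝ := pd 0 (pd 1 fun t => M.g t 0 1) t - 1 / 2 * pd 1 (pd 1 fun t => M.g t 0 0) t
    - 1 / 2 * pd 0 (pd 0 fun t => M.g t 1 1) t
    - (pd 1 (fun t => M.g t 0 1) t - 1 / 2 * pd 0 (fun t => M.g t 1 1) t)
        * christoffel M.g 0 0 0 t
    - 1 / 2 * pd 1 (fun t => M.g t 1 1) t * christoffel M.g 1 0 0 t
    + 1 / 2 * pd 1 (fun t => M.g t 0 0) t * christoffel M.g 0 0 1 t
    + 1 / 2 * pd 0 (fun t => M.g t 1 1) t * christoffel M.g 1 0 1 t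
  have key : ricci M.g t 0 0 = R * (M.g t)⁻¹ 1 1 ∧ ricci M.g t 0 1 = -R * (M.g t)⁻¹ 0 1
      ∧ ricci M.g t 1 0 = -R * (M.g t)⁻¹ 0 1 ∧ ricci M.g t 1 1 = R * (M.g t)⁻¹ 0 0 := by
    simp only [R, ricci, Matrix.of_apply, Fin.sum_univ_two, pd_christoffel_g ht,
      pd_inv_g_apply ht, christoffel_g_apply, pd_g_symm ht, pd_pd_g_symm ht, hc, inv_g_symm ht]
    refine ⟨?_, ?_, ?_, ?_⟩ <;> ring
  obtain ⟨k00, k01, k10, k11⟩ := key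
  refine ⟨R * ((M.g t).det)⁻¹, fun i j => ?_⟩
  have hs := g_symm ht
  fin_cases i <;> fin_cases j <;>
  simp only [Fin.zero_eta, Fin.mk_one, Fin.isValue, k00, k01, k10, k11] <;>
  simp [inv_g_apply, hs] <;> ring

end AdaptedMetric

/-! ### Covariant derivatives of h, ln x and χ -/

namespace AdaptedMetric

variable {M : AdaptedMetric} {t : Fin 2 → ℝ}

/-- The covariant Hessian of `h_kl`. -/
noncomputable def hessH (M : AdaptedMetric) (k l i j : Fin 2) (t : Fin 2 → ℝ) : ℝ :=
  pd i (M.dh k l j) t - ∑ e, christoffel M.g e i j t * M.dh k l e t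

/-- The covariant Hessian of `ln x`. -/
noncomputable def hessLnx (M : AdaptedMetric) (i j : Fin 2) (t : Fin 2 → ℝ) : ℝ :=
  pd i (fun t => M.dlnx t j) t - ∑ e, christoffel M.g e i j t * M.dlnx t e

/-- The covariant derivative `∇_k χ_ij`. -/
noncomputable def covChi (M : AdaptedMetric) (k i j : Fin 2) (t : Fin 2 → ℝ) : ℝ :=
  pd k (fun t => M.chi t i j) t
    - ∑ e, (christoffel M.g e k i t * M.chi t e j + christoffel M.g e k j t * M.chi t i e)

theorem chi_symm : M.chi t 1 0 = M.chi t 0 1 := by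
  simp only [chi, Matrix.of_apply]; ring

variable (ht : t ∈ M.dom)
include ht

theorem x_ne_zero : M.x t ≠ 0 := M.det_h_ne t ht

theorem x_eq : M.x t = M.h t 0 0 * M.h t 1 1 - M.h t 0 1 * M.h t 0 1 := by
  rw [x, Matrix.det_fin_two, h_symm ht]

theorem pd_x (i : Fin 2) : pd i M.x t
    = M.dh 0 0 i t * M.h t 1 1 + M.h t 0 0 * M.dh 1 1 i t - 2 * (M.dh 0 1 i t * M.h t 0 1) := by
  have hd := fun i j => (M.smooth_h i j).differentiableAt_dom ht
  rw [pd_congr_of_isOpen M.isOpen_dom (fun z hz => x_eq hz) ht,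
    pd_sub ((hd _ _).fun_mul (hd _ _)) ((hd _ _).fun_mul (hd _ _)), pd_mul (hd _ _) (hd _ _),
    pd_mul (hd _ _) (hd _ _)]
  simp only [dh]
  ring

theorem pd_x_eq_mul (i : Fin 2) : pd i M.x t = M.x t * M.dlnx t i := by
  have := x_ne_zero ht
  rw [dlnx]; field_simp

theorem dlnx_eq (i : Fin 2) : M.dlnx t i = (M.dh 0 0 i t * M.h t 1 1
    + M.h t 0 0 * M.dh 1 1 i t - 2 * (M.dh 0 1 i t * M.h t 0 1)) / M.x t := by
  rw [dlnx, pd_x ht]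

theorem chi_apply (i j : Fin 2) : M.chi t i j = (M.dh 0 0 i t * M.dh 1 1 j t
      + M.dh 0 0 j t * M.dh 1 1 i t - 2 * (M.dh 0 1 i t * M.dh 0 1 j t)) / (2 * M.x t) := by
  simp only [chi, Matrix.of_apply, dh_symm ht]; ring

theorem inv_h_apply :
    (M.h t)⁻¹ = (M.x t)⁻¹ • !![M.h t 1 1, -M.h t 0 1; -M.h t 0 1, M.h t 0 0] := by
  rw [Matrix.inv_def, Matrix.adjugate_fin_two, Ring.inverse_eq_inv', h_symm ht, x]

/-- Jacobi's formula for the logarithmic derivative of a determinant. -/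
theorem sum_hConn (i : Fin 2) : ∑ k, M.hConn k i k t = 1 / 2 * M.dlnx t i := by
  rw [dlnx_eq ht]
  simp only [hConn, Fin.sum_univ_two, inv_h_apply ht, dh_symm ht, Matrix.smul_apply,
    Matrix.of_apply, Matrix.cons_val', Matrix.cons_val_zero, Matrix.cons_val_one, smul_eq_mul,
    Matrix.cons_val_fin_one]
  ring

/-- Polarisation of tr A² = (tr A)² − 2 det A for A = h⁻¹∂h; the polarised determinant of A is χ. -/
theorem sum_hConn_mul_hConn (i j : Fin 2) : ∑ k, ∑ l, M.hConn k j l t * M.hConn l i k t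
    = 1 / 4 * (M.dlnx t i * M.dlnx t j - 2 * M.chi t i j) := by
  have hx := x_ne_zero ht
  have hx' := x_eq ht
  rw [dlnx_eq ht, dlnx_eq ht, chi_apply ht]
  simp only [hConn, Fin.sum_univ_two, inv_h_apply ht, dh_symm ht, Matrix.smul_apply,
    Matrix.of_apply, Matrix.cons_val', Matrix.cons_val_zero, Matrix.cons_val_one, smul_eq_mul,
    Matrix.cons_val_fin_one]
  rw [hx'] at hx ⊢
  field_simp
  ring

/-- Polarised Cayley–Hamilton: multiply A² = (tr A) A − (det A) 1, with A = h⁻¹∂h, by h. It turns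
the quadratic terms of the orbit equations into multiples of dh and of h. -/
theorem sum_dh_mul_hConn (c d k l : Fin 2) :
    ∑ m, (M.dh k m d t * M.hConn m c l t + M.dh l m d t * M.hConn m c k t)
      = 1 / 2 * (M.dlnx t c * M.dh k l d t + M.dlnx t d * M.dh k l c t
        - 2 * M.chi t c d * M.h t k l) := by
  have hx := x_ne_zero ht
  have hx' := x_eq ht
  have hs := h_symm ht
  rw [dlnx_eq ht, dlnx_eq ht, chi_apply ht]
  fin_cases k <;> fin_cases l <;>
  simp only [hConn, Fin.sum_univ_two, inv_h_apply ht, dh_symm ht, Matrix.smul_apply,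
    Matrix.of_apply, Matrix.cons_val', Matrix.cons_val_zero, Matrix.cons_val_one, smul_eq_mul,
    Matrix.cons_val_fin_one, Fin.zero_eta, Fin.mk_one, Fin.isValue, hs] <;>
  rw [hx'] at hx ⊢ <;>
  field_simp <;>
  ring

theorem pd_gradH (i c k l : Fin 2) : pd i (M.gradH c k l) t
    = -(1 / 2) * ∑ d, (pd i (fun t => (M.g t)⁻¹ c d) t * M.dh k l d t
      + (M.g t)⁻¹ c d * pd i (M.dh k l d) t) := by
  have hG := fun i j => (M.smooth_inv_g i j).differentiableAt_dom ht
  have hd := fun k l i => (M.smooth_dh k l i).differentiableAt_dom ht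
  unfold gradH
  rw [pd_const_mul _ (DifferentiableAt.fun_sum fun d _ => (hG _ _).fun_mul (hd _ _ _)),
    pd_sum _ (fun d _ => (hG _ _).fun_mul (hd _ _ _))]
  congr 1
  exact Finset.sum_congr rfl fun d _ => pd_mul (hG _ _) (hd _ _ _)

theorem pd_dlnx (i j : Fin 2) : pd i (fun t => M.dlnx t j) t
    = (pd i (M.dh 0 0 j) t * M.h t 1 1 + M.h t 0 0 * pd i (M.dh 1 1 j) t
        - 2 * (pd i (M.dh 0 1 j) t * M.h t 0 1)) / M.x t
      + 2 * M.chi t i j - M.dlnx t i * M.dlnx t j := by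
  have hh := fun i j => (M.smooth_h i j).differentiableAt_dom ht
  have hd := fun k l i => (M.smooth_dh k l i).differentiableAt_dom ht
  have hx := M.smooth_x.differentiableAt_dom ht
  have h1 := (((hd 0 0 j).fun_mul (hh 1 1)).fun_add ((hh 0 0).fun_mul (hd 1 1 j)))
  have h2 := ((hd 0 1 j).fun_mul (hh 0 1))
  rw [pd_congr_of_isOpen M.isOpen_dom (fun z hz => dlnx_eq hz j) ht,
    pd_div (h1.fun_sub (h2.const_mul 2)) hx (x_ne_zero ht), pd_sub h1 (h2.const_mul 2),
    pd_const_mul _ h2, pd_add ((hd 0 0 j).fun_mul (hh 1 1)) ((hh 0 0).fun_mul (hd 1 1 j)),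
    pd_mul (hd 0 0 j) (hh 1 1), pd_mul (hh 0 0) (hd 1 1 j), pd_mul (hd 0 1 j) (hh 0 1),
    ← dlnx_eq ht, pd_x_eq_mul ht, chi_apply ht]
  have := x_ne_zero ht
  change (pd i (M.dh 0 0 j) t * M.h t 1 1 + M.dh 0 0 j t * M.dh 1 1 i t
    + (M.dh 0 0 i t * M.dh 1 1 j t + M.h t 0 0 * pd i (M.dh 1 1 j) t)
    - 2 * (pd i (M.dh 0 1 j) t * M.h t 0 1 + M.dh 0 1 j t * M.dh 0 1 i t)
    - M.dlnx t j * (M.x t * M.dlnx t i)) / M.x t = _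
  field_simp
  ring

theorem hessLnx_eq (i j : Fin 2) : M.hessLnx i j t
    = (M.hessH 0 0 i j t * M.h t 1 1 + M.h t 0 0 * M.hessH 1 1 i j t
        - 2 * (M.hessH 0 1 i j t * M.h t 0 1)) / M.x t
      + 2 * M.chi t i j - M.dlnx t i * M.dlnx t j := by
  simp only [hessLnx, hessH, pd_dlnx ht, Fin.sum_univ_two, dlnx_eq ht 0, dlnx_eq ht 1]
  ring

theorem pd_chi (k i j : Fin 2) : pd k (fun t => M.chi t i j) t
    = (pd k (M.dh 0 0 i) t * M.dh 1 1 j t + M.dh 0 0 i t * pd k (M.dh 1 1 j) t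
        + (pd k (M.dh 0 0 j) t * M.dh 1 1 i t + M.dh 0 0 j t * pd k (M.dh 1 1 i) t)
        - 2 * (pd k (M.dh 0 1 i) t * M.dh 0 1 j t + M.dh 0 1 i t * pd k (M.dh 0 1 j) t))
        / (2 * M.x t)
      - M.dlnx t k * M.chi t i j := by
  have hd := fun k l i => (M.smooth_dh k l i).differentiableAt_dom ht
  have hx := M.smooth_x.differentiableAt_dom ht
  have h1 := (hd 0 0 i).fun_mul (hd 1 1 j)
  have h2 := (hd 0 0 j).fun_mul (hd 1 1 i)
  have h3 := (hd 0 1 i).fun_mul (hd 0 1 j)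
  have h0 := x_ne_zero ht
  rw [pd_congr_of_isOpen M.isOpen_dom (fun z hz => chi_apply hz i j) ht,
    pd_div ((h1.fun_add h2).fun_sub (h3.const_mul 2)) (hx.const_mul 2) (by simpa using h0),
    pd_sub (h1.fun_add h2) (h3.const_mul 2), pd_add h1 h2, pd_const_mul _ h3,
    pd_mul (hd 0 0 i) (hd 1 1 j), pd_mul (hd 0 0 j) (hd 1 1 i), pd_mul (hd 0 1 i) (hd 0 1 j),
    pd_const_mul _ hx, ← chi_apply ht, pd_x_eq_mul ht]
  field_simp

theorem covChi_eq (k i j : Fin 2) : M.covChi k i j t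
    = (M.hessH 0 0 k i t * M.dh 1 1 j t + M.dh 0 0 i t * M.hessH 1 1 k j t
        + (M.hessH 0 0 k j t * M.dh 1 1 i t + M.dh 0 0 j t * M.hessH 1 1 k i t)
        - 2 * (M.hessH 0 1 k i t * M.dh 0 1 j t + M.dh 0 1 i t * M.hessH 0 1 k j t))
        / (2 * M.x t)
      - M.dlnx t k * M.chi t i j := by
  simp only [covChi, hessH, pd_chi ht, Fin.sum_univ_two, chi_apply ht]
  ring

theorem hessH_symm (k l : Fin 2) : M.hessH k l 1 0 t = M.hessH k l 0 1 t := by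
  simp only [hessH, christoffel_g_symm ht]
  congr 1
  exact pd_pd_comm (M.smooth_h k l) ht

theorem Cchi_eq : M.Cchi t = (M.g t)⁻¹ 0 0 * M.chi t 0 0 + 2 * (M.g t)⁻¹ 0 1 * M.chi t 0 1
    + (M.g t)⁻¹ 1 1 * M.chi t 1 1 := by
  simp only [Cchi, trForm, Fin.sum_univ_two, inv_g_symm ht, chi_symm]; ring

theorem Crho_eq : M.Crho t = (M.g t)⁻¹ 0 0 * M.dlnx t 0 ^ 2
    + 2 * (M.g t)⁻¹ 0 1 * (M.dlnx t 0 * M.dlnx t 1) + (M.g t)⁻¹ 1 1 * M.dlnx t 1 ^ 2 := by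
  simp only [Crho, trForm, rho, Matrix.of_apply, Fin.sum_univ_two, inv_g_symm ht]; ring

/-! ### The vacuum equations in reduced form -/

section Vacuum

variable {Λ : ℝ} (hM : M.IsVacuum Λ)
include hM

/-- The vacuum equations along the orbits: `□h = ½ l^c h_c - (C_χ + 2Λ) h`. -/
theorem box_h (k l : Fin 2) :
    (M.g t)⁻¹ 0 0 * M.hessH k l 0 0 t + 2 * (M.g t)⁻¹ 0 1 * M.hessH k l 0 1 t
      + (M.g t)⁻¹ 1 1 * M.hessH k l 1 1 t
    = 1 / 2 * ∑ c, ∑ d, (M.g t)⁻¹ c d * M.dlnx t c * M.dh k l d t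
      - (M.Cchi t + 2 * Λ) * M.h t k l := by
  have hy : (Sum.elim t 0 : Fin 2 ⊕ Fin 2 → ℝ) ∘ Sum.inl ∈ M.dom := by simpa using ht
  have h := hM.ricci_eq hy (Sum.inr k) (Sum.inr l)
  rw [ricci_full_inr hy] at h
  have hf : M.full (Sum.elim t 0) (Sum.inr k) (Sum.inr l) = M.h t k l := by
    simp [full]
  rw [hf] at h
  simp only [Sum.elim_comp_inl] at h
  have hs : ∑ c, ∑ m, (M.gradH c k m t * M.hConn m c l t + M.gradH c l m t * M.hConn m c k t)
      = -(1 / 2) * ∑ c, ∑ d, (M.g t)⁻¹ c d *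
        ∑ m, (M.dh k m d t * M.hConn m c l t + M.dh l m d t * M.hConn m c k t) := by
    simp only [gradH, Fin.sum_univ_two]; ring
  simp only [hs, sum_dh_mul_hConn ht, sum_hConn ht, pd_gradH ht] at h
  simp only [Fin.sum_univ_two, pd_inv_g ht, gradH, inv_g_symm ht, christoffel_g_symm ht,
    chi_symm] at h
  have hc : pd 1 (M.dh k l 0) t = pd 0 (M.dh k l 1) t := pd_pd_comm (M.smooth_h k l) ht
  rw [hc] at h
  rw [Cchi_eq ht]
  simp only [Fin.sum_univ_two, hessH, inv_g_symm ht]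
  linear_combination (-2) * h

/-- Contract the wave equation for h with h⁻¹. The contraction −2C_χ cancels against the 2χ in the
second derivative of ln det h, which leaves only Λ and C_ρ. -/
theorem trace_hessLnx :
    (M.g t)⁻¹ 0 0 * M.hessLnx 0 0 t + 2 * (M.g t)⁻¹ 0 1 * M.hessLnx 0 1 t
      + (M.g t)⁻¹ 1 1 * M.hessLnx 1 1 t = -4 * Λ - 1 / 2 * M.Crho t := by
  have h00 := box_h ht hM 0 0
  have h01 := box_h ht hM 0 1
  have h11 := box_h ht hM 1 1
  have h0 := x_ne_zero ht
  have hx : M.x t * (M.x t)⁻¹ = 1 := mul_inv_cancel₀ h0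
  have hxx := x_eq ht
  simp only [hessLnx_eq ht, Crho_eq ht]
  simp only [Fin.sum_univ_two, inv_g_symm ht, Cchi_eq ht] at h00 h01 h11
  have l0 : M.dlnx t 0 * M.x t = _ := (div_eq_iff h0).mp (dlnx_eq ht 0).symm |>.symm
  have l1 : M.dlnx t 1 * M.x t = _ := (div_eq_iff h0).mp (dlnx_eq ht 1).symm |>.symm
  field_simp
  generalize M.dlnx t 0 = p0 at *
  generalize M.dlnx t 1 = p1 at *
  linear_combination 2 * M.h t 1 1 * h00 + 2 * M.h t 0 0 * h11 - 4 * M.h t 0 1 * h01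
    - ((M.g t)⁻¹ 0 0 * p0 + (M.g t)⁻¹ 0 1 * p1) * l0
    - ((M.g t)⁻¹ 0 1 * p0 + (M.g t)⁻¹ 1 1 * p1) * l1
    + (4 * ((M.g t)⁻¹ 0 0 * M.chi t 0 0 + 2 * (M.g t)⁻¹ 0 1 * M.chi t 0 1
    + (M.g t)⁻¹ 1 1 * M.chi t 1 1) + 8 * Λ) * hxx

/-- The vacuum equations transversal to the orbits. -/
theorem hessLnx_vacuum (i j : Fin 2) : M.hessLnx i j t = M.chi t i j
    - 1 / 2 * M.dlnx t i * M.dlnx t j - (2 * Λ + 1 / 2 * M.Cchi t) * M.g t i j := by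
  have hy : (Sum.elim t 0 : Fin 2 ⊕ Fin 2 → ℝ) ∘ Sum.inl ∈ M.dom := by simpa using ht
  obtain ⟨K, hK⟩ := exists_ricci_g_eq ht
  -- The transversal equations, with the Gaussian curvature K still unknown.
  have key : ∀ i j, M.hessLnx i j t = M.chi t i j
      - 1 / 2 * M.dlnx t i * M.dlnx t j + 2 * (K - Λ) * M.g t i j := by
    intro i j
    have h := hM.ricci_eq hy (Sum.inl i) (Sum.inl j)
    rw [ricci_full_inl hy] at h
    have hf : M.full (Sum.elim t 0) (Sum.inl i) (Sum.inl j) = M.g t i j := by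
      simp [full]
    rw [hf] at h
    simp only [Sum.elim_comp_inl, hK, sum_hConn_mul_hConn ht] at h
    have h1 : ∑ k, pd j (M.hConn k i k) t = 1 / 2 * pd j (fun t => M.dlnx t i) t := by
      rw [← pd_sum _ (fun k _ => (smooth_hConn k i k).differentiableAt_dom ht),
        pd_congr_of_isOpen M.isOpen_dom (fun z hz => sum_hConn hz i) ht,
        pd_const_mul _ ((M.smooth_dlnx i).differentiableAt_dom ht)]
    have h2 : ∑ k, ∑ l, M.hConn k l k t * christoffel M.g l i j t
        = 1 / 2 * ∑ l, christoffel M.g l i j t * M.dlnx t l := by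
      rw [Finset.sum_comm, Finset.mul_sum]
      refine Finset.sum_congr rfl fun l _ => ?_
      rw [← Finset.sum_mul, sum_hConn ht]; ring
    have h3 : pd j (fun t => M.dlnx t i) t = pd i (fun t => M.dlnx t j) t := by
      rw [pd_dlnx ht, pd_dlnx ht]
      have := fun a b => pd_comm (M.smooth_h a b) M.isOpen_dom ht i j
      have h4 : ∀ a b, pd j (M.dh a b i) t = pd i (M.dh a b j) t :=
        fun a b => (this a b).symm
      have h5 : M.chi t j i = M.chi t i j := by
        simp only [chi, Matrix.of_apply]; ring
      rw [h4, h4, h4, h5]; ring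
    rw [h1, h2, h3] at h
    rw [hessLnx]
    linear_combination (-2) * h
  -- Comparing traces eliminates K, so that no curvature of g survives in the result.
  have htr := trace_hessLnx ht hM
  simp only [key] at htr
  have e00 := inv_g_mul_g ht 0 0
  have e11 := inv_g_mul_g ht 1 1
  simp only [if_true] at e00 e11
  rw [inv_g_symm ht] at e11
  rw [g_symm ht] at e00
  have hK' : 2 * (K - Λ) = -(2 * Λ + 1 / 2 * M.Cchi t) := by
    rw [Crho_eq ht] at htr
    rw [Cchi_eq ht]
    linear_combination (1 / 2) * htr - (K - Λ) * e00 - (K - Λ) * e11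
  rw [key, hK']; ring

/-- The contracted Codazzi equation for `χ`. -/
theorem codazzi (k : Fin 2) :
    ∑ i, ∑ j, (M.g t)⁻¹ i j * (M.covChi i j k t - 1 / 2 * M.covChi k i j t)
      = -(1 / 2) * ∑ i, ∑ j, (M.g t)⁻¹ i j * M.dlnx t i * M.chi t j k - Λ * M.dlnx t k := by
  have h00 := box_h ht hM 0 0
  have h01 := box_h ht hM 0 1
  have h11 := box_h ht hM 1 1
  have h0 := x_ne_zero ht
  simp only [Fin.sum_univ_two, inv_g_symm ht] at h00 h01 h11 ⊢
  have hC := Cchi_eq ht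
  have hl := dlnx_eq ht k
  have hch := chi_apply ht
  -- With xχ_ij = ⟨h_i, h_j⟩, the divergence of ⟨h_i, h_k⟩ is ⟨□h, h_k⟩ + ⟨h^i, ∇_i h_k⟩. The second
  -- term equals half the derivative of ⟨h^i, h_i⟩ by symmetry of the Hessian, so the contraction
  -- leaves □h paired with h_k, apart from derivatives of 1/x.
  have key : ∑ i, ∑ j, (M.g t)⁻¹ i j * (M.covChi i j k t - 1 / 2 * M.covChi k i j t)
     = (((M.g t)⁻¹ 0 0 * M.hessH 0 0 0 0 t + 2 * (M.g t)⁻¹ 0 1 * M.hessH 0 0 0 1 t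
      + (M.g t)⁻¹ 1 1 * M.hessH 0 0 1 1 t) * M.dh 1 1 k t
      + ((M.g t)⁻¹ 0 0 * M.hessH 1 1 0 0 t + 2 * (M.g t)⁻¹ 0 1 * M.hessH 1 1 0 1 t
      + (M.g t)⁻¹ 1 1 * M.hessH 1 1 1 1 t) * M.dh 0 0 k t
      - 2 * ((M.g t)⁻¹ 0 0 * M.hessH 0 1 0 0 t + 2 * (M.g t)⁻¹ 0 1 * M.hessH 0 1 0 1 t
      + (M.g t)⁻¹ 1 1 * M.hessH 0 1 1 1 t) * M.dh 0 1 k t) / (2 * M.x t)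
      - ∑ i, ∑ j, (M.g t)⁻¹ i j * M.dlnx t i * M.chi t j k + 1 / 2 * M.dlnx t k * M.Cchi t := by
    simp only [Fin.sum_univ_two, inv_g_symm ht, covChi_eq ht, hC, chi_symm]
    fin_cases k <;> simp only [Fin.zero_eta, Fin.mk_one, Fin.isValue, hessH_symm ht, chi_symm] <;>
    ring
  simp only [Fin.sum_univ_two, inv_g_symm ht] at key
  rw [key, h00, h01, h11]
  rw [hl, hch 0 k, hch 1 k]
  generalize M.Cchi t = C
  field_simp
  ring

end Vacuum

end AdaptedMetric

/-! ### Frame algebra and derivatives of the invariants -/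

namespace AdaptedMetric

/-- The vacuum relations as polynomial identities between the components, in the invariant frame,
of `χ` and of its covariant derivative, all divided by `p = C_ρ`. -/
theorem relations_of_frame_components (e p L a b c A1 A2 A3 B1 B2 B3 : ℝ) (he : e = 1 ∨ e = -1)
  (h1 : A1 + e * B2 - 1/2*(A1+e*A3) = -(1/2)*p*a - L*p)
  (h2 : A2 + e * B3 - 1/2*(B1+e*B3) = -(1/2)*p*b)
  {I1 I2 I3 I4 Cg Cc Qg Qc XCc YCc XQg YQg XQc YQc H11 H12 H22 : ℝ}
  (hCc : Cc = a + e * c) (hCg : Cg = a - p / 4 + e * c) (hQc : Qc = e * (a * c - b ^ 2))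
  (hQg : Qg = e * ((a - p / 4) * c - b ^ 2)) (hI1 : I1 = -(1/4)* (p * b))
  (hI2 : I2 = -(Qg + Qc) + (1 / 2) * Cg * (Cg + (1 / 4) * p))
  (hI3 : I3 = (1 / 2) * Cg * (Qg - Qc) + (1 / 4) * p * Qg)
  (hI4 : I4 = (1 / 4) * Cg ^ 2 - Qg)
  (hH11 : H11 = p * a - 1 / 2 * p ^ 2 - (2 * L + 1 / 2 * Cc) * p) (hH12 : H12 = p * b)
  (hH22 : H22 = p * c - (2 * L + 1 / 2 * Cc) * (e * p))
  (hXCc : XCc = A1 + e * A3) (hYCc : YCc = B1 + e * B3)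
  (hXQc : XQc = e * (A1 * c + a * A3 - 2 * (b * A2)))
  (hYQc : YQc = e * (B1 * c + a * B3 - 2 * (b * B2)))
  (hXQg : XQg = e * ((A1 - 1 / 2 * H11) * c + (a - p / 4) * A3 - 2 * (b * (A2 - 1 / 4 * H12))))
  (hYQg : YQg = e * ((B1 - 1 / 2 * H12) * c + (a - p / 4) * B3 - 2 * (b * (B2 - 1 / 4 * H22)))) :
  I1 ^ 2 = -e * ((Qg - Qc) ^ 2 - (1 / 4) * p *
      (Cg * Qc - (Cg + (1 / 4) * p) * Qg)) ∧
  (1 / 4) * Cg * I1 * XCc - (1 / 2) * I1 * XQg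
      + (1 / 2) * I2 * YQg - (1 / 2) * I3 * YCc
      - I4 * YQc
    = I1 * (I4 * (Cg - (1 / 2) * p + 4 * L)
      - (1 / 16) * Cg * p * ((3 / 4) * p + 4 * L)) ∧
  (1 / 4) * e * Cg * I1 * YCc
      - (1 / 2) * e * I1 * YQg
      - (1 / 2) * I2 * XQg + (1 / 2) * I3 * XCc
      + I4 * XQc
    = I4 * (((1 / 2) * p + 4 * L) * (Qg - Qc) + 2 * I3)
      - (1 / 8) * I3 * p * ((3 / 4) * p + 4 * L) := by
  subst hI2 hI3 hI4 hXCc hYCc hXQc hYQc hXQg hYQg 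
  subst hI1 hCg hQc hQg hH11 hH12 hH22
  subst hCc
  rcases he with rfl | rfl
  · refine ⟨by ring, ?_, ?_⟩
    -- The common factor is I₁. The multipliers of the two Codazzi equations are, up to sign, the
    -- frame components (a − p/4 − εc)/2 and b of the trace-free part of γ; the difference of the
    -- squares of these components weighted by −ε is I₄.
    · linear_combination (-(1/4)* (p * b)) * ((a - p/4 - c) / 2 * h1 + b * h2)
    · linear_combination (-(1/4)* (p * b)) * (b * h1 - (a - p/4 - c) / 2 * h2)
  · refine ⟨by ring, ?_, ?_⟩
    · linear_combination (-(1/4)* (p * b)) * ((a - p/4 + c) / 2 * h1 - b * h2)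
    · linear_combination -(-(1/4)* (p * b)) * (b * h1 - (a - p/4 + c) / 2 * h2)

variable {M : AdaptedMetric} {t : Fin 2 → ℝ}

/-- The covariant derivative `∇_k γ_ij`. -/
noncomputable def covGamma (M : AdaptedMetric) (k i j : Fin 2) (t : Fin 2 → ℝ) : ℝ :=
  M.covChi k i j t
    - 1 / 4 * (M.hessLnx k i t * M.dlnx t j + M.dlnx t i * M.hessLnx k j t)

theorem gamma_apply (i j : Fin 2) :
    M.gamma t i j = M.chi t i j - 1 / 4 * (M.dlnx t i * M.dlnx t j) := by
  simp [gamma, rho]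

theorem gamma_symm : M.gamma t 1 0 = M.gamma t 0 1 := by
  simp only [gamma_apply, chi_symm]; ring

theorem Cgamma_eq : M.Cgamma t = M.Cchi t - 1 / 4 * M.Crho t := by
  simp only [Cgamma, Cchi, Crho, trForm, gamma_apply, rho, Matrix.of_apply, Fin.sum_univ_two]
  ring

variable (ht : t ∈ M.dom)
include ht

theorem inv_det_g : ((M.g t).det)⁻¹
    = (M.g t)⁻¹ 0 0 * (M.g t)⁻¹ 1 1 - (M.g t)⁻¹ 0 1 * (M.g t)⁻¹ 0 1 :=
  (inv_g_mul_det ht).symm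

/-- Covariant form of the derivative of a determinant invariant. -/
theorem pd_detForm {α : (Fin 2 → ℝ) → Matrix (Fin 2) (Fin 2) ℝ}
    (hα : ∀ i j, DifferentiableAt ℝ (fun t => α t i j) t) (hs : ∀ t ∈ M.dom, α t 1 0 = α t 0 1)
    {β : Fin 2 → Fin 2 → ℝ} (k : Fin 2)
    (hβ : ∀ i j, pd k (fun t => α t i j) t = β i j
      + ∑ e, (christoffel M.g e k i t * α t e j + christoffel M.g e k j t * α t i e)) :
    pd k (M.detForm α) t
      = ((M.g t).det)⁻¹ * (β 0 0 * α t 1 1 + α t 0 0 * β 1 1 - 2 * (α t 0 1 * β 0 1)) := by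
  have hG := fun i j => (M.smooth_inv_g i j).differentiableAt_dom ht
  -- Writing 1/det g as the determinant of g⁻¹ lets the Christoffel terms cancel because g⁻¹ is
  -- parallel.
  have hf : ∀ z ∈ M.dom, M.detForm α z
      = ((M.g z)⁻¹ 0 0 * (M.g z)⁻¹ 1 1 - (M.g z)⁻¹ 0 1 * (M.g z)⁻¹ 0 1)
        * (α z 0 0 * α z 1 1 - α z 0 1 * α z 0 1) := by
    intro z hz
    rw [← inv_det_g hz, detForm, Matrix.det_fin_two (α z), hs z hz]
    field_simp
  have g1 := (hG 0 0).fun_mul (hG 1 1)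
  have g2 := (hG 0 1).fun_mul (hG 0 1)
  have a1 := (hα 0 0).fun_mul (hα 1 1)
  have a2 := (hα 0 1).fun_mul (hα 0 1)
  rw [pd_congr_of_isOpen M.isOpen_dom hf ht, pd_mul (g1.fun_sub g2) (a1.fun_sub a2),
    pd_sub g1 g2, pd_sub a1 a2, pd_mul (hG 0 0) (hG 1 1), pd_mul (hG 0 1) (hG 0 1),
    pd_mul (hα 0 0) (hα 1 1), pd_mul (hα 0 1) (hα 0 1), inv_det_g ht]
  simp only [hβ, pd_inv_g ht, Fin.sum_univ_two, inv_g_symm ht, hs t ht]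
  ring

/-- Covariant form of the derivative of a trace invariant. -/
theorem pd_trForm {α : (Fin 2 → ℝ) → Matrix (Fin 2) (Fin 2) ℝ}
    (hα : ∀ i j, DifferentiableAt ℝ (fun t => α t i j) t)
    {β : Fin 2 → Fin 2 → ℝ} (k : Fin 2)
    (hβ : ∀ i j, pd k (fun t => α t i j) t = β i j
      + ∑ e, (christoffel M.g e k i t * α t e j + christoffel M.g e k j t * α t i e)) :
    pd k (M.trForm α) t = ∑ i, ∑ j, (M.g t)⁻¹ i j * β i j := by
  have hG := fun i j => (M.smooth_inv_g i j).differentiableAt_dom ht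
  have h1 : ∀ i j, DifferentiableAt ℝ (fun z => (M.g z)⁻¹ i j * α z i j) t :=
    fun i j => (hG i j).fun_mul (hα i j)
  unfold trForm
  have h2 : ∀ i, pd k (fun z => ∑ j, (M.g z)⁻¹ i j * α z i j) t
      = ∑ j, (pd k (fun t => (M.g t)⁻¹ i j) t * α t i j
        + (M.g t)⁻¹ i j * pd k (fun t => α t i j) t) := fun i => by
    rw [pd_sum _ (fun j _ => h1 i j)]
    exact Finset.sum_congr rfl fun j _ => pd_mul (hG i j) (hα i j)
  rw [pd_sum _ (fun i _ => DifferentiableAt.fun_sum fun j _ => h1 i j)]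
  rw [Finset.sum_congr rfl fun i _ => h2 i]
  simp only [hβ, pd_inv_g ht, Fin.sum_univ_two, inv_g_symm ht]
  ring

omit ht in
theorem pd_chi_eq_covChi (k i j : Fin 2) : pd k (fun t => M.chi t i j) t = M.covChi k i j t
      + ∑ e, (christoffel M.g e k i t * M.chi t e j + christoffel M.g e k j t * M.chi t i e) := by
  rw [covChi]; ring

theorem pd_rho (k i j : Fin 2) : pd k (fun t => M.rho t i j) t
    = (M.hessLnx k i t * M.dlnx t j + M.dlnx t i * M.hessLnx k j t)
      + ∑ e, (christoffel M.g e k i t * M.rho t e j + christoffel M.g e k j t * M.rho t i e) := by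
  have hl := fun i => (M.smooth_dlnx i).differentiableAt_dom ht
  have : (fun t => M.rho t i j) = fun t => M.dlnx t i * M.dlnx t j := rfl
  rw [this, pd_mul (hl i) (hl j)]
  simp only [hessLnx, rho, Matrix.of_apply, Fin.sum_univ_two]
  ring

theorem pd_gamma (k i j : Fin 2) : pd k (fun t => M.gamma t i j) t = M.covGamma k i j t
      + ∑ e, (christoffel M.g e k i t * M.gamma t e j
        + christoffel M.g e k j t * M.gamma t i e) := by
  have : (fun t => M.gamma t i j) = fun t => M.chi t i j - 1 / 4 * M.rho t i j := rfl
  have hr := (M.smooth_rho i j).differentiableAt_dom ht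
  rw [this, pd_sub ((M.smooth_chi i j).differentiableAt_dom ht) (hr.const_mul _),
    pd_const_mul _ hr, pd_chi_eq_covChi, pd_rho ht]
  simp only [covGamma, gamma_apply, rho, Matrix.of_apply, Fin.sum_univ_two]
  ring

theorem pd_Crho (k : Fin 2) : pd k M.Crho t
    = ∑ i, ∑ j, (M.g t)⁻¹ i j
      * (M.hessLnx k i t * M.dlnx t j + M.dlnx t i * M.hessLnx k j t) :=
  pd_trForm ht (fun i j => (M.smooth_rho i j).differentiableAt_dom ht) k (pd_rho ht k)

theorem pd_Cchi (k : Fin 2) : pd k M.Cchi t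
    = ∑ i, ∑ j, (M.g t)⁻¹ i j * M.covChi k i j t :=
  pd_trForm ht (fun i j => (M.smooth_chi i j).differentiableAt_dom ht) k (pd_chi_eq_covChi k)

theorem pd_Qchi (k : Fin 2) : pd k M.Qchi t
    = ((M.g t).det)⁻¹ * (M.covChi k 0 0 t * M.chi t 1 1 + M.chi t 0 0 * M.covChi k 1 1 t
      - 2 * (M.chi t 0 1 * M.covChi k 0 1 t)) :=
  pd_detForm ht (fun i j => (M.smooth_chi i j).differentiableAt_dom ht) (fun _ _ => chi_symm)
    (β := fun i j => M.covChi k i j t) k (pd_chi_eq_covChi k)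

theorem pd_Qgamma (k : Fin 2) : pd k M.Qgamma t
    = ((M.g t).det)⁻¹ * (M.covGamma k 0 0 t * M.gamma t 1 1 + M.gamma t 0 0 * M.covGamma k 1 1 t
      - 2 * (M.gamma t 0 1 * M.covGamma k 0 1 t)) :=
  pd_detForm ht (fun i j => (M.smooth_gamma i j).differentiableAt_dom ht) (fun _ _ => gamma_symm)
    (β := fun i j => M.covGamma k i j t) k (pd_gamma ht k)

/-! ### The invariant frame -/

theorem eps_cases : M.eps t = 1 ∨ M.eps t = -1 := by
  rcases Real.sign_apply_eq_of_ne_zero _ (M.det_g_ne t ht) with h | h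
  · exact Or.inr h
  · exact Or.inl h

theorem sqrt_det_ne : √|(M.g t).det| ≠ 0 :=
  (Real.sqrt_pos.mpr (abs_pos.mpr (M.det_g_ne t ht))).ne'

theorem eps_mul_sqrt_inv : M.eps t * (√|(M.g t).det|)⁻¹ ^ 2 = ((M.g t).det)⁻¹ := by
  have h0 := M.det_g_ne t ht
  rw [inv_pow, Real.sq_sqrt (abs_nonneg _), eps]
  rcases lt_or_gt_of_ne h0 with h | h
  · rw [Real.sign_of_neg h, abs_of_neg h]; field_simp
  · rw [Real.sign_of_pos h, abs_of_pos h]; field_simp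

omit ht in
theorem X_apply (i : Fin 2) :
    M.X t i = (M.g t)⁻¹ i 0 * M.dlnx t 0 + (M.g t)⁻¹ i 1 * M.dlnx t 1 := by
  simp [X, Matrix.mulVec, dotProduct, Fin.sum_univ_two]

omit ht in
theorem Y_zero : M.Y t 0 = -(M.dlnx t 1 * (√|(M.g t).det|)⁻¹) := by
  simp [Y, div_eq_mul_inv]

omit ht in
theorem Y_one : M.Y t 1 = M.dlnx t 0 * (√|(M.g t).det|)⁻¹ := by
  simp [Y, div_eq_mul_inv]

theorem Crho_eq_X : M.Crho t = M.X t 0 * M.dlnx t 0 + M.X t 1 * M.dlnx t 1 := by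
  rw [Crho_eq ht, X_apply, X_apply, inv_g_symm ht]; ring

omit ht in
theorem Y_dlnx : M.Y t 0 * M.dlnx t 0 + M.Y t 1 * M.dlnx t 1 = 0 := by
  rw [Y_zero, Y_one]; ring

/-- Y is the covector dx/x rotated by a right angle, and for a symmetric 2×2 matrix G one has (lᵀGl)
G = (Gl)(Gl)ᵀ + (det G) l^⊥(l^⊥)ᵀ. In this form the decomposition of g⁻¹ also holds where C_ρ = 0.
-/
theorem inv_g_mul_Crho (i j : Fin 2) : (M.g t)⁻¹ i j * M.Crho t
    = M.X t i * M.X t j + M.eps t * (M.Y t i * M.Y t j) := by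
  have h1 := (eps_mul_sqrt_inv ht).trans (inv_det_g ht)
  have hs := inv_g_symm ht
  rw [Crho_eq ht]
  fin_cases i <;> fin_cases j <;>
  simp only [Fin.zero_eta, Fin.mk_one, Fin.isValue, X_apply, Y_zero, Y_one, hs]
  · linear_combination (-M.dlnx t 1 ^ 2) * h1
  · linear_combination (M.dlnx t 1 * M.dlnx t 0) * h1
  · linear_combination (M.dlnx t 1 * M.dlnx t 0) * h1
  · linear_combination (-M.dlnx t 0 ^ 2) * h1

theorem inv_det_g_mul : ((M.g t).det)⁻¹ * M.Crho t ^ 2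
    = M.eps t * (M.X t 0 * M.Y t 1 - M.X t 1 * M.Y t 0) ^ 2 := by
  rw [← eps_mul_sqrt_inv ht, Crho_eq_X ht, Y_zero, Y_one]
  ring

theorem g_mulVec_X (i : Fin 2) : M.g t i 0 * M.X t 0 + M.g t i 1 * M.X t 1 = M.dlnx t i := by
  have := Matrix.mul_nonsing_inv _ (isUnit_iff_ne_zero.mpr (M.det_g_ne _ ht))
  have h : M.g t *ᵥ M.X t = M.dlnx t := by
    rw [X, Matrix.mulVec_mulVec, this, Matrix.one_mulVec]
  have := congrFun h i
  simpa [Matrix.mulVec, dotProduct, Fin.sum_univ_two] using this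

theorem g_Y_Y : M.g t 0 0 * M.Y t 0 ^ 2 + 2 * M.g t 0 1 * (M.Y t 0 * M.Y t 1)
    + M.g t 1 1 * M.Y t 1 ^ 2 = M.eps t * M.Crho t := by
  have h1 := eps_mul_sqrt_inv ht
  have he : M.eps t ^ 2 = 1 := by rcases eps_cases ht with h | h <;> rw [h] <;> norm_num
  have h0 := M.det_g_ne t ht
  have h2 : (√|(M.g t).det|)⁻¹ ^ 2 = M.eps t * ((M.g t).det)⁻¹ := by
    rw [← h1]; linear_combination (-(√|(M.g t).det|)⁻¹ ^ 2) * he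
  rw [Crho_eq ht, Y_zero, Y_one]
  simp only [inv_g_apply, Matrix.smul_apply, Matrix.of_apply, Matrix.cons_val',
    Matrix.cons_val_zero, Matrix.cons_val_one, smul_eq_mul, Matrix.cons_val_fin_one]
  linear_combination (M.g t 0 0 * M.dlnx t 1 ^ 2 - 2 * M.g t 0 1 * M.dlnx t 0 * M.dlnx t 1
    + M.g t 1 1 * M.dlnx t 0 ^ 2) * h2

omit ht in
/-- The contraction of a symmetric bilinear form with two vectors. -/
noncomputable def _root_.bilin (α : Fin 2 → Fin 2 → ℝ) (v w : Fin 2 → ℝ) : ℝ :=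
  ∑ i, ∑ j, v i * w j * α i j

section Frame

variable (hp : M.Crho t ≠ 0)
include hp

theorem trace_frame {α : Fin 2 → Fin 2 → ℝ} :
    ∑ i, ∑ j, (M.g t)⁻¹ i j * α i j = bilin α (M.X t) (M.X t) / M.Crho t
      + M.eps t * (bilin α (M.Y t) (M.Y t) / M.Crho t) := by
  have h := fun i j => (eq_div_iff hp).mpr (inv_g_mul_Crho ht i j)
  simp only [h, bilin, Fin.sum_univ_two]
  ring

/-- The determinant is polarised so that one formula serves both purposes: β = α gives twice the
determinant invariant, while β = ∇_kα gives its derivative. -/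
theorem det_frame {α β : Fin 2 → Fin 2 → ℝ} (hα : α 1 0 = α 0 1) (hβ : β 1 0 = β 0 1) :
    ((M.g t).det)⁻¹ * (β 0 0 * α 1 1 + α 0 0 * β 1 1 - 2 * (α 0 1 * β 0 1))
      = M.eps t * (bilin β (M.X t) (M.X t) / M.Crho t * (bilin α (M.Y t) (M.Y t) / M.Crho t)
        + bilin α (M.X t) (M.X t) / M.Crho t * (bilin β (M.Y t) (M.Y t) / M.Crho t)
        - 2 * (bilin α (M.X t) (M.Y t) / M.Crho t * (bilin β (M.X t) (M.Y t) / M.Crho t))) := by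
  have h := (eq_div_iff (pow_ne_zero 2 hp)).mpr (inv_det_g_mul ht)
  simp only [h, bilin, Fin.sum_univ_two, hα, hβ]
  ring

end Frame

omit ht in
theorem derivX_eq (f : (Fin 2 → ℝ) → ℝ) : M.derivX f t = ∑ k, M.X t k * pd k f t :=
  fderiv_eq_sum_pd _ _ _

omit ht in
theorem derivY_eq (f : (Fin 2 → ℝ) → ℝ) : M.derivY f t = ∑ k, M.Y t k * pd k f t :=
  fderiv_eq_sum_pd _ _ _

section Frame

variable (hp : M.Crho t ≠ 0)
include hp

theorem Cchi_frame : M.Cchi t = bilin (M.chi t) (M.X t) (M.X t) / M.Crho t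
    + M.eps t * (bilin (M.chi t) (M.Y t) (M.Y t) / M.Crho t) :=
  trace_frame ht hp

theorem Qchi_frame : M.Qchi t = M.eps t * (bilin (M.chi t) (M.X t) (M.X t) / M.Crho t
    * (bilin (M.chi t) (M.Y t) (M.Y t) / M.Crho t)
    - (bilin (M.chi t) (M.X t) (M.Y t) / M.Crho t) ^ 2) := by
  have h := det_frame ht hp (α := M.chi t) (β := M.chi t) chi_symm chi_symm
  rw [Qchi, detForm, Matrix.det_fin_two, chi_symm]
  linear_combination (1 / 2) * h

omit ht hp in
theorem bilin_gamma (v w : Fin 2 → ℝ) : bilin (M.gamma t) v w = bilin (M.chi t) v w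
    - 1 / 4 * ((v 0 * M.dlnx t 0 + v 1 * M.dlnx t 1) * (w 0 * M.dlnx t 0 + w 1 * M.dlnx t 1)) := by
  simp only [bilin, gamma_apply, Fin.sum_univ_two]; ring

theorem Qgamma_frame : M.Qgamma t
    = M.eps t * ((bilin (M.chi t) (M.X t) (M.X t) / M.Crho t - M.Crho t / 4)
      * (bilin (M.chi t) (M.Y t) (M.Y t) / M.Crho t)
      - (bilin (M.chi t) (M.X t) (M.Y t) / M.Crho t) ^ 2) := by
  have h := det_frame ht hp (α := M.gamma t) (β := M.gamma t) gamma_symm gamma_symm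
  have hX : bilin (M.gamma t) (M.X t) (M.X t) / M.Crho t
      = bilin (M.chi t) (M.X t) (M.X t) / M.Crho t - M.Crho t / 4 := by
    rw [bilin_gamma, ← Crho_eq_X ht]; field_simp
  rw [bilin_gamma _ (M.Y t), bilin_gamma _ (M.Y t), Y_dlnx, hX] at h
  rw [Qgamma, detForm, Matrix.det_fin_two, gamma_symm]
  linear_combination (1 / 2) * h

omit ht in
theorem I1_frame : M.I1 t
    = -(1 / 4) * (M.Crho t * (bilin (M.chi t) (M.X t) (M.Y t) / M.Crho t)) := by
  rw [mul_div_cancel₀ _ hp, I1]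
  simp only [bilin, dotProduct, Matrix.mulVec, Fin.sum_univ_two]
  ring

section Vacuum

variable {Λ : ℝ} (hM : M.IsVacuum Λ)
include hM

/-- All tensors are evaluated on X and Y and divided by p; what remains is the polynomial algebra of
`relations_of_frame_components`. -/
theorem vacuumRelations : M.VacuumRelations Λ t := by
  set p := M.Crho t with hpdef
  set a := bilin (M.chi t) (M.X t) (M.X t) / p with ha
  set b := bilin (M.chi t) (M.X t) (M.Y t) / p with hb
  set c := bilin (M.chi t) (M.Y t) (M.Y t) / p with hc
  have hlX : M.X t 0 * M.dlnx t 0 + M.X t 1 * M.dlnx t 1 = p := (Crho_eq_X ht).symm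
  have hlY : M.Y t 0 * M.dlnx t 0 + M.Y t 1 * M.dlnx t 1 = 0 := Y_dlnx
  have hgX0 := g_mulVec_X ht 0
  have hgX1 := g_mulVec_X ht 1
  have hgYY := g_Y_Y ht
  have hgs := g_symm ht
  have pa : p * a = bilin (M.chi t) (M.X t) (M.X t) := mul_div_cancel₀ _ hp
  have pb : p * b = bilin (M.chi t) (M.X t) (M.Y t) := mul_div_cancel₀ _ hp
  have pc : p * c = bilin (M.chi t) (M.Y t) (M.Y t) := mul_div_cancel₀ _ hp
  -- the Hessian of `ln x`
  have hess : ∀ v w, bilin (fun i j => M.hessLnx i j t) v w = bilin (M.chi t) v w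
      - 1 / 2 * (v 0 * M.dlnx t 0 + v 1 * M.dlnx t 1) * (w 0 * M.dlnx t 0 + w 1 * M.dlnx t 1)
      - (2 * Λ + 1 / 2 * M.Cchi t) * bilin (M.g t) v w := by
    intro v w
    simp only [bilin, hessLnx_vacuum ht hM, Fin.sum_univ_two]
    ring
  have hgXX : bilin (M.g t) (M.X t) (M.X t) = p := by
    simp only [bilin, Fin.sum_univ_two]
    linear_combination M.X t 0 * hgX0 + M.X t 1 * hgX1 + hlX
  have hgXY : bilin (M.g t) (M.X t) (M.Y t) = 0 := by
    simp only [bilin, Fin.sum_univ_two]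
    linear_combination M.Y t 0 * hgX0 + M.Y t 1 * hgX1 + hlY
      + (M.X t 1 * M.Y t 0 - M.X t 0 * M.Y t 1) * hgs
  have hgYY' : bilin (M.g t) (M.Y t) (M.Y t) = M.eps t * p := by
    simp only [bilin, Fin.sum_univ_two, hgs]
    linear_combination hgYY
  have hH11 : bilin (fun i j => M.hessLnx i j t) (M.X t) (M.X t)
      = p * a - 1 / 2 * p ^ 2 - (2 * Λ + 1 / 2 * M.Cchi t) * p := by
    rw [hess, hlX, hgXX, pa]; ring
  have hH12 : bilin (fun i j => M.hessLnx i j t) (M.X t) (M.Y t) = p * b := by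
    rw [hess, hlY, hgXY, pb]; ring
  have hH22 : bilin (fun i j => M.hessLnx i j t) (M.Y t) (M.Y t)
      = p * c - (2 * Λ + 1 / 2 * M.Cchi t) * (M.eps t * p) := by
    rw [hess, hlY, hgYY', pc]; ring
  -- the covariant derivative of `χ`
  have hHs : M.hessLnx 1 0 t = M.hessLnx 0 1 t := by
    rw [hessLnx_vacuum ht hM, hessLnx_vacuum ht hM, chi_symm, hgs]; ring
  have hDs : ∀ k, M.covChi k 1 0 t = M.covChi k 0 1 t := by
    intro k; simp only [covChi_eq ht, chi_symm]; ring
  have hDgs : ∀ k, M.covGamma k 1 0 t = M.covGamma k 0 1 t := by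
    intro k; simp only [covGamma, hDs]; ring
  have hG := fun i j => (eq_div_iff hp).mpr (inv_g_mul_Crho ht i j)
  have hcod : ∀ k, ∑ i, ∑ j, (M.g t)⁻¹ i j * (M.covChi i j k t - 1 / 2 * M.covChi k i j t)
      = -(1 / 2) * (M.X t 0 * M.chi t 0 k + M.X t 1 * M.chi t 1 k) - Λ * M.dlnx t k := by
    intro k
    rw [codazzi ht hM, X_apply, X_apply]
    simp only [Fin.sum_univ_two, inv_g_symm ht]; ring
  simp only [Fin.sum_univ_two, hG] at hcod
  have cod0 := hcod 0
  have cod1 := hcod 1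
  simp only [hDs, chi_symm] at cod0 cod1
  -- D u v w is (∇_u χ)(v,w)/p. Its values on the frame are the six unknowns of the algebraic
  -- identity.
  set D : (Fin 2 → ℝ) → (Fin 2 → ℝ) → (Fin 2 → ℝ) → ℝ := fun u v w =>
    (u 0 * bilin (fun i j => M.covChi 0 i j t) v w
      + u 1 * bilin (fun i j => M.covChi 1 i j t) v w) / p with hD
  have hcodX : D (M.X t) (M.X t) (M.X t) + M.eps t * D (M.Y t) (M.X t) (M.Y t)
      - 1 / 2 * (D (M.X t) (M.X t) (M.X t) + M.eps t * D (M.X t) (M.Y t) (M.Y t))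
      = -(1 / 2) * p * a - Λ * p := by
    rw [mul_assoc, pa]
    simp only [hD, bilin, Fin.sum_univ_two, hDs, chi_symm]
    linear_combination M.X t 0 * cod0 + M.X t 1 * cod1 - Λ * hlX
  have hcodY : D (M.X t) (M.X t) (M.Y t) + M.eps t * D (M.Y t) (M.Y t) (M.Y t)
      - 1 / 2 * (D (M.Y t) (M.X t) (M.X t) + M.eps t * D (M.Y t) (M.Y t) (M.Y t))
      = -(1 / 2) * p * b := by
    rw [mul_assoc, pb]
    simp only [hD, bilin, Fin.sum_univ_two, hDs, chi_symm]
    linear_combination M.Y t 0 * cod0 + M.Y t 1 * cod1 - Λ * hlY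
  have hgam : ∀ k v w, bilin (fun i j => M.covGamma k i j t) v w
      = bilin (fun i j => M.covChi k i j t) v w
        - 1 / 4 * ((v 0 * M.hessLnx k 0 t + v 1 * M.hessLnx k 1 t)
            * (w 0 * M.dlnx t 0 + w 1 * M.dlnx t 1)
          + (v 0 * M.dlnx t 0 + v 1 * M.dlnx t 1)
            * (w 0 * M.hessLnx k 0 t + w 1 * M.hessLnx k 1 t)) := by
    intro k v w
    simp only [bilin, covGamma, Fin.sum_univ_two]; ring
  have pdQg := fun k => (pd_Qgamma ht k).trans
    (det_frame ht hp (α := M.gamma t) (β := fun i j => M.covGamma k i j t) gamma_symm (hDgs k))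
  have pdQc := fun k => (pd_Qchi ht k).trans
    (det_frame ht hp (α := M.chi t) (β := fun i j => M.covChi k i j t) chi_symm (hDs k))
  have pdCc := fun k => (pd_Cchi ht k).trans (trace_frame ht hp (α := fun i j => M.covChi k i j t))
  simp only [hgam, bilin_gamma, hlX, hlY, ← pa, ← pb, ← pc, ← hpdef] at pdQg
  simp only [← pa, ← pb, ← pc, ← hpdef] at pdQc
  simp only [← hpdef] at pdCc
  simp only [bilin, Fin.sum_univ_two, hHs] at hH11 hH12 hH22
  have hrel := relations_of_frame_components (M.eps t) p Λ a b c _ _ _ _ _ _ (eps_cases ht)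
    hcodX hcodY (Cc := M.Cchi t) (Cg := M.Cgamma t) (Qc := M.Qchi t) (Qg := M.Qgamma t)
    (I1 := M.I1 t) (I2 := M.I2 t) (I3 := M.I3 t) (I4 := M.I4 t)
    (XCc := M.derivX M.Cchi t) (YCc := M.derivY M.Cchi t) (XQc := M.derivX M.Qchi t)
    (YQc := M.derivY M.Qchi t) (XQg := M.derivX M.Qgamma t) (YQg := M.derivY M.Qgamma t)
    (Cchi_frame ht hp) (by rw [Cgamma_eq, Cchi_frame ht hp]; ring) (Qchi_frame ht hp)
    (Qgamma_frame ht hp) (I1_frame hp) rfl rfl rfl hH11 hH12 hH22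
    (by rw [derivX_eq]; simp only [Fin.sum_univ_two, pdCc, hD]; ring)
    (by rw [derivY_eq]; simp only [Fin.sum_univ_two, pdCc, hD]; ring)
    (by rw [derivX_eq]; simp only [Fin.sum_univ_two, pdQc, hD]; field_simp; ring)
    (by rw [derivY_eq]; simp only [Fin.sum_univ_two, pdQc, hD]; field_simp; ring)
    (by
      rw [derivX_eq]; simp only [Fin.sum_univ_two, pdQg, hD, hHs]; field_simp; ring)
    (by
      rw [derivY_eq]; simp only [Fin.sum_univ_two, pdQg, hD, hHs]; field_simp; ring)
  obtain ⟨r1, r2, r3⟩ := hrel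
  have hXl : ∀ i, M.X t i = (M.g t)⁻¹ i 0 * M.dlnx t 0 + (M.g t)⁻¹ i 1 * M.dlnx t 1 := X_apply
  -- Since C_ρ is the squared length of dx/x, its differential is twice the Hessian of ln x
  -- contracted with X; ∇χ does not enter.
  have pdCr : ∀ k, pd k M.Crho t
      = 2 * (M.X t 0 * M.hessLnx k 0 t + M.X t 1 * M.hessLnx k 1 t) := by
    intro k
    rw [pd_Crho ht, hXl, hXl]
    simp only [Fin.sum_univ_two, inv_g_symm ht]; ring
  refine ⟨r1, ?_, ?_, r2, r3⟩
  · rw [derivY_eq, I1_frame hp]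
    simp only [Fin.sum_univ_two, pdCr, hHs]
    linear_combination 2 * hH12
  · rw [derivX_eq, Qgamma_frame ht hp, Qchi_frame ht hp, Cgamma_eq]
    simp only [Fin.sum_univ_two, pdCr, hHs]
    have hC := Cchi_frame ht hp
    simp only [← ha, ← hb, ← hc, ← hpdef] at hC ⊢
    linear_combination 2 * hH11 - 2 * p * hC

end Vacuum

end Frame

end AdaptedMetric

/-! ### Rigidity of surfaces in the space of symmetric matrices -/

theorem eventually_eq_of_pd_eq_zero {f : (Fin 2 → ℝ) → ℝ} {U : Set (Fin 2 → ℝ)} (hU : IsOpen U)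
    {t₀ : Fin 2 → ℝ} (h₀ : t₀ ∈ U) (hd : ∀ t ∈ U, DifferentiableAt ℝ f t)
    (hf : ∀ t ∈ U, ∀ i, pd i f t = 0) : ∀ᶠ t in 𝓝 t₀, f t = f t₀ := by
  obtain ⟨r, hr, hB⟩ := Metric.isOpen_iff.mp hU t₀ h₀
  filter_upwards [Metric.ball_mem_nhds t₀ hr] with t ht
  refine Metric.isOpen_ball.is_const_of_fderiv_eq_zero (s := Metric.ball t₀ r) (𝕜 := ℝ)
    (convex_ball t₀ r).isPreconnected
    (fun z hz => (hd z (hB hz)).differentiableWithinAt) (fun z hz => ?_) ht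
    (Metric.mem_ball_self hr)
  ext v
  rw [fderiv_eq_sum_pd]
  simp [hf z (hB hz)]

/-- The polar form of `det` in the coordinates `(h₁₁, h₁₂, h₂₂)` of a symmetric matrix. -/
noncomputable def detPolar (v w : Fin 3 → ℝ) : ℝ := (v 0 * w 2 + v 2 * w 0) / 2 - v 1 * w 1

/-- The Gram matrix of `detPolar`. -/
noncomputable def detPolarMatrix : Matrix (Fin 3) (Fin 3) ℝ :=
  !![0, 0, 1 / 2; 0, -1, 0; 1 / 2, 0, 0]

/-- The determinant of three vectors. -/
noncomputable def triple (u v w : Fin 3 → ℝ) : ℝ :=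
  u 0 * (v 1 * w 2 - v 2 * w 1) - u 1 * (v 0 * w 2 - v 2 * w 0) + u 2 * (v 0 * w 1 - v 1 * w 0)

/-- The vector product adapted to `detPolar`. -/
noncomputable def detCross (u v : Fin 3 → ℝ) : Fin 3 → ℝ :=
  ![2 * (u 0 * v 1 - u 1 * v 0), u 0 * v 2 - u 2 * v 0, 2 * (u 1 * v 2 - u 2 * v 1)]

theorem detPolar_detCross (u v w : Fin 3 → ℝ) : detPolar (detCross u v) w = triple u v w := by
  simp [detPolar, detCross, triple]; ring

theorem detPolar_comm (v w : Fin 3 → ℝ) : detPolar v w = detPolar w v := by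
  simp only [detPolar]; ring

theorem triple_detCross (u v : Fin 3 → ℝ) : triple u v (detCross u v)
    = 4 * (detPolar u u * detPolar v v - detPolar u v ^ 2) := by
  simp [detPolar, detCross, triple]; ring

/-- The bracket is the Gram determinant, and the factor 4 is the reciprocal of the determinant of
`detPolarMatrix`. -/
theorem triple_sq (u v w : Fin 3 → ℝ) : triple u v w ^ 2
    = 4 * (detPolar u u * (detPolar v v * detPolar w w - detPolar v w ^ 2)
      - detPolar u v * (detPolar u v * detPolar w w - detPolar v w * detPolar u w)
      + detPolar u w * (detPolar u v * detPolar v w - detPolar v v * detPolar u w)) := by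
  simp only [detPolar, triple]; ring

/-- Componentwise partial derivative. -/
noncomputable def pdv (i : Fin 2) (u : (Fin 2 → ℝ) → Fin 3 → ℝ) (t : Fin 2 → ℝ) : Fin 3 → ℝ :=
  fun a => pd i (fun z => u z a) t

theorem pd_detPolar {u v : (Fin 2 → ℝ) → Fin 3 → ℝ} {t : Fin 2 → ℝ}
    (hu : ∀ a, DifferentiableAt ℝ (fun z => u z a) t)
    (hv : ∀ a, DifferentiableAt ℝ (fun z => v z a) t) (i : Fin 2) :
    pd i (fun z => detPolar (u z) (v z)) t
      = detPolar (pdv i u t) (v t) + detPolar (u t) (pdv i v t) := by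
  have h1 := (hu 0).fun_mul (hv 2)
  have h2 := (hu 2).fun_mul (hv 0)
  have h3 := (hu 1).fun_mul (hv 1)
  have : (fun z => detPolar (u z) (v z))
      = fun z => 1 / 2 * (u z 0 * v z 2 + u z 2 * v z 0) - u z 1 * v z 1 := by
    funext z; simp only [detPolar]; ring
  rw [this, pd_sub ((h1.fun_add h2).const_mul _) h3, pd_const_mul _ (h1.fun_add h2), pd_add h1 h2,
    pd_mul (hu 0) (hv 2), pd_mul (hu 2) (hv 0), pd_mul (hu 1) (hv 1)]
  simp only [detPolar, pdv]; ring

theorem pd_triple {u v w : (Fin 2 → ℝ) → Fin 3 → ℝ} {t : Fin 2 → ℝ}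
    (hu : ∀ a, DifferentiableAt ℝ (fun z => u z a) t)
    (hv : ∀ a, DifferentiableAt ℝ (fun z => v z a) t)
    (hw : ∀ a, DifferentiableAt ℝ (fun z => w z a) t) (i : Fin 2) :
    pd i (fun z => triple (u z) (v z) (w z)) t = triple (pdv i u t) (v t) (w t)
      + triple (u t) (pdv i v t) (w t) + triple (u t) (v t) (pdv i w t) := by
  have h1 := fun a b => (hv a).fun_mul (hw b)
  have h2 := fun a b c d => (h1 a b).fun_sub (h1 c d)
  have h3 := fun e a b c d => (hu e).fun_mul (h2 a b c d)
  simp only [triple]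
  rw [pd_add ((h3 _ _ _ _ _).fun_sub (h3 _ _ _ _ _)) (h3 _ _ _ _ _),
    pd_sub (h3 _ _ _ _ _) (h3 _ _ _ _ _), pd_mul (hu _) (h2 _ _ _ _), pd_mul (hu _) (h2 _ _ _ _),
    pd_mul (hu _) (h2 _ _ _ _), pd_sub (h1 _ _) (h1 _ _), pd_sub (h1 _ _) (h1 _ _),
    pd_sub (h1 _ _) (h1 _ _)]
  simp only [pd_mul (hv _) (hw _), pdv]
  ring

theorem det_detPolarMatrix : detPolarMatrix.det ≠ 0 := by
  simp [detPolarMatrix, Matrix.det_fin_three]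

theorem transpose_mul_detPolarMatrix_mul (F F' : Matrix (Fin 3) (Fin 3) ℝ) (a b : Fin 3) :
    (Fᵀ * detPolarMatrix * F') a b = detPolar (fun i => F i a) (fun i => F' i b) := by
  simp [Matrix.mul_apply, Fin.sum_univ_three, detPolarMatrix, detPolar]; ring

/-- Two moving frames with proportional Gram matrices and proportional connection coefficients
differ by a constant linear map. -/
theorem exists_linear_of_frames {U : Set (Fin 2 → ℝ)} (hU : IsOpen U) {t₀ : Fin 2 → ℝ}
    (h₀ : t₀ ∈ U) {c : ℝ} (hc : c ≠ 0) {F F' : (Fin 2 → ℝ) → Matrix (Fin 3) (Fin 3) ℝ}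
    (hF : ∀ t ∈ U, ∀ a b, DifferentiableAt ℝ (fun z => F z a b) t)
    (hF' : ∀ t ∈ U, ∀ a b, DifferentiableAt ℝ (fun z => F' z a b) t)
    (hdet : ∀ t ∈ U, (F t).det ≠ 0)
    (hGram : ∀ t ∈ U, ∀ a b, detPolar (fun i => F' t i a) (fun i => F' t i b)
      = c * detPolar (fun i => F t i a) (fun i => F t i b))
    (hConn : ∀ t ∈ U, ∀ i a b, detPolar (fun k => F' t k a) (pdv i (fun z k => F' z k b) t)
      = c * detPolar (fun k => F t k a) (pdv i (fun z k => F z k b) t)) :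
    ∃ L : Matrix (Fin 3) (Fin 3) ℝ, Lᵀ * detPolarMatrix * L = c • detPolarMatrix ∧
      ∀ᶠ t in 𝓝 t₀, F' t = L * F t := by
  have hunit : ∀ t ∈ U, IsUnit (F t).det := fun t ht => isUnit_iff_ne_zero.mpr (hdet t ht)
  have hG : ∀ t ∈ U, (F' t)ᵀ * detPolarMatrix * F' t
      = c • ((F t)ᵀ * detPolarMatrix * F t) := by
    intro t ht
    ext a b
    rw [Matrix.smul_apply, transpose_mul_detPolarMatrix_mul, transpose_mul_detPolarMatrix_mul,
      hGram t ht, smul_eq_mul]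
  set L : (Fin 2 → ℝ) → Matrix (Fin 3) (Fin 3) ℝ := fun t => F' t * (F t)⁻¹ with hL
  have hLF : ∀ t ∈ U, L t * F t = F' t := by
    intro t ht
    simp only [hL]
    rw [Matrix.mul_assoc, Matrix.nonsing_inv_mul _ (hunit t ht), Matrix.mul_one]
  have hFL : ∀ t ∈ U, (F' t)ᵀ * detPolarMatrix * L t = c • ((F t)ᵀ * detPolarMatrix) := by
    intro t ht
    simp only [hL]
    rw [← Matrix.mul_assoc, hG t ht, Matrix.smul_mul, Matrix.mul_assoc,
      Matrix.mul_nonsing_inv _ (hunit t ht), Matrix.mul_one]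
  have hLL : ∀ t ∈ U, (L t)ᵀ * detPolarMatrix * L t = c • detPolarMatrix := by
    intro t ht
    have h1 := hFL t ht
    rw [← hLF t ht, Matrix.transpose_mul, Matrix.mul_assoc, Matrix.mul_assoc,
      ← Matrix.mul_smul] at h1
    have hu : IsUnit (F t)ᵀ.det := by rw [Matrix.det_transpose]; exact hunit t ht
    have h2 := congrArg (fun A => ((F t)ᵀ)⁻¹ * A) h1
    simp only [← Matrix.mul_assoc, Matrix.nonsing_inv_mul _ hu, Matrix.one_mul] at h2
    exact h2
  have hLd : ∀ t ∈ U, ∀ a b, DifferentiableAt ℝ (fun z => L z a b) t := by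
    intro t ht a b
    have hd := hF t ht
    have hdF : DifferentiableAt ℝ (fun z => (F z).det) t := by
      simp only [Matrix.det_fin_three]; fun_prop
    have hadj : ∀ a b, DifferentiableAt ℝ (fun z => (F z).adjugate a b) t := by
      intro a b
      simp only [Matrix.adjugate_fin_three]
      fin_cases a <;> fin_cases b <;> simp <;> fun_prop
    have hinv : ∀ a b, DifferentiableAt ℝ (fun z => (F z)⁻¹ a b) t := by
      intro a b
      simp only [Matrix.inv_def, Ring.inverse_eq_inv', Matrix.smul_apply, smul_eq_mul]
      exact (hdF.inv (hdet t ht)).mul (hadj a b)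
    simp only [hL, Matrix.mul_apply]
    exact DifferentiableAt.fun_sum fun k _ => (hF' t ht a k).mul (hinv k b)
  -- Differentiate L F = F' and pair with F'. The connection hypothesis cancels the terms containing
  -- dF and dF', leaving dL between invertible factors.
  have hLpd : ∀ t ∈ U, ∀ i a b, pd i (fun z => L z a b) t = 0 := by
    intro t ht i
    set dL : Matrix (Fin 3) (Fin 3) ℝ := Matrix.of fun a b => pd i (fun z => L z a b) t with hdL
    set dF : Matrix (Fin 3) (Fin 3) ℝ := Matrix.of fun a b => pd i (fun z => F z a b) t with hdF
    set dF' : Matrix (Fin 3) (Fin 3) ℝ := Matrix.of fun a b => pd i (fun z => F' z a b) t with hdF'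
    have hprod : dL * F t + L t * dF = dF' := by
      ext a b
      have h1 : pd i (fun z => F' z a b) t = pd i (fun z => ∑ k, L z a k * F z k b) t :=
        pd_congr_of_isOpen hU (fun z hz => by rw [← hLF z hz, Matrix.mul_apply]) ht
      rw [pd_sum _ (fun k _ => (hLd t ht a k).fun_mul (hF t ht k b))] at h1
      simp only [pd_mul (hLd t ht _ _) (hF t ht _ _), Finset.sum_add_distrib] at h1
      simp [hdL, hdF, hdF', Matrix.mul_apply, h1]
    have hC : (F' t)ᵀ * detPolarMatrix * dF' = c • ((F t)ᵀ * detPolarMatrix * dF) := by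
      ext a b
      rw [Matrix.smul_apply, transpose_mul_detPolarMatrix_mul, transpose_mul_detPolarMatrix_mul,
        smul_eq_mul]
      exact hConn t ht i a b
    have hz : (F' t)ᵀ * detPolarMatrix * (dL * F t) = 0 := by
      have : dL * F t = dF' - L t * dF := by rw [← hprod]; abel
      rw [this, Matrix.mul_sub, hC, ← Matrix.mul_assoc, hFL t ht, Matrix.smul_mul, sub_self]
    have hdF'0 : ((F' t)ᵀ * detPolarMatrix).det ≠ 0 := by
      have h1 := congrArg Matrix.det (hG t ht)
      intro h0
      rw [Matrix.det_mul, h0, zero_mul, Matrix.det_smul, Matrix.det_mul, Matrix.det_mul,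
        Matrix.det_transpose] at h1
      exact mul_ne_zero (pow_ne_zero _ hc) (mul_ne_zero (mul_ne_zero (hdet t ht)
        det_detPolarMatrix) (hdet t ht)) h1.symm
    have h2 : dL * F t = 0 := by
      have := congrArg (fun A => ((F' t)ᵀ * detPolarMatrix)⁻¹ * A) hz
      simpa only [← Matrix.mul_assoc, Matrix.nonsing_inv_mul _ (isUnit_iff_ne_zero.mpr hdF'0),
        Matrix.one_mul, Matrix.mul_zero] using this
    have h3 : dL = 0 := by
      have := congrArg (fun A => A * (F t)⁻¹) h2
      simpa only [Matrix.mul_assoc, Matrix.mul_nonsing_inv _ (hunit t ht), Matrix.mul_one,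
        Matrix.zero_mul] using this
    intro a b
    exact congrFun (congrFun h3 a) b
  refine ⟨L t₀, hLL t₀ h₀, ?_⟩
  have hall : ∀ᶠ t in 𝓝 t₀, ∀ a b, L t a b = L t₀ a b :=
    Filter.eventually_all.mpr fun a => Filter.eventually_all.mpr fun b =>
      eventually_eq_of_pd_eq_zero hU h₀ (fun t ht => hLd t ht a b) (fun t ht i => hLpd t ht i a b)
  filter_upwards [hall, hU.mem_nhds h₀] with t ht htU
  have : L t = L t₀ := by ext a b; exact ht a b
  rw [← this, hLF t htU]

section Surfaces

variable {U : Set (Fin 2 → ℝ)} (hU : IsOpen U) {t₀ : Fin 2 → ℝ} (h₀ : t₀ ∈ U) {c : ℝ}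
  {H H' : (Fin 2 → ℝ) → Fin 3 → ℝ}
  (hH : ∀ a, ContDiffOn ℝ ∞ (fun z => H z a) U) (hH' : ∀ a, ContDiffOn ℝ ∞ (fun z => H' z a) U)

include hU hH in
theorem contDiffOn_pdv (i : Fin 2) (a : Fin 3) : ContDiffOn ℝ ∞ (fun z => pdv i H z a) U :=
  (hH a).pd hU i

include hU hH in
theorem pdv_comm {t : Fin 2 → ℝ} (ht : t ∈ U) (i j : Fin 2) :
    pdv i (pdv j H) t = pdv j (pdv i H) t :=
  funext fun a => pd_comm (hH a) hU ht i j

variable (hHH : ∀ t ∈ U, detPolar (H' t) (H' t) = c * detPolar (H t) (H t))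
  (hHi : ∀ t ∈ U, ∀ i, detPolar (H' t) (pdv i H' t) = c * detPolar (H t) (pdv i H t))
  (hij : ∀ t ∈ U, ∀ i j, detPolar (pdv i H' t) (pdv j H' t)
    = c * detPolar (pdv i H t) (pdv j H t))

include hU in
theorem detPolar_pdv_of_eq {u v u' v' : (Fin 2 → ℝ) → Fin 3 → ℝ}
    (hu : ∀ a, ContDiffOn ℝ ∞ (fun z => u z a) U) (hv : ∀ a, ContDiffOn ℝ ∞ (fun z => v z a) U)
    (hu' : ∀ a, ContDiffOn ℝ ∞ (fun z => u' z a) U)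
    (hv' : ∀ a, ContDiffOn ℝ ∞ (fun z => v' z a) U)
    (h : ∀ t ∈ U, detPolar (u' t) (v' t) = c * detPolar (u t) (v t)) {t : Fin 2 → ℝ} (ht : t ∈ U)
    (i : Fin 2) :
    detPolar (pdv i u' t) (v' t) + detPolar (u' t) (pdv i v' t)
      = c * (detPolar (pdv i u t) (v t) + detPolar (u t) (pdv i v t)) := by
  have d := fun {f : (Fin 2 → ℝ) → ℝ} (hf : ContDiffOn ℝ ∞ f U) =>
    hf.differentiableAt_of_isOpen hU ht
  have hd : DifferentiableAt ℝ (fun z => detPolar (u z) (v z)) t := by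
    have h1 := fun a => d (hu a)
    have h2 := fun a => d (hv a)
    simp only [detPolar]; fun_prop
  rw [← pd_detPolar (fun a => d (hu' a)) (fun a => d (hv' a)),
    ← pd_detPolar (fun a => d (hu a)) (fun a => d (hv a)), ← pd_const_mul c hd]
  exact pd_congr_of_isOpen hU h ht

/-- The derivative of a surface along a constant vector. -/
noncomputable def dirDeriv (v : Fin 2 → ℝ) (H : (Fin 2 → ℝ) → Fin 3 → ℝ) (t : Fin 2 → ℝ) :
    Fin 3 → ℝ :=
  fun a => v 0 * pdv 0 H t a + v 1 * pdv 1 H t a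

theorem detPolar_dirDeriv (u : Fin 3 → ℝ) (v : Fin 2 → ℝ) (t : Fin 2 → ℝ) :
    detPolar u (dirDeriv v H t) = v 0 * detPolar u (pdv 0 H t) + v 1 * detPolar u (pdv 1 H t) := by
  simp only [detPolar, dirDeriv]; ring

include hU hH in
theorem contDiffOn_dirDeriv (v : Fin 2 → ℝ) (a : Fin 3) :
    ContDiffOn ℝ ∞ (fun z => dirDeriv v H z a) U :=
  (contDiffOn_const.mul (contDiffOn_pdv hU hH 0 a)).add
    (contDiffOn_const.mul (contDiffOn_pdv hU hH 1 a))

include hU hH in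
theorem pdv_dirDeriv (v : Fin 2 → ℝ) {t : Fin 2 → ℝ} (ht : t ∈ U) (i : Fin 2) :
    pdv i (dirDeriv v H) t
      = fun a => v 0 * pdv i (pdv 0 H) t a + v 1 * pdv i (pdv 1 H) t a := by
  funext a
  have hd := fun j => (contDiffOn_pdv hU hH j a).differentiableAt_of_isOpen hU ht
  simp only [pdv, dirDeriv] at hd ⊢
  rw [pd_add ((hd 0).const_mul _) ((hd 1).const_mul _), pd_const_mul _ (hd 0),
    pd_const_mul _ (hd 1)]

theorem contDiffOn_detCross {u v : (Fin 2 → ℝ) → Fin 3 → ℝ} (r : ℝ)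
    (hu : ∀ a, ContDiffOn ℝ ∞ (fun z => u z a) U) (hv : ∀ a, ContDiffOn ℝ ∞ (fun z => v z a) U)
    (a : Fin 3) : ContDiffOn ℝ ∞ (fun z => (r • detCross (u z) (v z)) a) U := by
  have h := fun a b c d => ((hu a).mul (hv b)).sub ((hu c).mul (hv d))
  fin_cases a
  exacts [contDiffOn_const.mul (contDiffOn_const.mul (h 0 1 1 0)),
    contDiffOn_const.mul (h 0 2 2 0), contDiffOn_const.mul (contDiffOn_const.mul (h 1 2 2 1))]

include hU hH in
/-- For a surface lying in planes through the origin to second order, the normal is parallel. -/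
theorem detCross_connection (r : ℝ) (v : Fin 2 → ℝ)
    (h3 : ∀ t ∈ U, ∀ i j, triple (H t) (pdv i H t) (pdv j H t) = 0)
    (h4 : ∀ t ∈ U, ∀ i j k, triple (H t) (pdv k H t) (pdv i (pdv j H) t) = 0)
    {t : Fin 2 → ℝ} (ht : t ∈ U) :
    detPolar (r • detCross (H t) (dirDeriv v H t)) (H t) = 0 ∧
    detPolar (r • detCross (H t) (dirDeriv v H t)) (dirDeriv v H t) = 0 ∧
    (∀ i, detPolar (r • detCross (H t) (dirDeriv v H t)) (pdv i H t) = 0) ∧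
    (∀ i, detPolar (r • detCross (H t) (dirDeriv v H t)) (pdv i (dirDeriv v H) t) = 0) ∧
    (∀ i, detPolar (H t) (pdv i (fun z => r • detCross (H z) (dirDeriv v H z)) t) = 0) ∧
    ∀ i, detPolar (dirDeriv v H t) (pdv i (fun z => r • detCross (H z) (dirDeriv v H z)) t) = 0 := by
  have hK := contDiffOn_dirDeriv hU hH v
  have hN := contDiffOn_detCross r hH hK
  have hsm : ∀ t w, detPolar (r • detCross (H t) (dirDeriv v H t)) w
      = r * triple (H t) (dirDeriv v H t) w := by
    intro t w
    rw [← detPolar_detCross]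
    simp only [detPolar, Pi.smul_apply, smul_eq_mul]; ring
  have z1 : ∀ t, detPolar (r • detCross (H t) (dirDeriv v H t)) (H t) = 0 := by
    intro t; rw [hsm, triple]; ring
  have z2 : ∀ t, detPolar (r • detCross (H t) (dirDeriv v H t)) (dirDeriv v H t) = 0 := by
    intro t; rw [hsm, triple]; ring
  have hlin : ∀ w, triple (H t) (dirDeriv v H t) w
      = v 0 * triple (H t) (pdv 0 H t) w + v 1 * triple (H t) (pdv 1 H t) w := by
    intro w; simp only [triple, dirDeriv]; ring
  have z3 : ∀ i, detPolar (r • detCross (H t) (dirDeriv v H t)) (pdv i H t) = 0 := by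
    intro i; rw [hsm, hlin, h3 t ht, h3 t ht]; ring
  have z4 : ∀ i, detPolar (r • detCross (H t) (dirDeriv v H t)) (pdv i (dirDeriv v H) t) = 0 := by
    intro i
    have : ∀ u w, triple u w (pdv i (dirDeriv v H) t) = v 0 * triple u w (pdv i (pdv 0 H) t)
        + v 1 * triple u w (pdv i (pdv 1 H) t) := by
      intro u w; rw [pdv_dirDeriv hU hH v ht]; simp only [triple]; ring
    rw [hsm, this, hlin, hlin, h4 t ht, h4 t ht, h4 t ht, h4 t ht]; ring
  have d := fun {f : (Fin 2 → ℝ) → ℝ} (hf : ContDiffOn ℝ ∞ f U) =>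
    hf.differentiableAt_of_isOpen hU ht
  refine ⟨z1 t, z2 t, z3, z4, fun i => ?_, fun i => ?_⟩
  · have := pd_detPolar (fun a => d (hN a)) (fun a => d (hH a)) i
    simp only [z1, pd_const, z3] at this
    rw [detPolar_comm]; linarith
  · have := pd_detPolar (fun a => d (hN a)) (fun a => d (hK a)) i
    simp only [z2, pd_const] at this
    have h5 := z4 i
    rw [detPolar_comm]
    change _ = _ + detPolar _ (pdv i (dirDeriv v H) t) at this
    linarith

include hU h₀ hH hH' hHH hHi hij

/-- Two surfaces with proportional first fundamental data and linearly independent position vector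
and tangent vectors differ by a linear map. -/
theorem exists_linear_of_nondegenerate (hc : c ≠ 0)
    (hdet : ∀ t ∈ U, triple (H t) (pdv 0 H t) (pdv 1 H t) ≠ 0) :
    ∃ L : Matrix (Fin 3) (Fin 3) ℝ, Lᵀ * detPolarMatrix * L = c • detPolarMatrix ∧
      ∀ᶠ t in 𝓝 t₀, H' t = L *ᵥ H t := by
  have d := fun {t : Fin 2 → ℝ} (ht : t ∈ U) {f : (Fin 2 → ℝ) → ℝ} (hf : ContDiffOn ℝ ∞ f U) =>
    hf.differentiableAt_of_isOpen hU ht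
  let F (H : (Fin 2 → ℝ) → Fin 3 → ℝ) (t : Fin 2 → ℝ) : Matrix (Fin 3) (Fin 3) ℝ :=
    Matrix.of fun a b => ![H t a, pdv 0 H t a, pdv 1 H t a] b
  have hpH := contDiffOn_pdv hU hH
  have hpH' := contDiffOn_pdv hU hH'
  have hHi' : ∀ t ∈ U, ∀ i, detPolar (pdv i H' t) (H' t) = c * detPolar (pdv i H t) (H t) := by
    intro t ht i; rw [detPolar_comm, hHi t ht, detPolar_comm]
  -- From differentiating ⟨H, ∂_jH⟩ and subtracting ⟨∂_iH, ∂_jH⟩.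
  have h2 : ∀ t ∈ U, ∀ i j, detPolar (H' t) (pdv i (pdv j H') t)
      = c * detPolar (H t) (pdv i (pdv j H) t) := by
    intro t ht i j
    have := detPolar_pdv_of_eq hU hH (hpH j) hH' (hpH' j) (fun t ht => hHi t ht j) ht i
    linear_combination this - hij t ht i j
  -- The Koszul formula: an alternating sum of three derivatives of the first fundamental form
  -- isolates ⟨∂_kH, ∂_i∂_jH⟩.
  have h3 : ∀ t ∈ U, ∀ i j k, detPolar (pdv k H' t) (pdv i (pdv j H') t)
      = c * detPolar (pdv k H t) (pdv i (pdv j H) t) := by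
    intro t ht i j k
    have e := fun i j k => detPolar_pdv_of_eq hU (hpH j) (hpH k) (hpH' j) (hpH' k)
      (fun t ht => hij t ht j k) ht i
    have e1 := e i j k
    have e2 := e j i k
    have e3 := e k i j
    rw [pdv_comm hU hH ht j i, pdv_comm hU hH' ht j i] at e2
    rw [pdv_comm hU hH ht k i, pdv_comm hU hH' ht k i, pdv_comm hU hH ht k j,
      pdv_comm hU hH' ht k j] at e3
    rw [detPolar_comm (pdv k H' t), detPolar_comm (pdv k H t)]
    have c1 := detPolar_comm (pdv i (pdv k H) t) (pdv j H t)
    have c2 := detPolar_comm (pdv i (pdv k H') t) (pdv j H' t)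
    linear_combination (1 / 2) * e1 + (1 / 2) * e2 - (1 / 2) * e3 + (1 / 2) * c2 - (c / 2) * c1
  have key : ∃ L : Matrix (Fin 3) (Fin 3) ℝ, Lᵀ * detPolarMatrix * L = c • detPolarMatrix ∧
      ∀ᶠ t in 𝓝 t₀, F H' t = L * F H t := by
    refine exists_linear_of_frames hU h₀ hc (F := F H) (F' := F H') ?_ ?_ ?_ ?_ ?_
    · intro t ht a b
      fin_cases b
      exacts [d ht (hH a), d ht (hpH 0 a), d ht (hpH 1 a)]
    · intro t ht a b
      fin_cases b
      exacts [d ht (hH' a), d ht (hpH' 0 a), d ht (hpH' 1 a)]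
    · intro t ht
      convert hdet t ht using 1
      simp [F, Matrix.det_fin_three, triple]; ring
    · intro t ht a b
      fin_cases a <;> fin_cases b
      exacts [hHH t ht, hHi t ht 0, hHi t ht 1, hHi' t ht 0, hij t ht 0 0, hij t ht 0 1,
        hHi' t ht 1, hij t ht 1 0, hij t ht 1 1]
    · intro t ht i a b
      fin_cases a <;> fin_cases b
      exacts [hHi t ht i, h2 t ht i 0, h2 t ht i 1, hij t ht 0 i, h3 t ht i 0 0, h3 t ht i 1 0,
        hij t ht 1 i, h3 t ht i 0 1, h3 t ht i 1 1]
  obtain ⟨L, hL, hev⟩ := key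
  refine ⟨L, hL, ?_⟩
  filter_upwards [hev] with t ht
  ext a
  have := congrFun (congrFun ht a) 0
  simpa [F, Matrix.mul_apply, Matrix.mulVec, dotProduct] using this

/-- Two surfaces with proportional first fundamental data lying in planes through the origin to
second order differ by a linear map. -/
theorem exists_linear_of_degenerate (hc : 0 < c) (v : Fin 2 → ℝ)
    (hgram : ∀ t ∈ U, detPolar (H t) (H t) * detPolar (dirDeriv v H t) (dirDeriv v H t)
      - detPolar (H t) (dirDeriv v H t) ^ 2 ≠ 0)
    (h3 : ∀ t ∈ U, ∀ i j, triple (H t) (pdv i H t) (pdv j H t) = 0)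
    (h3' : ∀ t ∈ U, ∀ i j, triple (H' t) (pdv i H' t) (pdv j H' t) = 0)
    (h4 : ∀ t ∈ U, ∀ i j k, triple (H t) (pdv k H t) (pdv i (pdv j H) t) = 0)
    (h4' : ∀ t ∈ U, ∀ i j k, triple (H' t) (pdv k H' t) (pdv i (pdv j H') t) = 0) :
    ∃ L : Matrix (Fin 3) (Fin 3) ℝ, Lᵀ * detPolarMatrix * L = c • detPolarMatrix ∧
      ∀ᶠ t in 𝓝 t₀, H' t = L *ᵥ H t := by
  have d := fun {t : Fin 2 → ℝ} (ht : t ∈ U) {f : (Fin 2 → ℝ) → ℝ} (hf : ContDiffOn ℝ ∞ f U) =>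
    hf.differentiableAt_of_isOpen hU ht
  -- The vector product is quadratic, so its square scales by c² instead of c. Multiplying the
  -- second normal by 1/√c restores the common factor c; this uses c > 0.
  set r := (√c)⁻¹ with hr
  have hrc : r ^ 2 * c = 1 := by
    rw [hr, inv_pow, Real.sq_sqrt hc.le, inv_mul_cancel₀ hc.ne']
  let N (r : ℝ) (H : (Fin 2 → ℝ) → Fin 3 → ℝ) (t : Fin 2 → ℝ) : Fin 3 → ℝ :=
    r • detCross (H t) (dirDeriv v H t)
  let F (r : ℝ) (H : (Fin 2 → ℝ) → Fin 3 → ℝ) (t : Fin 2 → ℝ) : Matrix (Fin 3) (Fin 3) ℝ :=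
    Matrix.of fun a b => ![H t a, dirDeriv v H t a, N r H t a] b
  have hK := contDiffOn_dirDeriv hU hH v
  have hK' := contDiffOn_dirDeriv hU hH' v
  have hN := contDiffOn_detCross 1 hH hK
  have hN' := contDiffOn_detCross r hH' hK'
  have hHi' : ∀ t ∈ U, ∀ i, detPolar (pdv i H' t) (H' t) = c * detPolar (pdv i H t) (H t) := by
    intro t ht i; rw [detPolar_comm, hHi t ht, detPolar_comm]
  have hHK : ∀ t ∈ U, detPolar (H' t) (dirDeriv v H' t)
      = c * detPolar (H t) (dirDeriv v H t) := by
    intro t ht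
    rw [detPolar_dirDeriv, detPolar_dirDeriv, hHi t ht, hHi t ht]; ring
  have hiK : ∀ t ∈ U, ∀ i, detPolar (pdv i H' t) (dirDeriv v H' t)
      = c * detPolar (pdv i H t) (dirDeriv v H t) := by
    intro t ht i
    rw [detPolar_dirDeriv, detPolar_dirDeriv, hij t ht, hij t ht]; ring
  have hKi : ∀ t ∈ U, ∀ i, detPolar (dirDeriv v H' t) (pdv i H' t)
      = c * detPolar (dirDeriv v H t) (pdv i H t) := by
    intro t ht i; rw [detPolar_comm, hiK t ht, detPolar_comm]
  have hKK : ∀ t ∈ U, detPolar (dirDeriv v H' t) (dirDeriv v H' t)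
      = c * detPolar (dirDeriv v H t) (dirDeriv v H t) := by
    intro t ht
    rw [detPolar_dirDeriv, detPolar_dirDeriv, hKi t ht, hKi t ht]; ring
  have hNN0 : ∀ (r : ℝ) (H : (Fin 2 → ℝ) → Fin 3 → ℝ) t, detPolar (N r H t) (N r H t)
      = r ^ 2 * (4 * (detPolar (H t) (H t) * detPolar (dirDeriv v H t) (dirDeriv v H t)
        - detPolar (H t) (dirDeriv v H t) ^ 2)) := by
    intro r H t
    rw [← triple_detCross, ← detPolar_detCross]
    simp only [N, detPolar, Pi.smul_apply, smul_eq_mul]; ring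
  have hNN : ∀ t ∈ U, detPolar (N r H' t) (N r H' t) = c * detPolar (N 1 H t) (N 1 H t) := by
    intro t ht
    rw [hNN0, hNN0, hHH t ht, hKK t ht, hHK t ht]
    linear_combination 4 * c * (detPolar (H t) (H t)
      * detPolar (dirDeriv v H t) (dirDeriv v H t) - detPolar (H t) (dirDeriv v H t) ^ 2) * hrc
  have hz := fun t (ht : t ∈ U) => detCross_connection hU hH 1 v h3 h4 (t := t) ht
  have hz' := fun t (ht : t ∈ U) => detCross_connection hU hH' r v h3' h4' (t := t) ht
  have q01 : ∀ t ∈ U, ∀ i, detPolar (H' t) (pdv i (dirDeriv v H') t)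
      = c * detPolar (H t) (pdv i (dirDeriv v H) t) := by
    intro t ht i
    have := detPolar_pdv_of_eq hU hH hK hH' hK' hHK ht i
    linear_combination this - hiK t ht i
  have q11 : ∀ t ∈ U, ∀ i, detPolar (dirDeriv v H' t) (pdv i (dirDeriv v H') t)
      = c * detPolar (dirDeriv v H t) (pdv i (dirDeriv v H) t) := by
    intro t ht i
    have := detPolar_pdv_of_eq hU hK hK hK' hK' hKK ht i
    rw [detPolar_comm (pdv i _ t), detPolar_comm (pdv i (dirDeriv v H) t)] at this
    linear_combination (1 / 2) * this
  have q22 : ∀ t ∈ U, ∀ i, detPolar (N r H' t) (pdv i (N r H') t)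
      = c * detPolar (N 1 H t) (pdv i (N 1 H) t) := by
    intro t ht i
    have := detPolar_pdv_of_eq hU hN hN hN' hN' hNN ht i
    rw [detPolar_comm (pdv i _ t), detPolar_comm (pdv i (fun t => _) t)] at this
    linear_combination (1 / 2) * this
  have comm0 : ∀ {u w : Fin 3 → ℝ}, detPolar u w = 0 → detPolar w u = 0 := by
    intro u w h; rw [detPolar_comm, h]
  have zero : ∀ {a b : ℝ}, a = 0 → b = 0 → a = c * b := by
    rintro a b rfl rfl; simp
  have key : ∃ L : Matrix (Fin 3) (Fin 3) ℝ, Lᵀ * detPolarMatrix * L = c • detPolarMatrix ∧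
      ∀ᶠ t in 𝓝 t₀, F r H' t = L * F 1 H t := by
    refine exists_linear_of_frames hU h₀ hc.ne' (F := F 1 H) (F' := F r H')
      ?_ ?_ ?_ ?_ ?_
    · intro t ht a b
      fin_cases b
      exacts [d ht (hH a), d ht (hK a), d ht (hN a)]
    · intro t ht a b
      fin_cases b
      exacts [d ht (hH' a), d ht (hK' a), d ht (hN' a)]
    · intro t ht
      have h1 : (F 1 H t).det = triple (H t) (dirDeriv v H t)
          (detCross (H t) (dirDeriv v H t)) := by
        simp [F, N, Matrix.det_fin_three, triple]; ring
      rw [h1, triple_detCross]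
      exact mul_ne_zero (by norm_num) (hgram t ht)
    · intro t ht a b
      obtain ⟨z1, z2, -⟩ := hz t ht
      obtain ⟨z1', z2', -⟩ := hz' t ht
      fin_cases a <;> fin_cases b
      exacts [hHH t ht, hHK t ht, zero (comm0 z1') (comm0 z1),
        (detPolar_comm _ _).trans ((hHK t ht).trans (congrArg _ (detPolar_comm _ _))), hKK t ht,
        zero (comm0 z2') (comm0 z2), zero z1' z1, zero z2' z2, hNN t ht]
    · intro t ht i a b
      obtain ⟨-, -, z3, z4, z5, z6⟩ := hz t ht
      obtain ⟨-, -, z3', z4', z5', z6'⟩ := hz' t ht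
      fin_cases a <;> fin_cases b
      exacts [hHi t ht i, q01 t ht i, zero (z5' i) (z5 i), hKi t ht i, q11 t ht i,
        zero (z6' i) (z6 i), zero (z3' i) (z3 i), zero (z4' i) (z4 i), q22 t ht i]
  obtain ⟨L, hL, hev⟩ := key
  refine ⟨L, hL, ?_⟩
  filter_upwards [hev] with t ht
  ext a
  have := congrFun (congrFun ht a) 0
  simpa [F, Matrix.mul_apply, Matrix.mulVec, dotProduct] using this

end Surfaces

/-! ### Similarities of the determinant form -/

/-- A null vector of `det` is a signed dyadic square. -/
theorem exists_eq_mul_of_mul_eq_sq {a b d : ℝ} (h : a * d = b ^ 2) :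
    ∃ e v w : ℝ, (e = 1 ∨ e = -1) ∧ a = e * v ^ 2 ∧ b = e * (v * w) ∧ d = e * w ^ 2 := by
  have key : ∀ {a b d : ℝ}, a * d = b ^ 2 → 0 ≤ a + d →
      ∃ v w : ℝ, a = v ^ 2 ∧ b = v * w ∧ d = w ^ 2 := by
    intro a b d h hs
    have ha : 0 ≤ a := by nlinarith [sq_nonneg b, sq_nonneg a]
    have hd : 0 ≤ d := by nlinarith [sq_nonneg b, sq_nonneg d]
    have hbb : |b| = √a * √d := by
      rw [← Real.sqrt_mul ha, h, Real.sqrt_sq_eq_abs]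
    rcases abs_cases b with ⟨hb, _⟩ | ⟨hb, _⟩
    · exact ⟨√a, √d, (Real.sq_sqrt ha).symm, by rw [← hbb, hb], (Real.sq_sqrt hd).symm⟩
    · exact ⟨√a, -√d, (Real.sq_sqrt ha).symm, by rw [mul_neg, ← hbb, hb, neg_neg],
        by rw [neg_sq, Real.sq_sqrt hd]⟩
  rcases le_total 0 (a + d) with hs | hs
  · obtain ⟨v, w, h1, h2, h3⟩ := key h hs
    exact ⟨1, v, w, Or.inl rfl, by linarith, by linarith, by linarith⟩
  · obtain ⟨v, w, h1, h2, h3⟩ := key (a := -a) (b := -b) (d := -d) (by linarith) (by linarith)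
    exact ⟨-1, v, w, Or.inr rfl, by linarith, by linarith, by linarith⟩

/-- The symmetric matrix with coordinates `(h₁₁, h₁₂, h₂₂)`. -/
def symMatrix (v : Fin 3 → ℝ) : Matrix (Fin 2) (Fin 2) ℝ := !![v 0, v 1; v 1, v 2]

/-- Linear similarities of `det` on symmetric matrices are congruences, up to sign. -/
theorem exists_congruence_of_similarity {c : ℝ} (hc : 0 < c) {L : Matrix (Fin 3) (Fin 3) ℝ}
    (hL : Lᵀ * detPolarMatrix * L = c • detPolarMatrix) :
    ∃ (e : ℝ) (P : Matrix (Fin 2) (Fin 2) ℝ), (e = 1 ∨ e = -1) ∧ P.det ≠ 0 ∧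
      ∀ v, symMatrix (L *ᵥ v) = e • (P * symMatrix v * Pᵀ) := by
  have hLe : ∀ a b, detPolar (fun i => L i a) (fun i => L i b) = c * detPolarMatrix a b := by
    intro a b
    rw [← transpose_mul_detPolarMatrix_mul, hL, Matrix.smul_apply, smul_eq_mul]
  have h00 := hLe 0 0
  have h01 := hLe 0 1
  have h02 := hLe 0 2
  have h11 := hLe 1 1
  have h12 := hLe 1 2
  have h22 := hLe 2 2
  simp [detPolar, detPolarMatrix] at h00 h01 h02 h11 h12 h22
  -- The first and third columns of L are the images of the null matrices E₁₁ and E₂₂, hence signed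
  -- dyads e vvᵀ and e' wwᵀ.
  obtain ⟨e, v0, v1, he, ha, hb, hd⟩ := exists_eq_mul_of_mul_eq_sq
    (a := L 0 0) (b := L 1 0) (d := L 2 0) (by linear_combination h00)
  obtain ⟨e', w0, w1, he', ha', hb', hd'⟩ := exists_eq_mul_of_mul_eq_sq
    (a := L 0 2) (b := L 1 2) (d := L 2 2) (by linear_combination h22)
  set m := v0 * w1 - v1 * w0 with hm
  have hee : e * e' * m ^ 2 = c := by
    rw [ha, hb, hd, ha', hb', hd'] at h02
    rw [hm]; linear_combination 2 * h02
  have hm0 : m ≠ 0 := by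
    intro h; rw [h] at hee; simp at hee; exact hc.ne hee
  have hm2 : 0 < m ^ 2 := by positivity
  -- The product of the two null columns is a positive multiple of e e' and also of c > 0, so the
  -- signs coincide.
  have hsame : e' = e := by
    rcases he with rfl | rfl <;> rcases he' with rfl | rfl <;> first | rfl | nlinarith
  have he2 : e ^ 2 = 1 := by rcases he with rfl | rfl <;> norm_num
  have hcm : c = m ^ 2 := by rw [← hee, hsame]; linear_combination m ^ 2 * he2
  rw [hsame] at ha' hb' hd'
  -- The middle column is orthogonal to both dyads and is therefore a multiple s of v wᵀ + w vᵀ. Its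
  -- own norm then forces s² = 1.
  have hq1 : L 0 1 * v1 ^ 2 + L 2 1 * v0 ^ 2 - 2 * L 1 1 * (v0 * v1) = 0 := by
    rw [ha, hb, hd] at h01
    linear_combination 2 * e * h01
      - (L 0 1 * v1 ^ 2 + L 2 1 * v0 ^ 2 - 2 * L 1 1 * (v0 * v1)) * he2
  have hq2 : L 0 1 * w1 ^ 2 + L 2 1 * w0 ^ 2 - 2 * L 1 1 * (w0 * w1) = 0 := by
    rw [ha', hb', hd'] at h12
    linear_combination 2 * e * h12
      - (L 0 1 * w1 ^ 2 + L 2 1 * w0 ^ 2 - 2 * L 1 1 * (w0 * w1)) * he2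
  set s := -(L 0 1 * (v1 * w1) + L 2 1 * (v0 * w0) - L 1 1 * (v0 * w1 + v1 * w0)) / m ^ 2 with hs
  have hsm : s * m ^ 2
      = -(L 0 1 * (v1 * w1) + L 2 1 * (v0 * w0) - L 1 1 * (v0 * w1 + v1 * w0)) :=
    div_mul_cancel₀ _ hm2.ne'
  have s0 : L 0 1 = 2 * s * (v0 * w0) := by
    apply mul_right_cancel₀ hm2.ne'
    have : 2 * s * (v0 * w0) * m ^ 2 = 2 * (v0 * w0) * (s * m ^ 2) := by ring
    rw [this, hsm, hm]
    linear_combination w0 ^ 2 * hq1 + v0 ^ 2 * hq2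
  have s1 : L 1 1 = s * (v0 * w1 + v1 * w0) := by
    apply mul_right_cancel₀ hm2.ne'
    have : s * (v0 * w1 + v1 * w0) * m ^ 2 = (v0 * w1 + v1 * w0) * (s * m ^ 2) := by ring
    rw [this, hsm, hm]
    linear_combination w0 * w1 * hq1 + v0 * v1 * hq2
  have s2 : L 2 1 = 2 * s * (v1 * w1) := by
    apply mul_right_cancel₀ hm2.ne'
    have : 2 * s * (v1 * w1) * m ^ 2 = 2 * (v1 * w1) * (s * m ^ 2) := by ring
    rw [this, hsm, hm]
    linear_combination w1 ^ 2 * hq1 + v1 ^ 2 * hq2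
  have hs2 : s ^ 2 = 1 := by
    apply mul_right_cancel₀ hm2.ne'
    rw [s0, s1, s2, hcm] at h11
    rw [hm] at h11 ⊢
    linear_combination -h11
  -- P has columns v and e s w: the outer sign e makes the diagonal dyads correct, and the factor e
  -- s corrects the mixed term.
  refine ⟨e, !![v0, e * s * w0; v1, e * s * w1], he, ?_, ?_⟩
  · rw [Matrix.det_fin_two_of]
    have : v0 * (e * s * w1) - e * s * w0 * v1 = e * s * m := by rw [hm]; ring
    rw [this]
    intro h
    have : (e * s * m) ^ 2 = m ^ 2 := by linear_combination s ^ 2 * m ^ 2 * he2 + m ^ 2 * hs2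
    rw [h] at this
    exact hm2.ne (by simpa using this)
  · intro v
    have hes : e ^ 2 * s ^ 2 = 1 := by rw [he2, hs2, one_mul]
    clear_value s m
    ext i j
    rw [Matrix.smul_apply, Matrix.mul_apply]
    fin_cases i <;> fin_cases j <;>
    simp [symMatrix, Matrix.mulVec, dotProduct, Fin.sum_univ_three, Matrix.mul_apply,
      Fin.sum_univ_two, ha, hb, hd, ha', hb', hd', s0, s1, s2]
    · linear_combination (-2 * s * v0 * w0 * v 1) * he2 - (e * w0 ^ 2 * v 2) * hes
    · linear_combination (-s * (v0 * w1 + v1 * w0) * v 1) * he2 - (e * w0 * w1 * v 2) * hes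
    · linear_combination (-s * (v0 * w1 + v1 * w0) * v 1) * he2 - (e * w0 * w1 * v 2) * hes
    · linear_combination (-2 * s * v1 * w1 * v 1) * he2 - (e * w1 ^ 2 * v 2) * hes

/-! ### Chain rules for reparametrised surfaces -/

theorem pd_comp {f : (Fin 2 → ℝ) → ℝ} {φ : (Fin 2 → ℝ) → Fin 2 → ℝ} {t : Fin 2 → ℝ}
    (hf : DifferentiableAt ℝ f (φ t)) (hφ : DifferentiableAt ℝ φ t) (i : Fin 2) :
    pd i (fun z => f (φ z)) t = ∑ a, pd i (fun z => φ z a) t * pd a f (φ t) := by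
  have h1 : fderiv ℝ (fun z => f (φ z)) t = (fderiv ℝ f (φ t)).comp (fderiv ℝ φ t) :=
    fderiv_comp t hf hφ
  have h2 : ∀ a, fderiv ℝ φ t (Pi.single i 1) a = pd i (fun z => φ z a) t := by
    intro a
    unfold pd
    rw [fderiv_apply (hφ.hasFDerivAt.differentiableAt)]
    rfl
  conv_lhs => unfold pd
  rw [h1, ContinuousLinearMap.comp_apply, fderiv_eq_sum_pd]
  exact Finset.sum_congr rfl fun a _ => by rw [h2]

theorem pdv_comp {H : (Fin 2 → ℝ) → Fin 3 → ℝ} {φ : (Fin 2 → ℝ) → Fin 2 → ℝ} {t : Fin 2 → ℝ}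
    (hf : ∀ k, DifferentiableAt ℝ (fun z => H z k) (φ t)) (hφ : DifferentiableAt ℝ φ t)
    (i : Fin 2) :
    pdv i (fun z => H (φ z)) t = ∑ a, pd i (fun z => φ z a) t • pdv a H (φ t) := by
  funext k
  simp only [Finset.sum_apply, Pi.smul_apply, smul_eq_mul]
  exact pd_comp (hf k) hφ i

/-- Second derivatives of a composition. -/
theorem pdv_pdv_comp {H : (Fin 2 → ℝ) → Fin 3 → ℝ} {φ : (Fin 2 → ℝ) → Fin 2 → ℝ}
    {U V : Set (Fin 2 → ℝ)} (hU : IsOpen U) (hV : IsOpen V)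
    (hH : ∀ a, ContDiffOn ℝ ∞ (fun z => H z a) U) (hφ : ContDiffOn ℝ ∞ φ V)
    (hm : ∀ t ∈ V, φ t ∈ U) {t : Fin 2 → ℝ} (ht : t ∈ V) (i j : Fin 2) :
    pdv i (pdv j (fun z => H (φ z))) t
      = ∑ a, (pd i (pd j (fun z => φ z a)) t • pdv a H (φ t)
        + pd j (fun z => φ z a) t • ∑ b, pd i (fun z => φ z b) t • pdv b (pdv a H) (φ t)) := by
  have dφ : ∀ t ∈ V, DifferentiableAt ℝ φ t := fun t ht =>
    (hφ.contDiffAt (hV.mem_nhds ht)).differentiableAt (by simp)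
  have dH : ∀ t ∈ V, ∀ k, DifferentiableAt ℝ (fun z => H z k) (φ t) := fun t ht k =>
    (hH k).differentiableAt_of_isOpen hU (hm t ht)
  have hφa : ∀ a, ContDiffOn ℝ ∞ (fun z => φ z a) V := fun a => contDiffOn_pi.mp hφ a
  have d1 : ∀ a, DifferentiableAt ℝ (pd j (fun z => φ z a)) t := fun a =>
    ((hφa a).pd hV j).differentiableAt_of_isOpen hV ht
  have d2 : ∀ a k, DifferentiableAt ℝ (fun z => pdv a H z k) (φ t) := fun a k =>
    (contDiffOn_pdv hU hH a k).differentiableAt_of_isOpen hU (hm t ht)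
  have d3 : ∀ a k, DifferentiableAt ℝ (fun z => pdv a H (φ z) k) t := fun a k =>
    (d2 a k).comp t (dφ t ht)
  funext k
  have h1 : pdv i (pdv j (fun z => H (φ z))) t k
      = pd i (fun z => ∑ a, pd j (fun z => φ z a) z * pdv a H (φ z) k) t :=
    pd_congr_of_isOpen hV (fun z hz => by
      rw [pdv_comp (dH z hz) (dφ z hz)]
      simp) ht
  rw [h1, pd_sum _ (fun a _ => (d1 a).fun_mul (d3 a k))]
  simp only [Finset.sum_apply, Pi.add_apply, Pi.smul_apply, smul_eq_mul]
  refine Finset.sum_congr rfl fun a _ => ?_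
  rw [pd_mul (d1 a) (d3 a k), pd_comp (f := fun z => pdv a H z k) (d2 a k) (dφ t ht)]
  rfl

/-- Four vectors in three-space satisfy the Cramer relation (vzw)u − (uzw)v + (uvw)z − (uvz)w = 0.
Apply the functional ⟨u,u⟩⟨v,·⟩ − ⟨u,v⟩⟨u,·⟩, which annihilates u. -/
theorem triple_gram (u v z w : Fin 3 → ℝ) :
    (detPolar u u * detPolar v z - detPolar u v * detPolar u z) * triple u v w
      - (detPolar u u * detPolar v v - detPolar u v * detPolar u v) * triple u z w
    = (detPolar u u * detPolar v w - detPolar u v * detPolar u w) * triple u v z := by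
  simp only [detPolar, triple]; ring

/-! ### The orbit metric h as a surface of symmetric matrices -/

namespace AdaptedMetric

variable {M : AdaptedMetric} {t : Fin 2 → ℝ}

/-- The coordinates `(h₁₁, h₁₂, h₂₂)` of `h`. -/
noncomputable def hvec (M : AdaptedMetric) (t : Fin 2 → ℝ) : Fin 3 → ℝ :=
  ![M.h t 0 0, M.h t 0 1, M.h t 1 1]

theorem smooth_hvec (a : Fin 3) : ContDiffOn ℝ ∞ (fun z => M.hvec z a) M.dom := by
  fin_cases a
  exacts [M.smooth_h 0 0, M.smooth_h 0 1, M.smooth_h 1 1]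

theorem pdv_hvec (i : Fin 2) :
    pdv i M.hvec = fun t => ![M.dh 0 0 i t, M.dh 0 1 i t, M.dh 1 1 i t] := by
  funext t a
  fin_cases a <;> rfl

theorem pdv_pdv_hvec (i j : Fin 2) : pdv i (pdv j M.hvec) t
    = ![pd i (M.dh 0 0 j) t, pd i (M.dh 0 1 j) t, pd i (M.dh 1 1 j) t] := by
  funext a
  fin_cases a <;> rfl

section
variable (ht : t ∈ M.dom)
include ht

theorem detPolar_hvec : detPolar (M.hvec t) (M.hvec t) = M.x t := by
  rw [x_eq ht]; simp [detPolar, hvec, mul_comm]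

theorem detPolar_hvec_pdv (i : Fin 2) :
    detPolar (M.hvec t) (pdv i M.hvec t) = M.x t * M.dlnx t i / 2 := by
  have := x_ne_zero ht
  rw [dlnx_eq ht, pdv_hvec]; simp [detPolar, hvec]; field_simp; ring

theorem detPolar_pdv_pdv (i j : Fin 2) :
    detPolar (pdv i M.hvec t) (pdv j M.hvec t) = M.x t * M.chi t i j := by
  have := x_ne_zero ht
  rw [chi_apply ht, pdv_hvec, pdv_hvec]; simp [detPolar]; field_simp

/-- The Schur complement of x in the Gram matrix of h, ∂₁h, ∂₂h is x(χ − ¼ρ) = xγ. This is how the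
Cosgrove form arises, and why Q_γ decides linear independence. -/
theorem triple_hvec_sq : triple (M.hvec t) (pdv 0 M.hvec t) (pdv 1 M.hvec t) ^ 2
    = 4 * M.x t ^ 3 * (M.Qgamma t * (M.g t).det) := by
  rw [triple_sq]
  simp only [detPolar_hvec ht, detPolar_hvec_pdv ht, detPolar_pdv_pdv ht]
  rw [Qgamma, detForm, div_mul_cancel₀ _ (M.det_g_ne t ht), Matrix.det_fin_two]
  simp only [gamma_apply, chi_symm]
  ring

theorem triple_hvec_eq_zero (hQ : M.Qgamma t = 0) (i j : Fin 2) :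
    triple (M.hvec t) (pdv i M.hvec t) (pdv j M.hvec t) = 0 := by
  have h := triple_hvec_sq ht
  rw [hQ] at h
  have h01 : triple (M.hvec t) (pdv 0 M.hvec t) (pdv 1 M.hvec t) = 0 := by
    simpa using h
  fin_cases i <;> fin_cases j
  · simp only [triple]; ring
  · exact h01
  · have : triple (M.hvec t) (pdv 1 M.hvec t) (pdv 0 M.hvec t)
        = -triple (M.hvec t) (pdv 0 M.hvec t) (pdv 1 M.hvec t) := by
      simp only [triple]; ring
    exact this.trans (by rw [h01, neg_zero])
  · simp only [triple]; ring

theorem Cgamma_apply : M.Cgamma t = (M.g t)⁻¹ 0 0 * M.gamma t 0 0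
    + 2 * (M.g t)⁻¹ 0 1 * M.gamma t 0 1 + (M.g t)⁻¹ 1 1 * M.gamma t 1 1 := by
  simp only [Cgamma, trForm, Fin.sum_univ_two, inv_g_symm ht, gamma_symm]; ring

end

/-- If `Q_γ` vanishes identically and `C_γ ≠ 0`, then by the vacuum equations `h` lies to second
order in a plane through the origin. -/
theorem triple_hvec_second {Λ : ℝ} (hM : M.IsVacuum Λ) {U : Set (Fin 2 → ℝ)} (hU : IsOpen U)
    (hUd : U ⊆ M.dom) (hQ : ∀ t ∈ U, M.Qgamma t = 0) (htU : t ∈ U) (hC : M.Cgamma t ≠ 0)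
    (i j k : Fin 2) : triple (M.hvec t) (pdv k M.hvec t) (pdv i (pdv j M.hvec) t) = 0 := by
  have ht := hUd htU
  have h3 := triple_hvec_eq_zero ht (hQ t htU)
  set D : Fin 2 → Fin 2 → Fin 2 → ℝ := fun k i j =>
    triple (M.hvec t) (pdv k M.hvec t) (pdv i (pdv j M.hvec) t) with hD
  have d := fun a => (smooth_hvec (M := M) a).differentiableAt_dom ht
  have d' := fun j a => (contDiffOn_pdv M.isOpen_dom (smooth_hvec (M := M)) j a).differentiableAt_dom
    ht
  have hsym : ∀ k, D k 1 0 = D k 0 1 := fun k => by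
    simp only [hD]; rw [pdv_comm M.isOpen_dom smooth_hvec ht 1 0]
  -- Differentiating the identity det(h, ∂₁h, ∂₂h) = 0. Together with the symmetry of second
  -- derivatives this makes D totally symmetric.
  have hcub : ∀ a, D 0 a 1 = D 1 a 0 := by
    intro a
    have h1 := pd_triple (u := M.hvec) (v := pdv 0 M.hvec) (w := pdv 1 M.hvec) d (d' 0) (d' 1) a
    rw [pd_congr_of_isOpen hU (f' := fun _ => 0)
      (fun z hz => triple_hvec_eq_zero (hUd hz) (hQ z hz) 0 1) htU, pd_const] at h1
    have h2 : triple (pdv a M.hvec t) (pdv 0 M.hvec t) (pdv 1 M.hvec t) = 0 := by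
      fin_cases a <;> simp only [Fin.zero_eta, Fin.mk_one, Fin.isValue, triple] <;> ring
    have h5 : triple (M.hvec t) (pdv a (pdv 0 M.hvec) t) (pdv 1 M.hvec t) = -D 1 a 0 := by
      simp only [hD, triple]; ring
    rw [h2, h5] at h1
    linarith
  -- D is trace-free: by the wave equation g^{ij}∂_i∂_jh is a combination of h and its first
  -- derivatives, all of which have zero triple product with h and ∂_kh.
  have hwave : ∀ k, (M.g t)⁻¹ 0 0 * D k 0 0 + 2 * (M.g t)⁻¹ 0 1 * D k 0 1
      + (M.g t)⁻¹ 1 1 * D k 1 1 = 0 := by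
    intro k
    have b0 := box_h ht hM 0 0
    have b1 := box_h ht hM 0 1
    have b2 := box_h ht hM 1 1
    simp only [hessH, Fin.sum_univ_two, inv_g_symm ht] at b0 b1 b2
    have e0 := h3 k 0
    have e1 := h3 k 1
    simp only [hD, pdv_pdv_hvec]
    simp only [pdv_hvec] at e0 e1 ⊢
    generalize M.Cchi t + 2 * Λ = C at b0 b1 b2
    generalize M.dlnx t 0 = l0 at b0 b1 b2
    generalize M.dlnx t 1 = l1 at b0 b1 b2
    generalize (M.g t)⁻¹ 0 0 = G0 at b0 b1 b2 ⊢
    generalize (M.g t)⁻¹ 0 1 = G1 at b0 b1 b2 ⊢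
    generalize (M.g t)⁻¹ 1 1 = G2 at b0 b1 b2 ⊢
    generalize christoffel M.g 0 0 0 t = a1 at b0 b1 b2
    generalize christoffel M.g 0 0 1 t = a2 at b0 b1 b2
    generalize christoffel M.g 0 1 1 t = a3 at b0 b1 b2
    generalize christoffel M.g 1 0 0 t = a4 at b0 b1 b2
    generalize christoffel M.g 1 0 1 t = a5 at b0 b1 b2
    generalize christoffel M.g 1 1 1 t = a6 at b0 b1 b2
    simp [triple, hvec] at e0 e1 ⊢
    linear_combination (M.h t 0 1 * M.dh 1 1 k t - M.h t 1 1 * M.dh 0 1 k t) * b0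
      - (M.h t 0 0 * M.dh 1 1 k t - M.h t 1 1 * M.dh 0 0 k t) * b1
      + (M.h t 0 0 * M.dh 0 1 k t - M.h t 0 1 * M.dh 0 0 k t) * b2
      + (G0 * a1 + 2 * G1 * a2 + G2 * a3 + 1 / 2 * (G0 * l0 + G1 * l1)) * e0
      + (G0 * a4 + 2 * G1 * a5 + G2 * a6 + 1 / 2 * (G1 * l0 + G2 * l1)) * e1
  have hx := x_ne_zero ht
  -- The coefficients in `triple_gram` are x²γ, and its right side vanishes because the tangent
  -- vectors are dependent modulo h.
  have hgam : ∀ k l i j, M.gamma t k l * D k i j = M.gamma t k k * D l i j := by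
    intro k l i j
    have h1 := triple_gram (M.hvec t) (pdv k M.hvec t) (pdv l M.hvec t) (pdv i (pdv j M.hvec) t)
    rw [h3 k l] at h1
    simp only [detPolar_hvec ht, detPolar_hvec_pdv ht, detPolar_pdv_pdv ht] at h1
    apply mul_left_cancel₀ (pow_ne_zero 2 hx)
    simp only [gamma_apply, hD]
    linear_combination h1
  have g0 := hgam 0 1
  have g1 := hgam 1 0
  rw [gamma_symm] at g1
  have w0 := hwave 0
  have w1 := hwave 1
  have c0 := hcub 0
  have c1 := hcub 1
  rw [hsym] at c1
  have hCe := Cgamma_apply ht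
  have r1 : M.gamma t 0 1 * D 0 0 0 = M.gamma t 0 0 * D 0 0 1 := by
    linear_combination g0 0 0 - M.gamma t 0 0 * c0
  have r2 : M.gamma t 0 1 * D 0 0 1 = M.gamma t 0 0 * D 1 0 1 := g0 0 1
  have r3 : M.gamma t 0 1 * D 1 0 1 = M.gamma t 0 0 * D 1 1 1 := by
    linear_combination g0 1 1 - M.gamma t 0 1 * c1
  have s1 : M.gamma t 0 1 * D 0 0 1 = M.gamma t 1 1 * D 0 0 0 := by
    linear_combination g1 0 0 + M.gamma t 0 1 * c0
  have s2 : M.gamma t 0 1 * D 1 0 1 = M.gamma t 1 1 * D 0 0 1 := g1 0 1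
  have s3 : M.gamma t 0 1 * D 1 1 1 = M.gamma t 1 1 * D 1 0 1 := by
    linear_combination g1 1 1 + M.gamma t 1 1 * c1
  have w0' : (M.g t)⁻¹ 0 0 * D 0 0 0 + 2 * (M.g t)⁻¹ 0 1 * D 0 0 1
      + (M.g t)⁻¹ 1 1 * D 1 0 1 = 0 := by
    linear_combination w0 - (M.g t)⁻¹ 1 1 * c1
  have w1' : (M.g t)⁻¹ 0 0 * D 0 0 1 + 2 * (M.g t)⁻¹ 0 1 * D 1 0 1
      + (M.g t)⁻¹ 1 1 * D 1 1 1 = 0 := by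
    linear_combination w1 + (M.g t)⁻¹ 0 0 * c0
  -- In index form: exchanging indices between γ and the totally symmetric D gives C_γ D_mij = γ_mi
  -- g^{kl} D_klj, which is zero. The four components are treated separately.
  have z0 : D 0 0 0 = 0 := by
    apply mul_left_cancel₀ hC
    rw [hCe]
    linear_combination M.gamma t 0 0 * w0' + 2 * (M.g t)⁻¹ 0 1 * r1 + (M.g t)⁻¹ 1 1 * (r2 - s1)
  have z1 : D 0 0 1 = 0 := by
    apply mul_left_cancel₀ hC
    rw [hCe]
    linear_combination M.gamma t 0 1 * w0' - (M.g t)⁻¹ 0 0 * r1 - (M.g t)⁻¹ 1 1 * s2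
  have z2 : D 1 0 1 = 0 := by
    apply mul_left_cancel₀ hC
    rw [hCe]
    linear_combination M.gamma t 0 1 * w1' - (M.g t)⁻¹ 0 0 * r2 - (M.g t)⁻¹ 1 1 * s3
  have z3 : D 1 1 1 = 0 := by
    apply mul_left_cancel₀ hC
    rw [hCe]
    linear_combination M.gamma t 1 1 * w1' + (M.g t)⁻¹ 0 0 * (s2 - r3) + 2 * (M.g t)⁻¹ 0 1 * s3
  change D k i j = 0
  fin_cases k <;> fin_cases i <;> fin_cases j <;>
  simp only [Fin.zero_eta, Fin.mk_one, Fin.isValue, hsym, z0, z1, z2, z3, ← c0, c1]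

end AdaptedMetric

/-! ### Adapted local coordinates -/

namespace AdaptedMetric

theorem eq_zero_of_jac_ne_zero {p q : (Fin 2 → ℝ) → ℝ} {t v : Fin 2 → ℝ} (h : jac p q t ≠ 0)
    (hp : v 0 * pd 0 p t + v 1 * pd 1 p t = 0) (hq : v 0 * pd 0 q t + v 1 * pd 1 q t = 0) :
    v = 0 := by
  have h0 : v 0 = 0 := by
    apply mul_right_cancel₀ h
    rw [jac]; linear_combination pd 1 q t * hp - pd 1 p t * hq
  have h1 : v 1 = 0 := by
    apply mul_right_cancel₀ h
    rw [jac]; linear_combination pd 0 p t * hq - pd 0 q t * hp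
  ext i; fin_cases i
  exacts [h0, h1]

/-- Two functions with independent differentials are local coordinates. -/
theorem exists_chart {p q : (Fin 2 → ℝ) → ℝ} {U : Set (Fin 2 → ℝ)} (hU : IsOpen U)
    (hp : ContDiffOn ℝ ∞ p U) (hq : ContDiffOn ℝ ∞ q U) {t₀ : Fin 2 → ℝ} (h₀ : t₀ ∈ U)
    (hj : jac p q t₀ ≠ 0) :
    ∃ e : OpenPartialHomeomorph (Fin 2 → ℝ) (Fin 2 → ℝ), t₀ ∈ e.source ∧ e.source ⊆ U ∧
      (∀ t, e t = ![p t, q t]) ∧ ContDiffOn ℝ ∞ e.symm e.target := by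
  set P : (Fin 2 → ℝ) → Fin 2 → ℝ := fun t => ![p t, q t] with hP
  have hPs : ContDiffOn ℝ ∞ P U := by
    rw [contDiffOn_pi]
    intro i; fin_cases i
    exacts [hp, hq]
  have hPd : ∀ t ∈ U, DifferentiableAt ℝ P t := fun t ht =>
    (hPs.contDiffAt (hU.mem_nhds ht)).differentiableAt (by simp)
  have hjc : ContinuousOn (jac p q) U :=
    (((hp.pd hU 0).continuousOn.mul (hq.pd hU 1).continuousOn).sub
      ((hp.pd hU 1).continuousOn.mul (hq.pd hU 0).continuousOn))
  -- Restricting to nonzero Jacobian everywhere, and not only at t₀, makes the inverse chart smooth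
  -- on its whole target.
  set W : Set (Fin 2 → ℝ) := U ∩ jac p q ⁻¹' {0}ᶜ with hW
  have hWo : IsOpen W := hjc.isOpen_inter_preimage hU isOpen_compl_singleton
  have hequiv : ∀ t ∈ W, ∃ f' : (Fin 2 → ℝ) ≃L[ℝ] (Fin 2 → ℝ),
      HasFDerivAt P (f' : (Fin 2 → ℝ) →L[ℝ] (Fin 2 → ℝ)) t := by
    rintro t ⟨ht, hjt⟩
    have hd := hPd t ht
    have hcomp : ∀ i v, fderiv ℝ P t v i = fderiv ℝ (fun z => P z i) t v := by
      intro i v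
      rw [fderiv_apply hd]; rfl
    have hinj : Function.Injective (fderiv ℝ P t : (Fin 2 → ℝ) →ₗ[ℝ] (Fin 2 → ℝ)) := by
      rw [← LinearMap.ker_eq_bot, LinearMap.ker_eq_bot']
      intro v hv
      have hv' : fderiv ℝ P t v = 0 := hv
      have e0 := (hcomp 0 v).symm.trans (congrFun hv' 0)
      have e1 := (hcomp 1 v).symm.trans (congrFun hv' 1)
      rw [fderiv_eq_sum_pd, Fin.sum_univ_two] at e0 e1
      exact eq_zero_of_jac_ne_zero hjt e0 e1
    refine ⟨(LinearEquiv.ofInjectiveEndo _ hinj).toContinuousLinearEquiv, ?_⟩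
    convert hd.hasFDerivAt using 1
    ext v : 1
    rfl
  have hcd : ∀ t ∈ U, ContDiffAt ℝ ∞ P t := fun t ht => hPs.contDiffAt (hU.mem_nhds ht)
  obtain ⟨f', hf'⟩ := hequiv t₀ ⟨h₀, hj⟩
  let e := ((hcd t₀ h₀).toOpenPartialHomeomorph P hf' (by simp)).restrOpen W hWo
  have hecoe : ∀ t, e t = P t := fun t => rfl
  have hesrc : e.source ⊆ W := by
    rw [OpenPartialHomeomorph.restrOpen_source]
    exact Set.inter_subset_right
  refine ⟨e, ?_, fun t ht => (hesrc ht).1, fun t => rfl, fun y hy => ?_⟩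
  · rw [OpenPartialHomeomorph.restrOpen_source]
    exact ⟨ContDiffAt.mem_toOpenPartialHomeomorph_source _ _ _, h₀, hj⟩
  · have hx := hesrc (e.map_target hy)
    obtain ⟨g', hg'⟩ := hequiv _ hx
    exact (e.contDiffAt_symm hy (f₀' := g') hg' (hcd _ hx.1)).contDiffWithinAt

/-- The local diffeomorphism matching two pairs of local coordinates. -/
theorem exists_localDiffeo {p q p' q' : (Fin 2 → ℝ) → ℝ} {U U' : Set (Fin 2 → ℝ)}
    (hU : IsOpen U) (hU' : IsOpen U') (hp : ContDiffOn ℝ ∞ p U) (hq : ContDiffOn ℝ ∞ q U)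
    (hp' : ContDiffOn ℝ ∞ p' U') (hq' : ContDiffOn ℝ ∞ q' U') {t₀ t₀' : Fin 2 → ℝ}
    (h₀ : t₀ ∈ U) (h₀' : t₀' ∈ U') (hj : jac p q t₀ ≠ 0) (hj' : jac p' q' t₀' ≠ 0)
    (hpp : p t₀ = p' t₀') (hqq : q t₀ = q' t₀') :
    ∃ φ : OpenPartialHomeomorph (Fin 2 → ℝ) (Fin 2 → ℝ), t₀ ∈ φ.source ∧ φ t₀ = t₀' ∧
      φ.source ⊆ U ∧ φ.target ⊆ U' ∧ ContDiffOn ℝ ∞ φ φ.source ∧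
      ContDiffOn ℝ ∞ φ.symm φ.target ∧
      ∀ t ∈ φ.source, p' (φ t) = p t ∧ q' (φ t) = q t := by
  obtain ⟨e, he0, heU, hec, hes⟩ := exists_chart hU hp hq h₀ hj
  obtain ⟨e', he0', heU', hec', hes'⟩ := exists_chart hU' hp' hq' h₀' hj'
  have hsm : ∀ {e : OpenPartialHomeomorph (Fin 2 → ℝ) (Fin 2 → ℝ)} {p q : (Fin 2 → ℝ) → ℝ}
      {U : Set (Fin 2 → ℝ)}, ContDiffOn ℝ ∞ p U → ContDiffOn ℝ ∞ q U →
      (∀ t, e t = ![p t, q t]) → ContDiffOn ℝ ∞ e U := by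
    intro e p q U hp hq he
    rw [contDiffOn_pi]
    intro i
    simp only [he]
    fin_cases i
    exacts [hp, hq]
  have h00 : e t₀ = e' t₀' := by rw [hec, hec', hpp, hqq]
  refine ⟨e.trans e'.symm, ?_, ?_, ?_, ?_, ?_, ?_, ?_⟩
  · rw [OpenPartialHomeomorph.trans_source]
    refine ⟨he0, ?_⟩
    change e t₀ ∈ e'.target
    rw [h00]; exact e'.map_source he0'
  · change e'.symm (e t₀) = t₀'
    rw [h00]; exact e'.left_inv he0'
  · intro t ht
    rw [OpenPartialHomeomorph.trans_source] at ht
    exact heU ht.1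
  · intro y hy
    rw [OpenPartialHomeomorph.trans_target] at hy
    exact heU' hy.1
  · refine hes'.comp ((hsm hp hq hec).mono fun t ht => ?_) ?_
    · rw [OpenPartialHomeomorph.trans_source] at ht
      exact heU ht.1
    intro t ht
    rw [OpenPartialHomeomorph.trans_source] at ht
    exact ht.2
  · refine hes.comp ((hsm hp' hq' hec').mono fun y hy => ?_) ?_
    · rw [OpenPartialHomeomorph.trans_target] at hy
      exact heU' hy.1
    · intro y hy
      rw [OpenPartialHomeomorph.trans_target] at hy
      exact hy.2
  · intro t ht
    rw [OpenPartialHomeomorph.trans_source] at ht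
    have h1 : e' (e'.symm (e t)) = e t := e'.right_inv ht.2
    have h2 := (hec' _).symm.trans (h1.trans (hec t))
    exact ⟨congrFun h2 0, congrFun h2 1⟩

/-! ### Matching of the invariant frames -/

/-- Uniqueness of the solution of the vacuum relations, for the homogeneous system. -/
theorem frame_unique {p f k g : (Fin 2 → ℝ) → ℝ} {t V W : Fin 2 → ℝ} {C I₁ I₂ I₃ I₄ e : ℝ}
    (hV : ∑ i, V i * pd i p t = 0) (hW : ∑ i, W i * pd i p t = 0)
    (h1 : ∑ i, V i * (1 / 4 * C * I₁ * pd i f t - 1 / 2 * I₁ * pd i g t)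
      + ∑ i, W i * (1 / 2 * I₂ * pd i g t - 1 / 2 * I₃ * pd i f t - I₄ * pd i k t) = 0)
    (h2 : ∑ i, W i * (e * (1 / 4 * C * I₁ * pd i f t - 1 / 2 * I₁ * pd i g t))
      - ∑ i, V i * (1 / 2 * I₂ * pd i g t - 1 / 2 * I₃ * pd i f t - I₄ * pd i k t) = 0)
    (hdet : e * I₁ ^ 2 * (1 / 4 * C * jac p f t - 1 / 2 * jac p g t) ^ 2
      + (1 / 2 * I₂ * jac p g t - 1 / 2 * I₃ * jac p f t - I₄ * jac p k t) ^ 2 ≠ 0) :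
    V = 0 ∧ W = 0 := by
  simp only [Fin.sum_univ_two] at hV hW h1 h2
  simp only [jac] at hdet
  generalize pd 0 p t = p0 at *
  generalize pd 1 p t = p1 at *
  generalize pd 0 f t = f0 at *
  generalize pd 1 f t = f1 at *
  generalize pd 0 g t = g0 at *
  generalize pd 1 g t = g1 at *
  generalize pd 0 k t = k0 at *
  generalize pd 1 k t = k1 at *
  set a := 1 / 4 * C * (p0 * f1 - p1 * f0) - 1 / 2 * (p0 * g1 - p1 * g0) with ha
  set b := 1 / 2 * I₂ * (p0 * g1 - p1 * g0) - 1 / 2 * I₃ * (p0 * f1 - p1 * f0)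
    - I₄ * (p0 * k1 - p1 * k0) with hb
  -- V and W are annihilated by dp, so each is proportional to (−∂₂p, ∂₁p). Multiplying the
  -- relations by a derivative of p turns the coefficients into Jacobians and leaves a 2×2 system
  -- whose determinant is e I₁²a² + b².
  have key : ∀ v w : ℝ, I₁ * a * v + b * w = 0 → e * I₁ * a * w - b * v = 0 →
      v = 0 ∧ w = 0 := by
    intro v w e1 e2
    constructor
    · apply mul_right_cancel₀ hdet
      linear_combination e * I₁ * a * e1 - b * e2
    · apply mul_right_cancel₀ hdet
      linear_combination I₁ * a * e2 + b * e1
  have k1' := key (V 1) (W 1)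
    (by rw [ha, hb]; linear_combination p0 * h1
          - (1 / 4 * C * I₁ * f0 - 1 / 2 * I₁ * g0) * hV
          - (1 / 2 * I₂ * g0 - 1 / 2 * I₃ * f0 - I₄ * k0) * hW)
    (by rw [ha, hb]; linear_combination p0 * h2
          - e * (1 / 4 * C * I₁ * f0 - 1 / 2 * I₁ * g0) * hW
          + (1 / 2 * I₂ * g0 - 1 / 2 * I₃ * f0 - I₄ * k0) * hV)
  have k0' := key (V 0) (W 0)
    (by rw [ha, hb]; linear_combination -p1 * h1
          + (1 / 4 * C * I₁ * f1 - 1 / 2 * I₁ * g1) * hV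
          + (1 / 2 * I₂ * g1 - 1 / 2 * I₃ * f1 - I₄ * k1) * hW)
    (by rw [ha, hb]; linear_combination -p1 * h2
          + e * (1 / 4 * C * I₁ * f1 - 1 / 2 * I₁ * g1) * hW
          - (1 / 2 * I₂ * g1 - 1 / 2 * I₃ * f1 - I₄ * k1) * hV)
  constructor
  · ext i; fin_cases i
    exacts [k0'.1, k1'.1]
  · ext i; fin_cases i
    exacts [k0'.2, k1'.2]

variable {M M' : AdaptedMetric} {t : Fin 2 → ℝ}

theorem solvDet_eq : M.solvDet t = M.eps t * M.I1 t ^ 2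
      * (1 / 4 * M.Cgamma t * jac M.Crho M.Cchi t - 1 / 2 * jac M.Crho M.Qgamma t) ^ 2
    + (1 / 2 * M.I2 t * jac M.Crho M.Qgamma t - 1 / 2 * M.I3 t * jac M.Crho M.Cchi t
      - M.I4 t * jac M.Crho M.Qchi t) ^ 2 := by
  simp only [solvDet, Matrix.det_fin_two_of]; ring

theorem X_cross_Y_ne_zero (ht : t ∈ M.dom) (hp : M.Crho t ≠ 0) :
    M.X t 0 * M.Y t 1 - M.X t 1 * M.Y t 0 ≠ 0 := by
  intro h
  have h1 := inv_det_g_mul ht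
  rw [h] at h1
  have : ((M.g t).det)⁻¹ * M.Crho t ^ 2 ≠ 0 :=
    mul_ne_zero (inv_ne_zero (M.det_g_ne t ht)) (pow_ne_zero 2 hp)
  exact this (by rw [h1]; ring)

/-- Genericity excludes `I₁ = 0`. -/
theorem I1_ne_zero (ht : t ∈ M.dom) {Λ : ℝ} (hM : M.IsVacuum Λ) (hp : M.Crho t ≠ 0)
    (hs : M.solvDet t ≠ 0) : M.I1 t ≠ 0 := by
  intro hI
  obtain ⟨-, r2, -, r4, -⟩ := vacuumRelations ht hp hM
  simp only [derivX_eq, derivY_eq, Fin.sum_univ_two, hI] at r2 r4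
  -- If I₁ = 0, the second and fourth relations say that the pair (0, Y) solves the homogeneous
  -- system. Then Y = 0, which is impossible where C_ρ ≠ 0.
  have h := frame_unique (p := M.Crho) (f := M.Cchi) (k := M.Qchi) (g := M.Qgamma) (V := 0)
    (W := M.Y t) (e := M.eps t) (C := M.Cgamma t) (I₁ := M.I1 t) (I₂ := M.I2 t) (I₃ := M.I3 t)
    (I₄ := M.I4 t) (by simp)
    (by rw [Fin.sum_univ_two]; linear_combination r2)
    (by simp only [Fin.sum_univ_two, hI, Pi.zero_apply]; linear_combination r4)
    (by simp only [Fin.sum_univ_two, hI, Pi.zero_apply]; ring)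
    (by rw [← solvDet_eq]; exact hs)
  exact X_cross_Y_ne_zero ht hp (by rw [h.2]; simp)

theorem eq_of_bilin_frame {α β : Fin 2 → Fin 2 → ℝ} {v w : Fin 2 → ℝ}
    (hvw : v 0 * w 1 - v 1 * w 0 ≠ 0) (hα : α 1 0 = α 0 1) (hβ : β 1 0 = β 0 1)
    (h1 : bilin α v v = bilin β v v) (h2 : bilin α v w = bilin β v w)
    (h3 : bilin α w w = bilin β w w) : α = β := by
  simp only [bilin, Fin.sum_univ_two, hα, hβ] at h1 h2 h3
  have hd := pow_ne_zero 2 hvw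
  have e00 : α 0 0 = β 0 0 := by
    apply mul_right_cancel₀ hd
    linear_combination w 1 ^ 2 * h1 - 2 * v 1 * w 1 * h2 + v 1 ^ 2 * h3
  have e01 : α 0 1 = β 0 1 := by
    apply mul_right_cancel₀ hd
    linear_combination -w 0 * w 1 * h1 + (v 1 * w 0 + v 0 * w 1) * h2 - v 0 * v 1 * h3
  have e11 : α 1 1 = β 1 1 := by
    apply mul_right_cancel₀ hd
    linear_combination w 0 ^ 2 * h1 - 2 * v 0 * w 0 * h2 + v 0 ^ 2 * h3
  funext i j
  fin_cases i <;> fin_cases j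
  exacts [e00, e01, hα.trans (e01.trans hβ.symm), e11]

end AdaptedMetric

/-! ### Pulling back g, dx/x and χ -/

namespace AdaptedMetric

section Matching

variable {M M' : AdaptedMetric} {Λ : ℝ} {t : Fin 2 → ℝ}
  {φ : (Fin 2 → ℝ) → Fin 2 → ℝ}

theorem pd_of_eventuallyEq_comp {f f' : (Fin 2 → ℝ) → ℝ} (hφ : DifferentiableAt ℝ φ t)
    (hf' : DifferentiableAt ℝ f' (φ t)) (h : ∀ᶠ z in 𝓝 t, f z = f' (φ z)) (j : Fin 2) :
    pd j f t = ∑ i, jacobian φ t i j * pd i f' (φ t) := by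
  rw [pd_congr (f' := fun z => f' (φ z)) h, pd_comp hf' hφ]
  rfl

theorem jac_of_eventuallyEq_comp {f f' k k' : (Fin 2 → ℝ) → ℝ} (hφ : DifferentiableAt ℝ φ t)
    (hf' : DifferentiableAt ℝ f' (φ t)) (h : ∀ᶠ z in 𝓝 t, f z = f' (φ z))
    (hk' : DifferentiableAt ℝ k' (φ t)) (hk : ∀ᶠ z in 𝓝 t, k z = k' (φ z)) :
    jac f k t = (jacobian φ t).det * jac f' k' (φ t) := by
  simp only [jac, pd_of_eventuallyEq_comp hφ hf' h, pd_of_eventuallyEq_comp hφ hk' hk,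
    Matrix.det_fin_two, Fin.sum_univ_two]
  ring

theorem I2_congr {t' : Fin 2 → ℝ} (hC : M.Crho t = M'.Crho t') (hCc : M.Cchi t = M'.Cchi t')
    (hQc : M.Qchi t = M'.Qchi t') (hQg : M.Qgamma t = M'.Qgamma t') :
    M'.Cgamma t' = M.Cgamma t ∧ M'.I2 t' = M.I2 t ∧ M'.I3 t' = M.I3 t ∧ M'.I4 t' = M.I4 t := by
  have : M'.Cgamma t' = M.Cgamma t := by rw [Cgamma_eq, Cgamma_eq, hC, hCc]
  simp [I2, I3, I4, this, hC, hQc, hQg]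

/-- Bilinear forms with the same values on corresponding frames. -/
theorem bilin_pullback (α : Fin 2 → Fin 2 → ℝ) (J : Matrix (Fin 2) (Fin 2) ℝ)
    (v w : Fin 2 → ℝ) : bilin (fun a b => ∑ i, ∑ j, J i a * J j b * α i j) v w
      = bilin α (J *ᵥ v) (J *ᵥ w) := by
  simp only [bilin, Matrix.mulVec, dotProduct, Fin.sum_univ_two]; ring

theorem bilin_smul_right (α : Fin 2 → Fin 2 → ℝ) (s : ℝ) (v w : Fin 2 → ℝ) :
    bilin α v (s • w) = s * bilin α v w := by
  simp only [bilin, Pi.smul_apply, smul_eq_mul, Fin.sum_univ_two]; ring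

theorem bilin_smul_left (α : Fin 2 → Fin 2 → ℝ) (s : ℝ) (v w : Fin 2 → ℝ) :
    bilin α (s • v) w = s * bilin α v w := by
  simp only [bilin, Pi.smul_apply, smul_eq_mul, Fin.sum_univ_two]; ring

variable (hM : M.IsVacuum Λ) (hM' : M'.IsVacuum Λ) (ht : t ∈ M.dom) (ht' : φ t ∈ M'.dom)
  (hφ : DifferentiableAt ℝ φ t) (hJ : (jacobian φ t).det ≠ 0)
  (hC : ∀ᶠ z in 𝓝 t, M.Crho z = M'.Crho (φ z)) (hCc : ∀ᶠ z in 𝓝 t, M.Cchi z = M'.Cchi (φ z))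
  (hQc : ∀ᶠ z in 𝓝 t, M.Qchi z = M'.Qchi (φ z))
  (hQg : ∀ᶠ z in 𝓝 t, M.Qgamma z = M'.Qgamma (φ z))
  (he : M'.eps (φ t) = M.eps t) (hp : M.Crho t ≠ 0) (hsd : M.solvDet t ≠ 0) {s : ℝ}
  (hs : s = 1 ∨ s = -1) (hI : M'.I1 (φ t) = s * M.I1 t)

include hM hM' ht ht' hφ hJ hC hCc hQc hQg he hp hsd hs hI

/-- By the vacuum relations the invariant frames correspond to each other. -/
theorem frame_matching : M'.X (φ t) = jacobian φ t *ᵥ M.X t ∧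
    M'.Y (φ t) = s • (jacobian φ t *ᵥ M.Y t) := by
  set J := jacobian φ t with hJdef
  have hJu : IsUnit J.det := isUnit_iff_ne_zero.mpr hJ
  -- V and W are the pullback of the second frame, with the sign of I₁ absorbed into W. They satisfy
  -- the same linear relations as X and Y, so the differences solve the homogeneous system.
  set V := J⁻¹ *ᵥ M'.X (φ t) with hV
  set W := s • (J⁻¹ *ᵥ M'.Y (φ t)) with hW
  have hss : s * s = 1 := by rcases hs with rfl | rfl <;> norm_num
  have hJV : J *ᵥ V = M'.X (φ t) := by
    rw [hV, Matrix.mulVec_mulVec, Matrix.mul_nonsing_inv _ hJu, Matrix.one_mulVec]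
  have hJW : J *ᵥ W = s • M'.Y (φ t) := by
    rw [hW, Matrix.mulVec_smul, Matrix.mulVec_mulVec, Matrix.mul_nonsing_inv _ hJu,
      Matrix.one_mulVec]
  have hVd : ∀ {f f' : (Fin 2 → ℝ) → ℝ}, DifferentiableAt ℝ f' (φ t) →
      (∀ᶠ z in 𝓝 t, f z = f' (φ z)) → M'.derivX f' (φ t) = ∑ j, V j * pd j f t := by
    intro f f' hf' h
    rw [derivX_eq, ← hJV]
    simp only [pd_of_eventuallyEq_comp hφ hf' h, Matrix.mulVec, dotProduct, Fin.sum_univ_two]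
    ring
  have hWd : ∀ {f f' : (Fin 2 → ℝ) → ℝ}, DifferentiableAt ℝ f' (φ t) →
      (∀ᶠ z in 𝓝 t, f z = f' (φ z)) → M'.derivY f' (φ t) = s * ∑ j, W j * pd j f t := by
    intro f f' hf' h
    have : M'.Y (φ t) = s • (J *ᵥ W) := by rw [hJW, smul_smul, hss, one_smul]
    rw [derivY_eq, this]
    simp only [pd_of_eventuallyEq_comp hφ hf' h, Matrix.mulVec, dotProduct, Fin.sum_univ_two,
      Pi.smul_apply, smul_eq_mul]
    ring
  have dC := M'.smooth_Crho.differentiableAt_dom ht'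
  have dCc := M'.smooth_Cchi.differentiableAt_dom ht'
  have dQc := M'.smooth_Qchi.differentiableAt_dom ht'
  have dQg := M'.smooth_Qgamma.differentiableAt_dom ht'
  have vC := hC.self_of_nhds
  have vCc := hCc.self_of_nhds
  have vQc := hQc.self_of_nhds
  have vQg := hQg.self_of_nhds
  obtain ⟨eCg, eI2, eI3, eI4⟩ := I2_congr vC vCc vQc vQg
  obtain ⟨-, r2, r3, r4, r5⟩ := vacuumRelations ht hp hM
  obtain ⟨-, r2', r3', r4', r5'⟩ := vacuumRelations ht' (vC ▸ hp) hM'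
  rw [hWd dC hC, hI] at r2'
  rw [hVd dC hC, eCg, ← vC, ← vQc, ← vQg] at r3'
  rw [hVd dCc hCc, hVd dQg hQg, hWd dQg hQg, hWd dCc hCc, hWd dQc hQc, eCg, eI2, eI3, eI4, hI,
    ← vC] at r4'
  rw [hVd dCc hCc, hVd dQg hQg, hWd dQg hQg, hWd dCc hCc, hVd dQc hQc, eCg, eI2, eI3, eI4, hI,
    ← vC, ← vQc, ← vQg, he] at r5'
  simp only [derivX_eq, derivY_eq, Fin.sum_univ_two] at r2 r3 r4 r5 r2' r3' r4' r5'
  have huniq := frame_unique (p := M.Crho) (f := M.Cchi) (k := M.Qchi) (g := M.Qgamma) (t := t)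
    (V := V - M.X t) (W := W - M.Y t) (e := M.eps t) (C := M.Cgamma t) (I₁ := M.I1 t)
    (I₂ := M.I2 t) (I₃ := M.I3 t) (I₄ := M.I4 t)
    (by simp only [Fin.sum_univ_two, Pi.sub_apply]; linear_combination r3' - r3)
    (by
      simp only [Fin.sum_univ_two, Pi.sub_apply]
      rcases hs with rfl | rfl
      · linear_combination r2' - r2
      · linear_combination -r2' - r2)
    (by
      simp only [Fin.sum_univ_two, Pi.sub_apply]
      rcases hs with rfl | rfl
      · linear_combination r4' - r4
      · linear_combination -r4' - r4)
    (by
      simp only [Fin.sum_univ_two, Pi.sub_apply]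
      rcases hs with rfl | rfl
      · linear_combination r5' - r5
      · linear_combination r5' - r5)
    (by rw [← solvDet_eq]; exact hsd)
  have hVX : V = M.X t := sub_eq_zero.mp huniq.1
  have hWY : W = M.Y t := sub_eq_zero.mp huniq.2
  refine ⟨by rw [← hVX, hJV], ?_⟩
  rw [← hWY, hJW, smul_smul, hss, one_smul]

theorem g_matching : M.g t = (jacobian φ t)ᵀ * M'.g (φ t) * jacobian φ t := by
  obtain ⟨hX, hY⟩ := frame_matching hM hM' ht ht' hφ hJ hC hCc hQc hQg he hp hsd hs hI
  set J := jacobian φ t with hJdef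
  have hJu : IsUnit J.det := isUnit_iff_ne_zero.mpr hJ
  have hss : s * s = 1 := by rcases hs with rfl | rfl <;> norm_num
  have vC := hC.self_of_nhds
  -- In p g⁻¹ = X⊗X + εY⊗Y the vector Y enters quadratically, so the sign s drops out.
  have hG : (M'.g (φ t))⁻¹ = J * (M.g t)⁻¹ * Jᵀ := by
    ext i j
    apply mul_right_cancel₀ (vC ▸ hp)
    rw [inv_g_mul_Crho ht', hX, hY, he, ← vC]
    simp only [Matrix.mul_apply, Matrix.transpose_apply, Matrix.mulVec, dotProduct,
      Fin.sum_univ_two, Pi.smul_apply, smul_eq_mul]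
    have h := inv_g_mul_Crho ht
    linear_combination M.eps t * (J i 0 * M.Y t 0 + J i 1 * M.Y t 1)
        * (J j 0 * M.Y t 0 + J j 1 * M.Y t 1) * hss - J i 0 * J j 0 * h 0 0
      - J i 0 * J j 1 * h 0 1 - J i 1 * J j 0 * h 1 0 - J i 1 * J j 1 * h 1 1
  have hg' : M'.g (φ t) = (J * (M.g t)⁻¹ * Jᵀ)⁻¹ := by
    rw [← hG, Matrix.nonsing_inv_nonsing_inv _ (isUnit_iff_ne_zero.mpr (M'.det_g_ne _ ht'))]
  have hJtu : IsUnit Jᵀ.det := by rw [Matrix.det_transpose]; exact hJu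
  rw [hg', Matrix.mul_inv_rev, Matrix.mul_inv_rev,
    Matrix.nonsing_inv_nonsing_inv _ (isUnit_iff_ne_zero.mpr (M.det_g_ne _ ht)),
    ← Matrix.mul_assoc, Matrix.mul_nonsing_inv _ hJtu, Matrix.one_mul, Matrix.mul_assoc,
    Matrix.nonsing_inv_mul _ hJu, Matrix.mul_one]

/-- The covector dx/x is X with its index lowered by g, and both X and g are already matched. -/
theorem dlnx_matching (j : Fin 2) :
    M.dlnx t j = ∑ i, jacobian φ t i j * M'.dlnx (φ t) i := by
  obtain ⟨hX, hY⟩ := frame_matching hM hM' ht ht' hφ hJ hC hCc hQc hQg he hp hsd hs hI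
  have hg := g_matching hM hM' ht ht' hφ hJ hC hCc hQc hQg he hp hsd hs hI
  have h1 := g_mulVec_X ht j
  have h2 := g_mulVec_X ht'
  rw [← h1, Fin.sum_univ_two, ← h2, ← h2, hX, hg]
  simp only [Matrix.mul_apply, Matrix.transpose_apply, Matrix.mulVec, dotProduct,
      Fin.sum_univ_two]
  ring

theorem chi_matching (a b : Fin 2) :
    M.chi t a b = ∑ i, ∑ j, jacobian φ t i a * jacobian φ t j b * M'.chi (φ t) i j := by
  obtain ⟨hX, hY⟩ := frame_matching hM hM' ht ht' hφ hJ hC hCc hQc hQg he hp hsd hs hI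
  have hss : s * s = 1 := by rcases hs with rfl | rfl <;> norm_num
  have vC := hC.self_of_nhds
  have hp' : M'.Crho (φ t) ≠ 0 := vC ▸ hp
  have hee : M.eps t * M.eps t = 1 := by rcases eps_cases ht with h | h <;> rw [h] <;> norm_num
  have e1 := Cchi_frame ht hp
  have e1' := Cchi_frame ht' hp'
  have e2 := Qchi_frame ht hp
  have e2' := Qchi_frame ht' hp'
  have e3 := Qgamma_frame ht hp
  have e3' := Qgamma_frame ht' hp'
  have e4 := I1_frame hp
  have e4' := I1_frame hp'
  rw [← hCc.self_of_nhds, he, ← vC] at e1'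
  rw [← hQc.self_of_nhds, he, ← vC] at e2'
  rw [← hQg.self_of_nhds, he, ← vC] at e3'
  rw [hI, ← vC] at e4'
  -- In the frame Q_γ − Q_χ = −ε C_ρ χ(Y,Y)/(4C_ρ), which determines χ(Y,Y). Then C_χ determines
  -- χ(X,X), and I₁ determines χ(X,Y).
  have hYY : bilin (M'.chi (φ t)) (M'.Y (φ t)) (M'.Y (φ t)) / M.Crho t
      = bilin (M.chi t) (M.Y t) (M.Y t) / M.Crho t := by
    apply mul_left_cancel₀ hp
    linear_combination -(M.eps t * 4 * (e2' - e3' - e2 + e3))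
      - M.Crho t * (bilin (M'.chi (φ t)) (M'.Y (φ t)) (M'.Y (φ t)) / M.Crho t
      - bilin (M.chi t) (M.Y t) (M.Y t) / M.Crho t) * hee
  have hXX : bilin (M'.chi (φ t)) (M'.X (φ t)) (M'.X (φ t)) / M.Crho t
      = bilin (M.chi t) (M.X t) (M.X t) / M.Crho t := by
    linear_combination e1 - e1' - M.eps t * hYY
  have hXY : bilin (M'.chi (φ t)) (M'.X (φ t)) (M'.Y (φ t)) / M.Crho t
      = s * (bilin (M.chi t) (M.X t) (M.Y t) / M.Crho t) := by
    apply mul_left_cancel₀ hp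
    linear_combination 4 * e4' - 4 * s * e4
  have hXX' := (div_left_inj' hp).mp hXX
  have hYY' := (div_left_inj' hp).mp hYY
  rw [← mul_div_assoc] at hXY
  have hXY' := (div_left_inj' hp).mp hXY
  rw [hX] at hXX' hXY'
  rw [hY] at hXY' hYY'
  replace hXY' := (bilin_smul_right (M'.chi (φ t)) s _ _).symm.trans hXY'
  replace hYY' := ((bilin_smul_right (M'.chi (φ t)) s _ _).trans
    (congrArg (s * ·) (bilin_smul_left (M'.chi (φ t)) s _ _))).symm.trans hYY'
  have := eq_of_bilin_frame (X_cross_Y_ne_zero ht hp) (α := M.chi t)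
    (β := fun a b => ∑ i, ∑ j, jacobian φ t i a * jacobian φ t j b * M'.chi (φ t) i j)
    chi_symm (by simp only [Fin.sum_univ_two, chi_symm]; ring)
    ((bilin_pullback _ _ _ _).trans hXX').symm
    (by
      refine Eq.trans ?_ (bilin_pullback (M'.chi (φ t)) _ _ _).symm
      linear_combination -s * hXY' + (bilin (M'.chi (φ t)) (jacobian φ t *ᵥ M.X t)
        (jacobian φ t *ᵥ M.Y t) - bilin (M.chi t) (M.X t) (M.Y t)) * hss)
    (by
      refine Eq.trans ?_ (bilin_pullback (M'.chi (φ t)) _ _ _).symm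
      linear_combination -hYY' + bilin (M'.chi (φ t)) (jacobian φ t *ᵥ M.Y t)
        (jacobian φ t *ᵥ M.Y t) * hss)
  exact congrFun (congrFun this a) b

end Matching

end AdaptedMetric

/-- Passage from germs to domains: a property known near t₀ is made to hold on the entire source of
a smaller local diffeomorphism. -/
theorem OpenPartialHomeomorph.exists_restriction
    (φ : OpenPartialHomeomorph (Fin 2 → ℝ) (Fin 2 → ℝ)) {t₀ : Fin 2 → ℝ} (h₀ : t₀ ∈ φ.source)
    (hφ : ContDiffOn ℝ ∞ φ φ.source) (hψ : ContDiffOn ℝ ∞ φ.symm φ.target)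
    {P : (Fin 2 → ℝ) → Prop} (hP : ∀ᶠ t in 𝓝 t₀, P t) :
    ∃ φ' : OpenPartialHomeomorph (Fin 2 → ℝ) (Fin 2 → ℝ), t₀ ∈ φ'.source ∧
      φ'.source ⊆ φ.source ∧ φ'.target ⊆ φ.target ∧ (∀ t, φ' t = φ t) ∧
      ContDiffOn ℝ ∞ φ' φ'.source ∧ ContDiffOn ℝ ∞ φ'.symm φ'.target ∧
      ∀ t ∈ φ'.source, P t := by
  obtain ⟨V, hVP, hV, h₀V⟩ := eventually_nhds_iff.mp hP
  refine ⟨φ.restrOpen V hV, ?_, ?_, ?_, fun _ => rfl, ?_, ?_, ?_⟩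
  · rw [φ.restrOpen_source]; exact ⟨h₀, h₀V⟩
  · rw [φ.restrOpen_source]; exact Set.inter_subset_left
  · exact Set.inter_subset_left
  · rw [φ.restrOpen_source]; exact hφ.mono Set.inter_subset_left
  · exact hψ.mono Set.inter_subset_left
  · rw [φ.restrOpen_source]; exact fun t ht => hVP t ht.2

/-! ### Matching on a neighbourhood -/

namespace AdaptedMetric

variable {M M' : AdaptedMetric} {Λ : ℝ} {t₀ t₀' : Fin 2 → ℝ}

theorem continuousAt_I1 (ht : t₀ ∈ M.dom) : ContinuousAt M.I1 t₀ := by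
  have c := fun {f : (Fin 2 → ℝ) → ℝ} (hf : ContDiffOn ℝ ∞ f M.dom) =>
    (hf.differentiableAt_dom ht).continuousAt
  have hs : ContinuousAt (fun t => √|(M.g t).det|) t₀ :=
    Real.continuous_sqrt.continuousAt.comp (c M.smooth_det_g).abs
  have hd := fun i => c (M.smooth_dlnx i)
  have hY0 : ContinuousAt (fun t => M.Y t 0) t₀ := by
    simp only [Y_zero]
    exact ((hd 1).div hs (sqrt_det_ne ht)).neg
  have hY1 : ContinuousAt (fun t => M.Y t 1) t₀ := by
    simp only [Y_one]
    exact (hd 0).div hs (sqrt_det_ne ht)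
  have hX : ∀ i, ContinuousAt (fun t => M.X t i) t₀ := fun i => by
    simp only [X_apply]
    exact ((c (M.smooth_inv_g i 0)).mul (hd 0)).add ((c (M.smooth_inv_g i 1)).mul (hd 1))
  have hchi := fun i j => c (M.smooth_chi i j)
  have : M.I1 = fun t => -(1 / 4) * (M.X t 0 * (M.chi t 0 0 * M.Y t 0 + M.chi t 0 1 * M.Y t 1)
      + M.X t 1 * (M.chi t 1 0 * M.Y t 0 + M.chi t 1 1 * M.Y t 1)) := by
    funext t
    simp only [I1, Matrix.mulVec, dotProduct, Fin.sum_univ_two]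
  rw [this]
  exact continuousAt_const.mul (((hX 0).mul (((hchi 0 0).mul hY0).add ((hchi 0 1).mul hY1))).add
    ((hX 1).mul (((hchi 1 0).mul hY0).add ((hchi 1 1).mul hY1))))

theorem eventually_eps_eq (ht : t₀ ∈ M.dom) : ∀ᶠ t in 𝓝 t₀, M.eps t = M.eps t₀ := by
  have hc := (M.smooth_det_g.differentiableAt_dom ht).continuousAt
  rcases lt_or_gt_of_ne (M.det_g_ne t₀ ht) with h | h
  · filter_upwards [hc.eventually_lt continuousAt_const h] with t h'
    simp only [eps, Real.sign_of_neg h, Real.sign_of_neg h']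
  · filter_upwards [continuousAt_const.eventually_lt hc h] with t h'
    simp only [eps, Real.sign_of_pos h, Real.sign_of_pos h']

theorem smooth_jac {U : Set (Fin 2 → ℝ)} (hU : IsOpen U) {f k : (Fin 2 → ℝ) → ℝ}
    (hf : ContDiffOn ℝ ∞ f U) (hk : ContDiffOn ℝ ∞ k U) : ContDiffOn ℝ ∞ (jac f k) U :=
  ((hf.pd hU 0).mul (hk.pd hU 1)).sub ((hf.pd hU 1).mul (hk.pd hU 0))

theorem eventually_solvDet_ne (ht : t₀ ∈ M.dom) (h : M.solvDet t₀ ≠ 0) :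
    ∀ᶠ t in 𝓝 t₀, M.solvDet t ≠ 0 := by
  have c := fun {f : (Fin 2 → ℝ) → ℝ} (hf : ContDiffOn ℝ ∞ f M.dom) =>
    (hf.differentiableAt_dom ht).continuousAt
  have hj := fun {k : (Fin 2 → ℝ) → ℝ} (hk : ContDiffOn ℝ ∞ k M.dom) =>
    c (smooth_jac M.isOpen_dom M.smooth_Crho hk)
  have cI := continuousAt_I1 ht
  have cC := c M.smooth_Crho
  have cg := c M.smooth_Cgamma
  have cq := c M.smooth_Qchi
  have cQ := c M.smooth_Qgamma
  have j1 := hj M.smooth_Cchi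
  have j2 := hj M.smooth_Qchi
  have j3 := hj M.smooth_Qgamma
  rw [solvDet_eq] at h
  -- Freezing the locally constant ε at t₀ avoids the discontinuity of the sign function.
  have hcont : ContinuousAt (fun t => M.eps t₀ * M.I1 t ^ 2
      * (1 / 4 * M.Cgamma t * jac M.Crho M.Cchi t - 1 / 2 * jac M.Crho M.Qgamma t) ^ 2
    + (1 / 2 * M.I2 t * jac M.Crho M.Qgamma t - 1 / 2 * M.I3 t * jac M.Crho M.Cchi t
      - M.I4 t * jac M.Crho M.Qchi t) ^ 2) t₀ := by
    simp only [I2, I3, I4]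
    fun_prop
  filter_upwards [hcont.eventually_ne h, eventually_eps_eq ht] with t h1 h2
  rwa [solvDet_eq, h2]

theorem inv_matching {k : Fin 3} {F : Fin 3 → ℝ → ℝ → ℝ} {φ : (Fin 2 → ℝ) → Fin 2 → ℝ}
    (hφ : ContinuousAt φ t₀) (h₀ : φ t₀ = t₀')
    (hp : ∀ᶠ t in 𝓝 t₀, M'.Crho (φ t) = M.Crho t) (hq : ∀ᶠ t in 𝓝 t₀, M'.inv k (φ t) = M.inv k t)
    (hF : ∀ j, j ≠ k → ∀ᶠ t in 𝓝 t₀, M.inv j t = F j (M.Crho t) (M.inv k t))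
    (hF' : ∀ j, j ≠ k → ∀ᶠ t in 𝓝 t₀', M'.inv j t = F j (M'.Crho t) (M'.inv k t)) (j : Fin 3) :
    ∀ᶠ t in 𝓝 t₀, M.inv j t = M'.inv j (φ t) := by
  by_cases hj : j = k
  · subst hj
    filter_upwards [hq] with t h using h.symm
  · have hφ' : Filter.Tendsto φ (𝓝 t₀) (𝓝 t₀') := h₀ ▸ hφ
    filter_upwards [hp, hq, hF j hj, hφ'.eventually (hF' j hj)] with t h1 h2 h3 h4
    rw [h3, h4, h1, h2]

theorem eps_eq_of_det_pos {t t' : Fin 2 → ℝ} (h : 0 < (M.g t).det * (M'.g t').det) :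
    M'.eps t' = M.eps t := by
  rcases mul_pos_iff.mp h with ⟨h1, h2⟩ | ⟨h1, h2⟩
  · simp only [eps, Real.sign_of_pos h1, Real.sign_of_pos h2]
  · simp only [eps, Real.sign_of_neg h1, Real.sign_of_neg h2]

theorem I1_sq_congr {t t' : Fin 2 → ℝ} (hM : M.IsVacuum Λ) (hM' : M'.IsVacuum Λ) (ht : t ∈ M.dom)
    (ht' : t' ∈ M'.dom) (hp : M.Crho t ≠ 0) (he : M'.eps t' = M.eps t)
    (hC : M.Crho t = M'.Crho t') (hCc : M.Cchi t = M'.Cchi t')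
    (hQc : M.Qchi t = M'.Qchi t') (hQg : M.Qgamma t = M'.Qgamma t') :
    M'.I1 t' ^ 2 = M.I1 t ^ 2 := by
  rw [(vacuumRelations ht hp hM).1, (vacuumRelations ht' (hC ▸ hp) hM').1, he,
    (I2_congr hC hCc hQc hQg).1, hC, hQc, hQg]

/-- The metric `g`, the covector `dx/x` and the form `χ` of `M` are pulled back from `M'`. -/
structure Matches (M M' : AdaptedMetric) (φ : (Fin 2 → ℝ) → Fin 2 → ℝ) (t : Fin 2 → ℝ) : Prop where
  g : M.g t = (jacobian φ t)ᵀ * M'.g (φ t) * jacobian φ t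
  dlnx : ∀ j, M.dlnx t j = ∑ i, jacobian φ t i j * M'.dlnx (φ t) i
  chi : ∀ a b, M.chi t a b = ∑ i, ∑ j, jacobian φ t i a * jacobian φ t j b * M'.chi (φ t) i j
  Qgamma : M.Qgamma t = M'.Qgamma (φ t)
  Cgamma : M'.Cgamma (φ t) = M.Cgamma t

theorem exists_matching {k : Fin 3} {F : Fin 3 → ℝ → ℝ → ℝ} (hM : M.IsVacuum Λ)
    (hM' : M'.IsVacuum Λ) (ht : t₀ ∈ M.dom) (ht' : t₀' ∈ M'.dom)
    (hg : 0 < (M.g t₀).det * (M'.g t₀').det) (hC : M.Crho t₀ ≠ 0) (hsd : M.solvDet t₀ ≠ 0)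
    (hj : jac M.Crho (M.inv k) t₀ ≠ 0) (hj' : jac M'.Crho (M'.inv k) t₀' ≠ 0)
    (hp : M.Crho t₀ = M'.Crho t₀') (hq : M.inv k t₀ = M'.inv k t₀')
    (hF : ∀ j, j ≠ k → ∀ᶠ t in 𝓝 t₀, M.inv j t = F j (M.Crho t) (M.inv k t))
    (hF' : ∀ j, j ≠ k → ∀ᶠ t in 𝓝 t₀', M'.inv j t = F j (M'.Crho t) (M'.inv k t)) :
    ∃ φ : OpenPartialHomeomorph (Fin 2 → ℝ) (Fin 2 → ℝ), t₀ ∈ φ.source ∧ φ t₀ = t₀' ∧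
      φ.source ⊆ M.dom ∧ φ.target ⊆ M'.dom ∧ ContDiffOn ℝ ∞ φ φ.source ∧
      ContDiffOn ℝ ∞ φ.symm φ.target ∧ ∀ᶠ t in 𝓝 t₀, Matches M M' φ t := by
  obtain ⟨φ, hs₀, hφ₀, hsU, htU, hφ, hψ, hpq⟩ := exists_localDiffeo M.isOpen_dom M'.isOpen_dom
    M.smooth_Crho (M.smooth_inv k) M'.smooth_Crho (M'.smooth_inv k) ht ht' hj hj' hp hq
  refine ⟨φ, hs₀, hφ₀, hsU, htU, hφ, hψ, ?_⟩
  have hsrc : ∀ᶠ t in 𝓝 t₀, t ∈ φ.source := φ.open_source.mem_nhds hs₀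
  have hcont : ContinuousAt φ t₀ := φ.continuousAt hs₀
  have htend : Filter.Tendsto φ (𝓝 t₀) (𝓝 t₀') := hφ₀ ▸ hcont
  have hinv := inv_matching hcont hφ₀ (hsrc.mono fun t h => (hpq t h).1)
    (hsrc.mono fun t h => (hpq t h).2) hF hF'
  have mC : ∀ᶠ t in 𝓝 t₀, M.Crho t = M'.Crho (φ t) := hsrc.mono fun t h => (hpq t h).1.symm
  have mq := hinv k
  have mCc : ∀ᶠ t in 𝓝 t₀, M.Cchi t = M'.Cchi (φ t) := hinv 0
  have mQc : ∀ᶠ t in 𝓝 t₀, M.Qchi t = M'.Qchi (φ t) := hinv 1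
  have mQg : ∀ᶠ t in 𝓝 t₀, M.Qgamma t = M'.Qgamma (φ t) := hinv 2
  have he₀ := eps_eq_of_det_pos hg
  have he : ∀ᶠ t in 𝓝 t₀, M'.eps (φ t) = M.eps t := by
    filter_upwards [eventually_eps_eq ht, htend.eventually (eventually_eps_eq ht')] with t h1 h2
    rw [h1, h2, he₀]
  have hCne : ∀ᶠ t in 𝓝 t₀, M.Crho t ≠ 0 :=
    (M.smooth_Crho.differentiableAt_dom ht).continuousAt.eventually_ne hC
  have hjne : ∀ᶠ t in 𝓝 t₀, jac M.Crho (M.inv k) t ≠ 0 :=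
    ((smooth_jac M.isOpen_dom M.smooth_Crho (M.smooth_inv k)).differentiableAt_dom
      ht).continuousAt.eventually_ne hj
  have hI₀ : M.I1 t₀ ≠ 0 := I1_ne_zero ht hM hC hsd
  have hsq₀ : M'.I1 t₀' ^ 2 = M.I1 t₀ ^ 2 := by
    rw [← hφ₀]
    exact I1_sq_congr hM hM' ht (htU (φ.map_source hs₀)) hC he.self_of_nhds mC.self_of_nhds
      mCc.self_of_nhds mQc.self_of_nhds mQg.self_of_nhds
  obtain ⟨s, hs, hsI⟩ : ∃ s : ℝ, (s = 1 ∨ s = -1) ∧ M'.I1 t₀' = s * M.I1 t₀ := by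
    rcases sq_eq_sq_iff_eq_or_eq_neg.mp hsq₀ with h | h
    · exact ⟨1, Or.inl rfl, by rw [h, one_mul]⟩
    · exact ⟨-1, Or.inr rfl, by rw [h, neg_one_mul]⟩
  -- The squares of I₁ agree near t₀; continuity and I₁ ≠ 0 at t₀ make the relative sign constant
  -- there.
  have hpos : ∀ᶠ t in 𝓝 t₀, 0 < s * (M'.I1 (φ t) * M.I1 t) := by
    have hcI : ContinuousAt (fun t => M'.I1 (φ t)) t₀ :=
      ContinuousAt.comp (g := M'.I1) (f := φ) (by rw [hφ₀]; exact continuousAt_I1 ht') hcont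
    have hc : ContinuousAt (fun t => s * (M'.I1 (φ t) * M.I1 t)) t₀ :=
      continuousAt_const.mul (hcI.mul (continuousAt_I1 ht))
    refine continuousAt_const.eventually_lt hc ?_
    rw [hφ₀, hsI]
    have : 0 < M.I1 t₀ ^ 2 := by positivity
    rcases hs with rfl | rfl <;> nlinarith
  filter_upwards [hsrc, mC.eventually_nhds, mq.eventually_nhds, mCc.eventually_nhds,
    mQc.eventually_nhds, mQg.eventually_nhds, he, hCne, hjne, eventually_solvDet_ne ht hsd, hpos]
    with t h1 h2 h3 h4 h5 h6 h7 h8 h9 h10 h11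
  have hd : DifferentiableAt ℝ φ t :=
    (hφ.contDiffAt (φ.open_source.mem_nhds h1)).differentiableAt (by simp)
  have htd' := htU (φ.map_source h1)
  have hJ : (jacobian φ t).det ≠ 0 := by
    intro h0
    apply h9
    rw [jac_of_eventuallyEq_comp hd (M'.smooth_Crho.differentiableAt_dom htd') h2
      ((M'.smooth_inv k).differentiableAt_dom htd') h3, h0, zero_mul]
  have hI : M'.I1 (φ t) = s * M.I1 t := by
    have hsq := I1_sq_congr hM hM' (hsU h1) htd' h8 h7 h2.self_of_nhds h4.self_of_nhds
      h5.self_of_nhds h6.self_of_nhds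
    rcases hs with rfl | rfl <;> rcases sq_eq_sq_iff_eq_or_eq_neg.mp hsq with h | h
    · rw [h, one_mul]
    · rw [h] at h11; nlinarith [sq_nonneg (M.I1 t)]
    · rw [h] at h11; nlinarith [sq_nonneg (M.I1 t)]
    · rw [h, neg_one_mul]
  exact ⟨g_matching hM hM' (hsU h1) htd' hd hJ h2 h4 h5 h6 h7 h8 h10 hs hI,
    dlnx_matching hM hM' (hsU h1) htd' hd hJ h2 h4 h5 h6 h7 h8 h10 hs hI,
    chi_matching hM hM' (hsU h1) htd' hd hJ h2 h4 h5 h6 h7 h8 h10 hs hI, h6.self_of_nhds,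
    (I2_congr h2.self_of_nhds h4.self_of_nhds h5.self_of_nhds h6.self_of_nhds).1⟩

/-- Hence `det h` is pulled back from `det h'` up to a constant factor. -/
theorem x_matching {φ : (Fin 2 → ℝ) → Fin 2 → ℝ} {U : Set (Fin 2 → ℝ)} (hU : IsOpen U)
    (hUd : U ⊆ M.dom) (hUd' : ∀ t ∈ U, φ t ∈ M'.dom) (hφ : ContDiffOn ℝ ∞ φ U) (h₀ : t₀ ∈ U)
    (hm : ∀ t ∈ U, ∀ j, M.dlnx t j = ∑ i, jacobian φ t i j * M'.dlnx (φ t) i) :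
    ∀ᶠ t in 𝓝 t₀, M'.x (φ t) = M'.x (φ t₀) / M.x t₀ * M.x t := by
  have dφ : ∀ t ∈ U, DifferentiableAt ℝ φ t := fun t ht =>
    (hφ.contDiffAt (hU.mem_nhds ht)).differentiableAt (by simp)
  have dx' : ∀ t ∈ U, DifferentiableAt ℝ M'.x (φ t) := fun t ht =>
    M'.smooth_x.differentiableAt_dom (hUd' t ht)
  have d1 : ∀ t ∈ U, DifferentiableAt ℝ (fun z => M'.x (φ z)) t := fun t ht =>
    (dx' t ht).comp t (dφ t ht)
  have d2 : ∀ t ∈ U, DifferentiableAt ℝ M.x t := fun t ht =>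
    M.smooth_x.differentiableAt_dom (hUd ht)
  have hne : ∀ t ∈ U, M.x t ≠ 0 := fun t ht => x_ne_zero (hUd ht)
  have := eventually_eq_of_pd_eq_zero (f := fun t => M'.x (φ t) / M.x t) hU h₀
    (fun t ht => by
      simpa only [div_eq_mul_inv] using (d1 t ht).fun_mul ((d2 t ht).fun_inv (hne t ht)))
    (fun t ht i => by
      have := hne t ht
      rw [pd_div (d1 t ht) (d2 t ht) (hne t ht), pd_comp (dx' t ht) (dφ t ht),
        pd_x_eq_mul (hUd ht), hm t ht]
      simp only [pd_x_eq_mul (hUd' t ht), jacobian, Matrix.of_apply, Fin.sum_univ_two]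
      field_simp
      ring)
  filter_upwards [this, hU.mem_nhds h₀] with t h1 h2
  have := hne t h2
  rw [← h1]; field_simp

end AdaptedMetric

/-! ### Multilinearity and coordinate derivatives -/

theorem triple_add_mid (u v v' w : Fin 3 → ℝ) :
    triple u (v + v') w = triple u v w + triple u v' w := by
  simp only [triple, Pi.add_apply]; ring

theorem triple_smul_mid (r : ℝ) (u v w : Fin 3 → ℝ) :
    triple u (r • v) w = r * triple u v w := by
  simp only [triple, Pi.smul_apply, smul_eq_mul]; ring

theorem triple_add_right (u v w w' : Fin 3 → ℝ) :
    triple u v (w + w') = triple u v w + triple u v w' := by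
  simp only [triple, Pi.add_apply]; ring

theorem triple_smul_right (r : ℝ) (u v w : Fin 3 → ℝ) :
    triple u v (r • w) = r * triple u v w := by
  simp only [triple, Pi.smul_apply, smul_eq_mul]; ring

theorem detPolar_add_right (u v w : Fin 3 → ℝ) :
    detPolar u (v + w) = detPolar u v + detPolar u w := by
  simp only [detPolar, Pi.add_apply]; ring

theorem detPolar_smul_right (r : ℝ) (u v : Fin 3 → ℝ) :
    detPolar u (r • v) = r * detPolar u v := by
  simp only [detPolar, Pi.smul_apply, smul_eq_mul]; ring

theorem detPolar_add_left (u v w : Fin 3 → ℝ) :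
    detPolar (u + v) w = detPolar u w + detPolar v w := by
  simp only [detPolar, Pi.add_apply]; ring

theorem detPolar_smul_left (r : ℝ) (u v : Fin 3 → ℝ) :
    detPolar (r • u) v = r * detPolar u v := by
  simp only [detPolar, Pi.smul_apply, smul_eq_mul]; ring

theorem pd_coord {ι : Type*} [Fintype ι] [DecidableEq ι] (i j : ι) (y : ι → ℝ) :
    pd i (fun z => z j) y = if i = j then 1 else 0 := by
  have : HasFDerivAt (fun z : ι → ℝ => z j) (ContinuousLinearMap.proj (R := ℝ) j) y :=
    (ContinuousLinearMap.proj (R := ℝ) (φ := fun _ : ι => ℝ) j).hasFDerivAt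
  rw [pd, this.fderiv, ContinuousLinearMap.proj_apply, Pi.single_apply]
  simp only [eq_comm]

/-! ### From matched surfaces to isometries -/

namespace AdaptedMetric

variable {M M' : AdaptedMetric} {Λ : ℝ} {t₀ : Fin 2 → ℝ}

section
variable {φ : OpenPartialHomeomorph (Fin 2 → ℝ) (Fin 2 → ℝ)} (h₀ : t₀ ∈ φ.source)
  (hsU : φ.source ⊆ M.dom) (htU : φ.target ⊆ M'.dom) (hφ : ContDiffOn ℝ ∞ φ φ.source)

include hφ in
theorem jacobian_adaptedMap (A : Matrix (Fin 2) (Fin 2) ℝ) {y : Fin 2 ⊕ Fin 2 → ℝ}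
    (hy : y ∘ Sum.inl ∈ φ.source) :
    jacobian (adaptedMap φ A) y = Matrix.fromBlocks (jacobian φ (y ∘ Sum.inl)) 0 0 A := by
  have hd : ∀ i, DifferentiableAt ℝ (fun z => φ z i) (y ∘ Sum.inl) := fun i =>
    (contDiffOn_pi.mp hφ i).differentiableAt_of_isOpen φ.open_source hy
  have hlin : ∀ a k, pd a (fun z : Fin 2 ⊕ Fin 2 → ℝ => (A *ᵥ (z ∘ Sum.inr)) k) y
      = ∑ m, A k m * if a = Sum.inr m then 1 else 0 := by
    intro a k
    have hc : ∀ m, DifferentiableAt ℝ (fun z : Fin 2 ⊕ Fin 2 → ℝ => z (Sum.inr m)) y :=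
      fun m => (ContinuousLinearMap.proj (R := ℝ) (φ := fun _ : Fin 2 ⊕ Fin 2 => ℝ)
        (Sum.inr m)).differentiableAt
    change pd a (fun z => ∑ m, A k m * z (Sum.inr m)) y = _
    rw [pd_sum _ fun m _ => (hc m).const_mul _]
    exact Finset.sum_congr rfl fun m _ => by rw [pd_const_mul _ (hc m), pd_coord]
  ext (i | i) (j | j)
  · exact pd_comp_inl_inl (hd i) j
  · exact pd_comp_inl_inr (hd i) j
  · exact (hlin _ _).trans (by simp)
  · exact (hlin _ _).trans (by simp)

include hsU htU hφ in
theorem locallyEquivalent_of_congruence (hg : ∀ t ∈ φ.source, M.g t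
      = (jacobian φ t)ᵀ * M'.g (φ t) * jacobian φ t)
    (hψ : ContDiffOn ℝ ∞ φ.symm φ.target) (h₀ : t₀ ∈ φ.source)
    {P : Matrix (Fin 2) (Fin 2) ℝ} (hP : P.det ≠ 0)
    (hh : ∀ t ∈ φ.source, M'.h (φ t) = P * M.h t * Pᵀ) : M.LocallyEquivalent M' t₀ (φ t₀) := by
  have hPu : IsUnit P.det := isUnit_iff_ne_zero.mpr hP
  have hPtu : IsUnit Pᵀ.det := by rw [Matrix.det_transpose]; exact hPu
  -- The pullback condition is Aᵀ h' A = h; substituting h' = P h Pᵀ forces the choice A = (Pᵀ)⁻¹.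
  set A : GL (Fin 2) ℝ := (Matrix.GeneralLinearGroup.mkOfDetNeZero Pᵀ hPtu.ne_zero)⁻¹ with hA
  have hA1 : (A : Matrix (Fin 2) (Fin 2) ℝ) = (Pᵀ)⁻¹ := by
    rw [hA, Matrix.coe_units_inv]; rfl
  refine ⟨φ, A, h₀, rfl, hsU, htU, hφ, hψ, fun y hy => ?_⟩
  rw [jacobian_adaptedMap hφ _ hy, hA1]
  have h1 : adaptedMap φ (Pᵀ)⁻¹ y ∘ Sum.inl = φ (y ∘ Sum.inl) := rfl
  have hAh : ((Pᵀ)⁻¹)ᵀ * M'.h (φ (y ∘ Sum.inl)) * (Pᵀ)⁻¹ = M.h (y ∘ Sum.inl) := by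
    rw [hh _ hy, ← Matrix.transpose_nonsing_inv, Matrix.transpose_transpose, Matrix.mul_assoc P,
      ← Matrix.mul_assoc, Matrix.nonsing_inv_mul _ hPu, Matrix.one_mul, Matrix.mul_assoc,
      Matrix.transpose_nonsing_inv, Matrix.mul_nonsing_inv _ hPtu, Matrix.mul_one]
  rw [full, full, h1, hg _ hy]
  simp only [Matrix.fromBlocks_transpose, Matrix.fromBlocks_multiply, Matrix.transpose_zero,
    Matrix.mul_zero, Matrix.zero_mul, add_zero, zero_add, hAh]

section Surfaces

variable {c : ℝ} (hm : ∀ t ∈ φ.source, Matches M M' φ t)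
  (hx : ∀ t ∈ φ.source, M'.x (φ t) = c * M.x t)

include htU hφ

theorem smooth_hvec_comp (a : Fin 3) :
    ContDiffOn ℝ ∞ (fun z => M'.hvec (φ z) a) φ.source :=
  (smooth_hvec (M := M') a).comp hφ fun _ ht => htU (φ.map_source ht)

theorem pdv_hvec_comp {t : Fin 2 → ℝ} (ht : t ∈ φ.source) (i : Fin 2) :
    pdv i (fun z => M'.hvec (φ z)) t = ∑ a, jacobian φ t a i • pdv a M'.hvec (φ t) :=
  pdv_comp (fun k => (smooth_hvec k).differentiableAt_dom (htU (φ.map_source ht)))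
    ((hφ.contDiffAt (φ.open_source.mem_nhds ht)).differentiableAt (by simp)) i

include hsU hm hx in
-- The inner products are x, x(dx/x)/2 and xχ. Covectors and forms are pulled back exactly, and the
-- constant c comes only from the prefactor x.
theorem detPolar_matching {t : Fin 2 → ℝ} (ht : t ∈ φ.source) :
    detPolar (M'.hvec (φ t)) (M'.hvec (φ t)) = c * detPolar (M.hvec t) (M.hvec t) ∧
    (∀ i, detPolar (M'.hvec (φ t)) (pdv i (fun z => M'.hvec (φ z)) t)
      = c * detPolar (M.hvec t) (pdv i M.hvec t)) ∧
    ∀ i j, detPolar (pdv i (fun z => M'.hvec (φ z)) t) (pdv j (fun z => M'.hvec (φ z)) t)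
      = c * detPolar (pdv i M.hvec t) (pdv j M.hvec t) := by
  have ht' := htU (φ.map_source ht)
  refine ⟨?_, fun i => ?_, fun i j => ?_⟩
  · rw [detPolar_hvec ht', detPolar_hvec (hsU ht), hx t ht]
  · rw [pdv_hvec_comp htU hφ ht, detPolar_hvec_pdv (hsU ht), (hm t ht).dlnx]
    simp only [Fin.sum_univ_two, detPolar_add_right, detPolar_smul_right, detPolar_hvec_pdv ht',
      hx t ht]
    ring
  · rw [pdv_hvec_comp htU hφ ht, pdv_hvec_comp htU hφ ht, detPolar_pdv_pdv (hsU ht),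
      (hm t ht).chi]
    simp only [Fin.sum_univ_two, detPolar_add_right, detPolar_smul_right, detPolar_add_left,
      detPolar_smul_left, detPolar_pdv_pdv ht', hx t ht]
    ring

include hsU h₀ hm hx

/-- By `triple_hvec_sq` the position vector and the tangent vectors are independent, so they serve
as the moving frame. -/
theorem exists_linear_hvec_of_Qgamma_ne_zero (hc : c ≠ 0) (hQ : ∀ t ∈ φ.source, M.Qgamma t ≠ 0) :
    ∃ L : Matrix (Fin 3) (Fin 3) ℝ, Lᵀ * detPolarMatrix * L = c • detPolarMatrix ∧
      ∀ᶠ t in 𝓝 t₀, M'.hvec (φ t) = L *ᵥ M.hvec t := by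
  have key := fun {t : Fin 2 → ℝ} (ht : t ∈ φ.source) => detPolar_matching hsU htU hφ hm hx ht
  refine exists_linear_of_nondegenerate (H' := fun z => M'.hvec (φ z)) φ.open_source h₀
    (fun a => (smooth_hvec a).mono hsU) (smooth_hvec_comp htU hφ) (fun t ht => (key ht).1)
    (fun t ht => (key ht).2.1) (fun t ht => (key ht).2.2) hc fun t ht h => ?_
  have h2 := triple_hvec_sq (hsU ht)
  rw [h] at h2
  have : 4 * M.x t ^ 3 * (M.Qgamma t * (M.g t).det) ≠ 0 :=
    mul_ne_zero (mul_ne_zero four_ne_zero (pow_ne_zero 3 (x_ne_zero (hsU ht))))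
      (mul_ne_zero (hQ t ht) (M.det_g_ne t (hsU ht)))
  exact this (by rw [← h2]; ring)

/-- The vector v supplies one fixed direction in which h and its derivative span a nondegenerate
plane; the Gram determinant of this pair is x²γ(v,v). Planarity to second order holds for both
surfaces and survives the reparametrisation by the chain rule. -/
theorem exists_linear_hvec_of_Qgamma_eq_zero (hc : 0 < c) (hM : M.IsVacuum Λ)
    (hM' : M'.IsVacuum Λ) (hQ : ∀ t ∈ φ.source, M.Qgamma t = 0)
    (hCg : ∀ t ∈ φ.source, M.Cgamma t ≠ 0) (v : Fin 2 → ℝ)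
    (hv : ∀ t ∈ φ.source, bilin (M.gamma t) v v ≠ 0) :
    ∃ L : Matrix (Fin 3) (Fin 3) ℝ, Lᵀ * detPolarMatrix * L = c • detPolarMatrix ∧
      ∀ᶠ t in 𝓝 t₀, M'.hvec (φ t) = L *ᵥ M.hvec t := by
  have key := fun {t : Fin 2 → ℝ} (ht : t ∈ φ.source) => detPolar_matching hsU htU hφ hm hx ht
  have hQ' : ∀ t ∈ φ.target, M'.Qgamma t = 0 := fun t ht => by
    have h1 := φ.map_target ht
    rw [← hQ _ h1, (hm _ h1).Qgamma, φ.right_inv ht]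
  have h3' : ∀ t ∈ φ.source, ∀ i j,
      triple (M'.hvec (φ t)) (pdv i M'.hvec (φ t)) (pdv j M'.hvec (φ t)) = 0 := fun t ht =>
    triple_hvec_eq_zero (htU (φ.map_source ht)) (hQ' _ (φ.map_source ht))
  have h4' : ∀ t ∈ φ.source, ∀ i j k,
      triple (M'.hvec (φ t)) (pdv k M'.hvec (φ t)) (pdv i (pdv j M'.hvec) (φ t)) = 0 := fun t ht =>
    triple_hvec_second hM' φ.open_target htU hQ' (φ.map_source ht)
      (by rw [(hm t ht).Cgamma]; exact hCg t ht)
  refine exists_linear_of_degenerate (H' := fun z => M'.hvec (φ z)) φ.open_source h₀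
    (fun a => (smooth_hvec a).mono hsU) (smooth_hvec_comp htU hφ) (fun t ht => (key ht).1)
    (fun t ht => (key ht).2.1) (fun t ht => (key ht).2.2) hc v (fun t ht => ?_)
    (fun t ht => triple_hvec_eq_zero (hsU ht) (hQ t ht)) (fun t ht i j => ?_)
    (fun t ht => triple_hvec_second hM φ.open_source hsU hQ ht (hCg t ht)) (fun t ht i j k => ?_)
  · have h1 : detPolar (M.hvec t) (M.hvec t)
          * detPolar (dirDeriv v M.hvec t) (dirDeriv v M.hvec t)
        - detPolar (M.hvec t) (dirDeriv v M.hvec t) ^ 2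
        = M.x t ^ 2 * bilin (M.gamma t) v v := by
      rw [detPolar_dirDeriv, detPolar_dirDeriv, detPolar_comm (dirDeriv v M.hvec t),
        detPolar_comm (dirDeriv v M.hvec t), detPolar_dirDeriv, detPolar_dirDeriv]
      simp only [detPolar_hvec (hsU ht), detPolar_hvec_pdv (hsU ht), detPolar_pdv_pdv (hsU ht),
        bilin, Fin.sum_univ_two, gamma_apply]
      ring
    rw [h1]
    exact mul_ne_zero (pow_ne_zero 2 (x_ne_zero (hsU ht))) (hv t ht)
  · rw [pdv_hvec_comp htU hφ ht, pdv_hvec_comp htU hφ ht]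
    simp only [Fin.sum_univ_two, triple_add_mid, triple_smul_mid, triple_add_right,
      triple_smul_right, h3' t ht, mul_zero, add_zero]
  · rw [pdv_hvec_comp htU hφ ht, pdv_pdv_comp M'.isOpen_dom φ.open_source smooth_hvec hφ
      (fun t ht => htU (φ.map_source ht)) ht]
    simp only [Fin.sum_univ_two, triple_add_mid, triple_smul_mid, triple_add_right,
      triple_smul_right, h3' t ht, h4' t ht, mul_zero, add_zero]

end Surfaces

end

theorem symMatrix_hvec {t : Fin 2 → ℝ} (ht : t ∈ M.dom) : symMatrix (M.hvec t) = M.h t := by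
  ext i j
  fin_cases i <;> fin_cases j <;> simp [symMatrix, hvec, h_symm ht]

/-- A nonzero quadratic form is nonzero on some fixed direction near a point. -/
theorem exists_bilin_gamma_ne_zero (ht : t₀ ∈ M.dom) (hC : M.Cgamma t₀ ≠ 0) :
    ∃ v : Fin 2 → ℝ, ∀ᶠ t in 𝓝 t₀, bilin (M.gamma t) v v ≠ 0 := by
  obtain ⟨v, hv⟩ : ∃ v : Fin 2 → ℝ, bilin (M.gamma t₀) v v ≠ 0 := by
    by_contra! h
    have h0 := h ![1, 0]
    have h1 := h ![0, 1]
    have h2 := h ![1, 1]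
    simp [bilin, Fin.sum_univ_two, gamma_symm] at h0 h1 h2
    rw [h0, h1] at h2
    have h3 : M.gamma t₀ 0 1 = 0 := by linarith
    exact hC (by rw [Cgamma_apply ht, h0, h1, h3]; ring)
  refine ⟨v, ContinuousAt.eventually_ne ?_ hv⟩
  have c := fun i j => ((M.smooth_gamma i j).differentiableAt_dom ht).continuousAt
  simp only [bilin, Fin.sum_univ_two]
  have c00 := c 0 0
  have c01 := c 0 1
  have c10 := c 1 0
  have c11 := c 1 1
  fun_prop

/-- The local equivalence of generic vacuum metrics with the same relations between their
first-order invariants, up to the sign of `h`. -/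
theorem exists_congruence {t₀' : Fin 2 → ℝ} {k : Fin 3} {F : Fin 3 → ℝ → ℝ → ℝ}
    (hM : M.IsVacuum Λ)
    (hM' : M'.IsVacuum Λ) (ht : t₀ ∈ M.dom) (ht' : t₀' ∈ M'.dom)
    (hg : 0 < (M.g t₀).det * (M'.g t₀').det) (hh : 0 < (M.h t₀).det * (M'.h t₀').det)
    (hgen : M.IsGenericAt t₀)
    (hj : jac M.Crho (M.inv k) t₀ ≠ 0) (hj' : jac M'.Crho (M'.inv k) t₀' ≠ 0)
    (hp : M.Crho t₀ = M'.Crho t₀') (hq : M.inv k t₀ = M'.inv k t₀')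
    (hF : ∀ j, j ≠ k → ∀ᶠ t in 𝓝 t₀, M.inv j t = F j (M.Crho t) (M.inv k t))
    (hF' : ∀ j, j ≠ k → ∀ᶠ t in 𝓝 t₀', M'.inv j t = F j (M'.Crho t) (M'.inv k t)) :
    ∃ (φ : OpenPartialHomeomorph (Fin 2 → ℝ) (Fin 2 → ℝ)) (e : ℝ) (P : Matrix (Fin 2) (Fin 2) ℝ),
      t₀ ∈ φ.source ∧ φ t₀ = t₀' ∧ φ.source ⊆ M.dom ∧ φ.target ⊆ M'.dom ∧
      ContDiffOn ℝ ∞ φ φ.source ∧ ContDiffOn ℝ ∞ φ.symm φ.target ∧ (e = 1 ∨ e = -1) ∧ P.det ≠ 0 ∧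
      ∀ t ∈ φ.source, M.g t = (jacobian φ t)ᵀ * M'.g (φ t) * jacobian φ t ∧
        M'.h (φ t) = e • (P * M.h t * Pᵀ) := by
  obtain ⟨hC, hCQ, hsd, hQ⟩ := hgen
  obtain ⟨φ₁, hs₁, e₁, hsU₁, htU₁, hφ₁, hψ₁, hm₁⟩ :=
    exists_matching hM hM' ht ht' hg hC hsd hj hj' hp hq hF hF'
  obtain ⟨φ₂, hs₂, hsU₂, htU₂, e₂, hφ₂, hψ₂, hm₂⟩ := φ₁.exists_restriction hs₁ hφ₁ hψ₁ hm₁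
  have ee₂ : (φ₂ : (Fin 2 → ℝ) → Fin 2 → ℝ) = φ₁ := funext e₂
  rw [← ee₂] at hm₂
  have hx₂ := x_matching φ₂.open_source (hsU₂.trans hsU₁)
    (fun t h => htU₁ (htU₂ (φ₂.map_source h))) hφ₂ hs₂ fun t h => (hm₂ t h).dlnx
  have hc : 0 < M'.x (φ₂ t₀) / M.x t₀ := by
    rw [e₂, e₁]
    rcases mul_pos_iff.mp hh with ⟨h1, h2⟩ | ⟨h1, h2⟩
    exacts [div_pos h2 h1, div_pos_of_neg_of_neg h2 h1]
  set c := M'.x (φ₂ t₀) / M.x t₀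
  have hL : ∃ L : Matrix (Fin 3) (Fin 3) ℝ, Lᵀ * detPolarMatrix * L = c • detPolarMatrix ∧
      ∀ᶠ t in 𝓝 t₀, M'.hvec (φ₂ t) = L *ᵥ M.hvec t := by
    rcases hQ with hQ | hQ
    · have hQ' := (M.smooth_Qgamma.differentiableAt_dom ht).continuousAt.eventually_ne hQ
      obtain ⟨φ₃, hs₃, hsU₃, htU₃, e₃, hφ₃, hψ₃, hm₃⟩ :=
        φ₂.exists_restriction hs₂ hφ₂ hψ₂ (hx₂.and hQ')
      rw [← funext e₃] at hm₃ hm₂ ⊢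
      exact exists_linear_hvec_of_Qgamma_ne_zero hs₃ (hsU₃.trans (hsU₂.trans hsU₁))
        (htU₃.trans (htU₂.trans htU₁)) hφ₃ (fun t h => hm₂ t (hsU₃ h)) (fun t h => (hm₃ t h).1)
        hc.ne' fun t h => (hm₃ t h).2
    -- With Q_γ = 0 the condition I₄ ≠ 0 reduces to C_γ ≠ 0, which the planarity argument needs.
    · have hCg : M.Cgamma t₀ ≠ 0 := fun h => hCQ (by rw [h, hQ.self_of_nhds]; norm_num)
      have hCg' := (M.smooth_Cgamma.differentiableAt_dom ht).continuousAt.eventually_ne hCg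
      obtain ⟨v, hv⟩ := exists_bilin_gamma_ne_zero ht hCg
      obtain ⟨φ₃, hs₃, hsU₃, htU₃, e₃, hφ₃, hψ₃, hm₃⟩ :=
        φ₂.exists_restriction hs₂ hφ₂ hψ₂ (hx₂.and (hQ.and (hCg'.and hv)))
      rw [← funext e₃] at hm₃ hm₂ ⊢
      exact exists_linear_hvec_of_Qgamma_eq_zero hs₃ (hsU₃.trans (hsU₂.trans hsU₁))
        (htU₃.trans (htU₂.trans htU₁)) hφ₃ (fun t h => hm₂ t (hsU₃ h)) (fun t h => (hm₃ t h).1)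
        hc hM hM' (fun t h => (hm₃ t h).2.1) (fun t h => (hm₃ t h).2.2.1) v
        fun t h => (hm₃ t h).2.2.2
  obtain ⟨L, hL, hLev⟩ := hL
  obtain ⟨e, P, he, hP, hcong⟩ := exists_congruence_of_similarity hc hL
  obtain ⟨φ, hs, hsU, htU, eφ, hφ, hψ, hm⟩ := φ₂.exists_restriction hs₂ hφ₂ hψ₂ hLev
  rw [← funext eφ] at hm hm₂
  have hsd := hsU.trans (hsU₂.trans hsU₁)
  have htd := htU.trans (htU₂.trans htU₁)
  refine ⟨φ, e, P, hs, by rw [eφ, e₂, e₁], hsd, htd, hφ, hψ, he, hP,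
    fun t h => ⟨(hm₂ t (hsU h)).g, ?_⟩⟩
  rw [← symMatrix_hvec (hsd h), ← symMatrix_hvec (htd (φ.map_source h)), hm t h, hcong]

/-- Congruence preserves definiteness. Completing the square writes the product as a square plus det
h times a square. -/
theorem congruence_apply_mul_nonneg {t : Fin 2 → ℝ} (ht : t ∈ M.dom) (hx : 0 < (M.h t).det)
    (P : Matrix (Fin 2) (Fin 2) ℝ) : 0 ≤ M.h t 0 0 * (P * M.h t * Pᵀ) 0 0 := by
  rw [Matrix.det_fin_two, h_symm ht] at hx
  have : M.h t 0 0 * (P * M.h t * Pᵀ) 0 0 = (M.h t 0 0 * P 0 0 + M.h t 0 1 * P 0 1) ^ 2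
      + (M.h t 0 0 * M.h t 1 1 - M.h t 0 1 * M.h t 0 1) * P 0 1 ^ 2 := by
    simp only [Matrix.mul_apply, Matrix.transpose_apply, Fin.sum_univ_two, h_symm ht]; ring
  rw [this]
  positivity

end AdaptedMetric

/-- In the last clause, det h > 0 and the positive product of determinants make both orbit metrics
definite; the product of their first diagonal entries then says that they have the same sign. -/
theorem mainTheorem2 (Λ : ℝ) :
    (∀ M : AdaptedMetric, M.IsVacuum Λ → ∀ t ∈ M.dom, M.Crho t ≠ 0 → M.VacuumRelations Λ t) ∧
    (∀ (M M' : AdaptedMetric) (t₀ t₀' : Fin 2 → ℝ) (k : Fin 3) (F : Fin 3 → ℝ → ℝ → ℝ),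
      M.IsVacuum Λ → M'.IsVacuum Λ → t₀ ∈ M.dom → t₀' ∈ M'.dom →
      0 < (M.g t₀).det * (M'.g t₀').det → 0 < (M.h t₀).det * (M'.h t₀').det →
      M.IsGenericAt t₀ →
      AdaptedMetric.jac M.Crho (M.inv k) t₀ ≠ 0 →
      AdaptedMetric.jac M'.Crho (M'.inv k) t₀' ≠ 0 →
      M.Crho t₀ = M'.Crho t₀' → M.inv k t₀ = M'.inv k t₀' →
      (∀ j, j ≠ k → ∀ᶠ t in 𝓝 t₀, M.inv j t = F j (M.Crho t) (M.inv k t)) →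
      (∀ j, j ≠ k → ∀ᶠ t in 𝓝 t₀', M'.inv j t = F j (M'.Crho t) (M'.inv k t)) →
      (M.LocallyEquivalent M' t₀ t₀' ∨ M.LocallyEquivalent M'.negH t₀ t₀') ∧
      (0 < (M.h t₀).det → 0 < M.h t₀ 0 0 * M'.h t₀' 0 0 → M.LocallyEquivalent M' t₀ t₀')) := by
  refine ⟨fun M hM t ht hp => AdaptedMetric.vacuumRelations ht hp hM, ?_⟩
  intro M M' t₀ t₀' k F hM hM' ht ht' hg hh hgen hj hj' hp hq hF hF'
  obtain ⟨φ, e, P, hs, rfl, hsd, htd, hφ, hψ, he, hP, hm⟩ :=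
    AdaptedMetric.exists_congruence hM hM' ht ht' hg hh hgen hj hj' hp hq hF hF'
  have hpos : e = 1 → M.LocallyEquivalent M' t₀ (φ t₀) := fun h1 =>
    AdaptedMetric.locallyEquivalent_of_congruence hsd htd hφ (fun t h => (hm t h).1) hψ hs hP
      fun t h => by rw [(hm t h).2, h1, one_smul]
  refine ⟨?_, fun hx h00 => ?_⟩
  · rcases he with h1 | h1
    · exact Or.inl (hpos h1)
    · exact Or.inr (AdaptedMetric.locallyEquivalent_of_congruence (M' := M'.negH) hsd htd hφ
        (fun t h => (hm t h).1) hψ hs hP fun t h => by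
          change -M'.h (φ t) = _
          rw [(hm t h).2, h1, neg_one_smul, neg_neg])
  · rcases he with h1 | h1
    · exact hpos h1
    -- For e = −1 the first entries of h and h' could not have a positive product.
    · have := AdaptedMetric.congruence_apply_mul_nonneg ht hx P
      rw [(hm t₀ hs).2, h1, neg_one_smul, Matrix.neg_apply] at h00
      linarith
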